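/- Let $k$ be an algebraically closed field of characteristic different from $2$, let $V$ be a $3$-dimensional $k$-vector space with a nondegenerate symmetric bilinear form $(\,,)$, and let $G=GL(V)$, $K=SO(V)$. For a subspace $V'\subset V$ put $V'^{\perp}=\{x\in V:(x,V')=0\}$. Let $\mathcal B$ be the flag variety of $G$, that is, the variety of pairs $(L,P)$ where $L\subset P$, $L$ is a line and $P$ a plane in $V$. Let $Q\subset\mathbb P(V)$ be the conic of lines $L$ with $L\subset L^{\perp}$ and let $Q'$ be the set of planes $P$ with $P^{\perp}\subset P$. Put $$\mathcal O_0=\{(L,P)\in\mathcal B:L\in Q,P\in Q'\},\quad \mathcal O_1=\{(L,P)\in\mathcal B:L\in Q,P\notin Q'\},$$ $$\mathcal O_2=\{(L,P)\in\mathcal B:L\notin Q,P\in Q'\},\quad \mathcal O_3=\{(L,P)\in\mathcal B:L\notin Q,P\notin Q'\}.$$ Then $\mathcal O_0,\mathcal O_1,\mathcal O_2,\mathcal O_3$ are pairwise distinct and are exactly the $K$-orbits on $\mathcal B$. The Zariski closures of $\mathcal O_1$ and $\mathcal O_2$ are $\bar{\mathcal O}_1=\{(L,P)\in\mathcal B:L\in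 Q\}$ and $\bar{\mathcal O}_2=\{(L,P)\in\mathcal B:P\in Q'\}$. There exists $g\in G$ such that $Q\cap gQ$ consists of exactly four points. For every such $g$, let $E=\bar{\mathcal O}_1\cap g\bar{\mathcal O}_2$, with its structure of a (reduced) subvariety of $\mathcal B$. Then: (a) $E$ is an elliptic curve, i.e. it is isomorphic as a variety to a plane projective Weierstrass cubic with nonzero discriminant. (b) $Q$ is isomorphic to $\mathbb P^1$, and $(L,P)\mapsto L$ defines a double covering $E\to Q$ (a finite, locally free morphism of degree $2$) branched exactly at the four points of $Q\cap gQ$: its fibre over each of these points is a single point, and every other fibre consists of two points. (c) $\mathcal O_1\cap g\mathcal O_0$ and $\mathcal O_0\cap g\mathcal O_2$ consist of four points each, their union $S$ is a subset of $E$ with exactly eight points, and $\mathcal O_1\cap g\mathcal O_2=E\setminus S$. Thus $\mathcal O_1\cap g\mathcal O_2$ is the elliptic curve $E$ with eight points removed. -/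

import Mathlib

open scoped LinearAlgebra.Projectivization Pointwise
open Filter Topology

universe u v w

/-- A space with functions over a field `k`: a topological space together with a sheaf of
`k`-algebras of `k`-valued functions. The sheaf is given by its germs: `RegularAt f x` says that
`f` is regular in some neighbourhood of `x`; the value of `f` away from `x` is irrelevant, and
the regular functions on an open set `U` are those that are regular at each point of `U`. -/
structure SpaceWithFunctions (k : Type u) [Field k] where
  carrier : Type v
  [top : TopologicalSpace carrier]
  RegularAt : (carrier → k) → carrier → Prop
  const : ∀ (c : k) (x : carrier), RegularAt (fun _ => c) x
  add : ∀ {f g : carrier → k} {x : carrier},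
    RegularAt f x → RegularAt g x → RegularAt (fun y => f y + g y) x
  mul : ∀ {f g : carrier → k} {x : carrier},
    RegularAt f x → RegularAt g x → RegularAt (fun y => f y * g y) x
  congr : ∀ {f g : carrier → k} {x : carrier}, f =ᶠ[𝓝 x] g → RegularAt f x → RegularAt g x
  isOpen_regularAt : ∀ f : carrier → k, IsOpen {x | RegularAt f x}

namespace SpaceWithFunctions

attribute [instance] SpaceWithFunctions.top

variable {k : Type u} [Field k]

instance : CoeSort (SpaceWithFunctions.{u, v} k) (Type v) := ⟨SpaceWithFunctions.carrier⟩

/-- The `k`-algebra of regular functions on the whole space. -/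
def globalSections (X : SpaceWithFunctions.{u, v} k) : Subalgebra k (X → k) where
  carrier := {f | ∀ x, X.RegularAt f x}
  mul_mem' hf hg x := X.mul (hf x) (hg x)
  add_mem' hf hg x := X.add (hf x) (hg x)
  algebraMap_mem' c x := X.const c x

/-- The structure induced on a subset (for a locally closed subset of a variety: the reduced
subvariety): the induced topology, and functions that extend locally to regular functions. -/
def sub (X : SpaceWithFunctions.{u, v} k) (Z : Set X) : SpaceWithFunctions.{u, v} k where
  carrier := Z
  RegularAt f z := ∃ F : X → k, X.RegularAt F z ∧ f =ᶠ[𝓝 z] fun y => F y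
  const c z := ⟨fun _ => c, X.const c z, Eventually.of_forall fun _ => rfl⟩
  add := by
    rintro f g z ⟨F, hF, hf⟩ ⟨G, hG, hg⟩
    exact ⟨_, X.add hF hG, hf.add hg⟩
  mul := by
    rintro f g z ⟨F, hF, hf⟩ ⟨G, hG, hg⟩
    exact ⟨_, X.mul hF hG, hf.mul hg⟩
  congr := by
    rintro f g z hfg ⟨F, hF, hf⟩
    exact ⟨F, hF, hfg.symm.trans hf⟩
  isOpen_regularAt f := by
    rw [isOpen_iff_eventually]
    rintro z ⟨F, hF, hf⟩
    have h1 : ∀ᶠ y : Z in 𝓝 z, X.RegularAt F y :=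
      continuous_subtype_val.continuousAt.eventually ((X.isOpen_regularAt F).mem_nhds hF)
    filter_upwards [h1, eventually_eventually_nhds.2 hf] with y hy hy'
    exact ⟨F, hy, hy'⟩

/-- The quotient structure along `π : X → Y`: `U ⊆ Y` is open if and only if `π ⁻¹' U` is open,
and `f` is regular on the open set `U` if and only if `f ∘ π` is regular on `π ⁻¹' U`. -/
def quotient (X : SpaceWithFunctions.{u, v} k) {Y : Type w} (π : X → Y) :
    SpaceWithFunctions.{u, w} k :=
  letI : TopologicalSpace Y := TopologicalSpace.coinduced π X.top
  { carrier := Y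
    RegularAt := fun f y =>
      ∃ U : Set Y, IsOpen U ∧ y ∈ U ∧ ∀ x, π x ∈ U → X.RegularAt (fun x => f (π x)) x
    const := fun c y => ⟨Set.univ, isOpen_univ, trivial, fun x _ => X.const c x⟩
    add := by
      rintro f g y ⟨U, hU, hyU, hf⟩ ⟨U', hU', hyU', hg⟩
      exact ⟨U ∩ U', hU.inter hU', ⟨hyU, hyU'⟩, fun x hx => X.add (hf x hx.1) (hg x hx.2)⟩
    mul := by
      rintro f g y ⟨U, hU, hyU, hf⟩ ⟨U', hU', hyU', hg⟩
      exact ⟨U ∩ U', hU.inter hU', ⟨hyU, hyU'⟩, fun x hx => X.mul (hf x hx.1) (hg x hx.2)⟩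
    congr := by
      rintro f g y hfg ⟨U, hU, hyU, hf⟩
      obtain ⟨U', hU'fg, hU', hyU'⟩ := eventually_nhds_iff.1 hfg
      refine ⟨U ∩ U', hU.inter hU', ⟨hyU, hyU'⟩, fun x hx => X.congr ?_ (hf x hx.1)⟩
      have hπ : Continuous π := continuous_coinduced_rng
      filter_upwards [(hU'.preimage hπ).mem_nhds hx.2] with x' hx'
      exact hU'fg _ hx'
    isOpen_regularAt := by
      intro f
      rw [isOpen_iff_forall_mem_open]
      rintro y ⟨U, hU, hyU, hf⟩
      exact ⟨U, fun y' hy' => ⟨U, hU, hy', hf⟩, hU, hyU⟩ }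

section Affine

variable (k) (W : Type w) [AddCommGroup W] [Module k W]

/-- The algebra of polynomial functions on a `k`-vector space: it is generated by the linear
functionals. -/
def polynomialFunctions : Subalgebra k (W → k) :=
  Algebra.adjoin k {f | ∃ ℓ : Module.Dual k W, f = ℓ}

/-- A vector space as an affine space: the Zariski topology, whose closed sets are the zero sets
of families of polynomial functions, and functions that are locally quotients of polynomial
functions. -/
def affineSpace : SpaceWithFunctions.{u, w} k :=
  letI : TopologicalSpace W :=
    TopologicalSpace.generateFrom {U | ∃ p ∈ polynomialFunctions k W, U = {x | p x ≠ 0}}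
  have hopen : ∀ q ∈ polynomialFunctions k W, IsOpen {x | q x ≠ 0} := fun q hq =>
    TopologicalSpace.isOpen_generateFrom_of_mem ⟨q, hq, rfl⟩
  { carrier := W
    RegularAt := fun f x => ∃ p ∈ polynomialFunctions k W, ∃ q ∈ polynomialFunctions k W,
      q x ≠ 0 ∧ f =ᶠ[𝓝 x] fun y => p y / q y
    const := fun c x => ⟨algebraMap k (W → k) c, Subalgebra.algebraMap_mem _ c, 1,
      Subalgebra.one_mem _, by simp, Eventually.of_forall fun y => by simp⟩
    add := by
      rintro f g x ⟨p, hp, q, hq, hqx, hf⟩ ⟨p', hp', q', hq', hqx', hg⟩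
      refine ⟨p * q' + q * p', Subalgebra.add_mem _ (Subalgebra.mul_mem _ hp hq')
        (Subalgebra.mul_mem _ hq hp'), q * q', Subalgebra.mul_mem _ hq hq',
        mul_ne_zero hqx hqx', ?_⟩
      have h1 : ∀ᶠ y in 𝓝 x, q y ≠ 0 :=
        (hopen q hq).mem_nhds hqx
      have h2 : ∀ᶠ y in 𝓝 x, q' y ≠ 0 :=
        (hopen q' hq').mem_nhds hqx'
      filter_upwards [hf, hg, h1, h2] with y h3 h4 h5 h6
      rw [h3, h4, div_add_div _ _ h5 h6]
      rfl
    mul := by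
      rintro f g x ⟨p, hp, q, hq, hqx, hf⟩ ⟨p', hp', q', hq', hqx', hg⟩
      refine ⟨p * p', Subalgebra.mul_mem _ hp hp', q * q', Subalgebra.mul_mem _ hq hq',
        mul_ne_zero hqx hqx', ?_⟩
      filter_upwards [hf, hg] with y h3 h4
      rw [h3, h4, div_mul_div_comm]
      rfl
    congr := by
      rintro f g x hfg ⟨p, hp, q, hq, hqx, hf⟩
      exact ⟨p, hp, q, hq, hqx, hfg.symm.trans hf⟩
    isOpen_regularAt := by
      intro f
      rw [isOpen_iff_eventually]
      rintro x ⟨p, hp, q, hq, hqx, hf⟩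
      have h1 : ∀ᶠ y in 𝓝 x, q y ≠ 0 :=
        (hopen q hq).mem_nhds hqx
      filter_upwards [h1, eventually_eventually_nhds.2 hf] with y h2 h3
      exact ⟨p, hp, q, hq, h2, h3⟩ }

/-- The projective space of lines in `W`, as the quotient of `W ∖ {0}` by scaling. -/
def projectiveSpace : SpaceWithFunctions.{u, w} k :=
  ((affineSpace k W).sub {x : W | x ≠ 0}).quotient (Projectivization.mk' k : _ → ℙ k W)

end Affine

/-- A morphism is a continuous map that pulls regular functions back to regular functions. -/
def IsMorphism (X : SpaceWithFunctions.{u, v} k) (Y : SpaceWithFunctions.{u, w} k)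
    (φ : X → Y) : Prop :=
  Continuous φ ∧ ∀ (f : Y → k) (x : X), Y.RegularAt f (φ x) → X.RegularAt (fun x => f (φ x)) x

/-- `X` and `Y` are isomorphic. -/
def Isomorphic (X : SpaceWithFunctions.{u, v} k) (Y : SpaceWithFunctions.{u, w} k) : Prop :=
  ∃ e : X ≃ Y, IsMorphism X Y e ∧ IsMorphism Y X e.symm

/-- `X` is isomorphic to a Zariski closed subset of an affine space `k ^ n`. -/
def IsAffine (X : SpaceWithFunctions.{u, v} k) : Prop :=
  ∃ (n : ℕ) (Z : Set (affineSpace k (Fin n → k))),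
    IsClosed Z ∧ Isomorphic X ((affineSpace k (Fin n → k)).sub Z)

/-- `π : X → Y` is finite and locally free of degree `d`: it is a morphism, and `Y` is covered by
affine open sets `U` such that `π ⁻¹' U` is affine and the ring of regular functions on `π ⁻¹' U`
is free of rank `d` over the ring of regular functions on `U`, with basis `b`. -/
def IsFiniteLocallyFree (X : SpaceWithFunctions.{u, v} k) (Y : SpaceWithFunctions.{u, w} k)
    (π : X → Y) (d : ℕ) : Prop :=
  IsMorphism X Y π ∧ ∀ y : Y, ∃ U : Set Y, IsOpen U ∧ y ∈ U ∧
    (Y.sub U).IsAffine ∧ (X.sub (π ⁻¹' U)).IsAffine ∧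
    ∃ b : Fin d → (X.sub (π ⁻¹' U)).globalSections,
      ∀ h : (X.sub (π ⁻¹' U)).globalSections, ∃! c : Fin d → (Y.sub U).globalSections,
        ∀ x : ↥(π ⁻¹' U), h.1 x = ∑ i, (c i).1 ⟨π x.1, x.2⟩ * (b i).1 x

/-- `π : X → Y` is a double covering with branch locus `S`: it is finite locally free of degree
two, its fibres over the points of `S` are single points, and all its other fibres consist of two
points. -/
def IsDoubleCoverBranchedAt (X : SpaceWithFunctions.{u, v} k) (Y : SpaceWithFunctions.{u, w} k)
    (π : X → Y) (S : Set Y) : Prop :=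
  IsFiniteLocallyFree X Y π 2 ∧ (∀ y ∈ S, (π ⁻¹' {y}).ncard = 1) ∧
    ∀ y ∉ S, (π ⁻¹' {y}).ncard = 2

/-- `X` is isomorphic to the projective line. -/
def IsProjectiveLine (X : SpaceWithFunctions.{u, v} k) : Prop :=
  Isomorphic X (projectiveSpace k (Fin 2 → k))

/-- The points of the plane projective curve given by a Weierstrass equation. -/
def weierstrassPoints (C : WeierstrassCurve k) : Set (projectiveSpace k (Fin 3 → k)) :=
  {x : ℙ k (Fin 3 → k) | C.toProjective.Equation x.rep}

/-- `X` is an elliptic curve: it is isomorphic, as a variety, to the plane projective curve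
given by a Weierstrass equation with invertible discriminant. -/
def IsEllipticCurve (X : SpaceWithFunctions.{u, v} k) : Prop :=
  ∃ C : WeierstrassCurve k, C.IsElliptic ∧
    Isomorphic X ((projectiveSpace k (Fin 3 → k)).sub (weierstrassPoints C))

end SpaceWithFunctions

/-- A full flag `L ⊆ P` in a three-dimensional space `V`: a line and a plane containing it. -/
@[ext]
structure FullFlag (k : Type u) (V : Type v) [Field k] [AddCommGroup V] [Module k V] where
  L : ℙ k V
  P : Submodule k V
  finrank_P : Module.finrank k P = 2
  le : L.submodule ≤ P

namespace FullFlag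

open LinearMap (GeneralLinearGroup)

variable {k : Type u} {V : Type v} [Field k] [AddCommGroup V] [Module k V]

/-- `GL(V)` acts on flags by `g • (L, P) = (g L, g P)`. -/
instance : MulAction (GeneralLinearGroup k V) (FullFlag k V) where
  smul g F :=
    { L := g • F.L
      P := F.P.map (g : V →ₗ[k] V)
      finrank_P := by
        rw [← F.finrank_P]
        exact (LinearEquiv.finrank_eq (g.toLinearEquiv.submoduleMap F.P)).symm
      le := by
        obtain ⟨L, P, hP, hL⟩ := F
        induction L with
        | h x hx =>
          rw [Projectivization.smul_mk, Projectivization.submodule_mk,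
            Submodule.span_singleton_le_iff_mem]
          rw [Projectivization.submodule_mk, Submodule.span_singleton_le_iff_mem] at hL
          exact Submodule.mem_map_of_mem hL }
  one_smul F := FullFlag.ext (one_smul _ F.L) (Submodule.map_id F.P)
  mul_smul g h F := FullFlag.ext (mul_smul g h F.L) (Submodule.map_comp _ _ F.P)

variable (k V) [Fact (Module.finrank k V = 3)]

/-- Homogeneous coordinates `(x, ξ)` of flags: a nonzero vector and a nonzero linear form that
vanishes on it. -/
def homogeneousCoordinates : Set (V × Module.Dual k V) :=
  {c | c.1 ≠ 0 ∧ c.2 ≠ 0 ∧ c.2 c.1 = 0}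

/-- The flag `(k x, ker ξ)` with homogeneous coordinates `(x, ξ)`. -/
def ofCoordinates (c : homogeneousCoordinates k V) : FullFlag k V where
  L := Projectivization.mk k c.1.1 c.2.1
  P := LinearMap.ker c.1.2
  finrank_P := by
    have h3 : Module.finrank k V = 3 := Fact.out
    have : FiniteDimensional k V := Module.finite_of_finrank_pos (by omega)
    have := Module.Dual.finrank_ker_add_one_of_ne_zero c.2.2.1
    omega
  le := by
    rw [Projectivization.submodule_mk, Submodule.span_singleton_le_iff_mem]
    exact c.2.2.2

/-- The flag variety of `GL(V)`, with its structure of an algebraic variety. -/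
def variety : SpaceWithFunctions.{u, v} k :=
  ((SpaceWithFunctions.affineSpace k (V × Module.Dual k V)).sub
    (homogeneousCoordinates k V)).quotient (ofCoordinates k V)

end FullFlag

section Orthogonal

open LinearMap (GeneralLinearGroup BilinForm)

variable {k : Type u} {V : Type v} [Field k] [AddCommGroup V] [Module k V]

/-- The special orthogonal group of a bilinear form. -/
def specialOrthogonal (B : BilinForm k V) : Subgroup (GeneralLinearGroup k V) where
  carrier := {g | (∀ x y : V, B ((g : V →ₗ[k] V) x) ((g : V →ₗ[k] V) y) = B x y) ∧
    LinearMap.det (g : V →ₗ[k] V) = 1}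
  one_mem' := by simp
  mul_mem' := by
    rintro g h ⟨hg, hg'⟩ ⟨hh, hh'⟩
    exact ⟨fun x y => by simp [hg, hh], by simp [hg', hh']⟩
  inv_mem' := by
    rintro g ⟨hg, hg'⟩
    have hinv : ∀ x : V,
        (g : V →ₗ[k] V) (((g⁻¹ : GeneralLinearGroup k V) : V →ₗ[k] V) x) = x := fun x => by
      rw [← Module.End.mul_apply, ← Units.val_mul, mul_inv_cancel, Units.val_one,
        Module.End.one_apply]
    refine ⟨fun x y => by rw [← hg, hinv, hinv], ?_⟩
    have h1 : LinearMap.det (g : V →ₗ[k] V) *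
        LinearMap.det ((g⁻¹ : GeneralLinearGroup k V) : V →ₗ[k] V) = 1 := by
      rw [← map_mul, ← Units.val_mul, mul_inv_cancel, Units.val_one, map_one]
    rwa [hg', one_mul] at h1

/-- The conic `Q` of isotropic lines, `L ⊆ Lᗮ`. -/
def isotropicLines (B : BilinForm k V) : Set (ℙ k V) :=
  {L | L.submodule ≤ B.orthogonal L.submodule}

/-- The condition `P ∈ Q'` on planes, `Pᗮ ⊆ P`. -/
def IsTangentPlane (B : BilinForm k V) (P : Submodule k V) : Prop :=
  B.orthogonal P ≤ P

/-- The sets of flags `𝒪₀`, `𝒪₁`, `𝒪₂`, `𝒪₃`. -/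
def flagOrbit (B : BilinForm k V) : Fin 4 → Set (FullFlag k V) :=
  ![{F | F.L ∈ isotropicLines B ∧ IsTangentPlane B F.P},
    {F | F.L ∈ isotropicLines B ∧ ¬ IsTangentPlane B F.P},
    {F | F.L ∉ isotropicLines B ∧ IsTangentPlane B F.P},
    {F | F.L ∉ isotropicLines B ∧ ¬ IsTangentPlane B F.P}]

/-- The closure of `𝒪ᵢ` in the flag variety for the Zariski topology. -/
def flagOrbitClosure [Fact (Module.finrank k V = 3)] (B : BilinForm k V) (i : Fin 4) :
    Set (FullFlag k V) :=
  closure (X := FullFlag.variety k V) (flagOrbit B i)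

end Orthogonal

/-!
Why the intersection is an elliptic curve. Replacing the form `B` by `B'(x, y) = B(g⁻¹ x, g⁻¹ y)`,
one has to study the flags `(L, P)` with `L` on the conic of `B` and `P` tangent to the conic of
`B'`, two conics with exactly four common points (`secantTangentFlags`). Everything is done in
explicit coordinates. A conic is parametrized by `s / t ↦ [s² : s t : t²]` in a basis in which its
form is `2 (x₁² - x₀ x₂)` (`IsConicBasis`), and its tangents by `v / w` (`tangentForm`). For each
common point of the two conics there are such bases of both forms which start with this point and
are related by four constants `α₀, α₁, β₀, β₁` (`IsConicFrame`). In these coordinates the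
incidence of the point `s / t` and the tangent `v / w` reads
  `w² (s² + α₀ s t + β₀ t²) - 2 v w t (α₁ s + β₁ t) = v² s t`,
and `x = s / t`, `y = x v / w` transforms it into
  `y² + 2 α₁ x y + 2 β₁ y = x³ + α₀ x² + β₀ x`
(`frameCurve`). Completing the square, the right-hand side becomes, up to a factor `2`, the form
`B'` restricted to the first conic, a cubic; its three roots are the common points other than the
one chosen, so they are distinct and the discriminant does not vanish (`IsConicFrame.isElliptic`).
The isomorphism is given by the graph `FrameRel`: each of the two parameters, and the point of the
cubic, has several homogeneous expressions in terms of the other data, and these cover everything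
(`IsConicFrame.exists_isomorphism`).

Varieties are spaces with functions, and projective space and the flag variety are quotients of
spaces of homogeneous coordinates. These quotients have local sections, so that a map given
locally by polynomials in homogeneous coordinates is a morphism
(`HasLocalSections.isMorphism_of_charts`).

The projection `(L, P) ↦ L` becomes `(x, y) ↦ x`, so over the complement of the chosen common
point it is the covering of the affine line by a curve `y² + a(x) y = b(x)`. Regular functions on
closed subsets of affine space are polynomials (`exists_mvPolynomial_of_regularAt`, from the
Nullstellensatz), and division by the monic quadratic equation shows that `1, y` is a basis
(`exists_basis_of_charts`). Two different common points give charts that cover the conic.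

The orbits are found from the fact that `SO(V)` permutes conic bases transitively up to
signs (`exists_specialOrthogonal_apply_eq`): every flag is the standard flag of its class in some conic
basis. The closures come from explicit pencils of flags (`mem_closure_of_line`). Finally a flag
with `L` on the first conic and `P` tangent to it has `P = L^⊥`, so the eight exceptional flags
correspond to the four common points and to the four common tangents of the two conics, and no
flag has this property for both conics (`disjoint_flagOrbit_zero`).
-/

/-! ### Morphisms of spaces with functions -/

namespace SpaceWithFunctions

variable {k : Type u} [Field k]

/-- `φ` is a morphism near the point `x`: it is continuous at `x` and pulls functions that are
regular at `φ x` back to functions that are regular at `x`. -/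
def MorphismAt (X : SpaceWithFunctions.{u, v} k) (Y : SpaceWithFunctions.{u, w} k)
    (φ : X → Y) (x : X) : Prop :=
  ContinuousAt φ x ∧ ∀ f : Y → k, Y.RegularAt f (φ x) → X.RegularAt (fun y => f (φ y)) x

theorem isMorphism_iff_morphismAt {X : SpaceWithFunctions.{u, v} k}
    {Y : SpaceWithFunctions.{u, w} k} {φ : X → Y} :
    IsMorphism X Y φ ↔ ∀ x, MorphismAt X Y φ x := by
  simp only [IsMorphism, MorphismAt, continuous_iff_continuousAt, forall_and]
  exact and_congr_right fun _ => forall_comm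

theorem MorphismAt.comp {X : SpaceWithFunctions.{u, v} k} {Y : SpaceWithFunctions.{u, w} k}
    {T : SpaceWithFunctions k} {φ : X → Y} {ψ : Y → T} {x : X}
    (hψ : MorphismAt Y T ψ (φ x)) (hφ : MorphismAt X Y φ x) :
    MorphismAt X T (fun y => ψ (φ y)) x :=
  ⟨ContinuousAt.comp (g := ψ) hψ.1 hφ.1, fun f hf => hφ.2 _ (hψ.2 f hf)⟩

theorem IsMorphism.comp {X : SpaceWithFunctions.{u, v} k} {Y : SpaceWithFunctions.{u, w} k}
    {T : SpaceWithFunctions k} {φ : X → Y} {ψ : Y → T}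
    (hψ : IsMorphism Y T ψ) (hφ : IsMorphism X Y φ) : IsMorphism X T (fun y => ψ (φ y)) :=
  ⟨hψ.1.comp hφ.1, fun f _ hf => hφ.2 _ _ (hψ.2 f _ hf)⟩

theorem MorphismAt.congr {X : SpaceWithFunctions.{u, v} k} {Y : SpaceWithFunctions.{u, w} k}
    {φ ψ : X → Y} {x : X} (h : MorphismAt X Y φ x) (e : φ =ᶠ[𝓝 x] ψ) : MorphismAt X Y ψ x := by
  refine ⟨h.1.congr e, fun f hf => X.congr (f := fun y => f (φ y)) ?_ (h.2 f ?_)⟩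
  · filter_upwards [e] with y hy
    rw [hy]
  · rwa [e.eq_of_nhds]

theorem isMorphism_subtype_val (X : SpaceWithFunctions.{u, v} k) (Z : Set X) :
    IsMorphism (X.sub Z) X Subtype.val :=
  ⟨continuous_subtype_val, fun f _ hf => ⟨f, hf, Eventually.of_forall fun _ => rfl⟩⟩

theorem MorphismAt.of_subtype_val {X : SpaceWithFunctions.{u, v} k}
    {Y : SpaceWithFunctions.{u, w} k} {Z : Set Y} {φ : X → Y.sub Z} {x : X}
    (h : MorphismAt X Y (fun y => (φ y).1) x) : MorphismAt X (Y.sub Z) φ x := by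
  have hc : ContinuousAt φ x := Topology.IsInducing.subtypeVal.continuousAt_iff.2 h.1
  refine ⟨hc, ?_⟩
  rintro f ⟨F, hF, hf⟩
  refine X.congr ?_ (h.2 F hF)
  filter_upwards [hc.eventually hf] with y hy using hy.symm

theorem IsMorphism.of_subtype_val {X : SpaceWithFunctions.{u, v} k}
    {Y : SpaceWithFunctions.{u, w} k} {Z : Set Y} {φ : X → Y.sub Z}
    (h : IsMorphism X Y (fun y => (φ y).1)) : IsMorphism X (Y.sub Z) φ :=
  isMorphism_iff_morphismAt.2 fun x => .of_subtype_val (isMorphism_iff_morphismAt.1 h x)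

theorem isMorphism_quotient (X : SpaceWithFunctions.{u, v} k) {Y : Type w} (π : X → Y) :
    IsMorphism X (X.quotient π) π :=
  ⟨continuous_coinduced_rng, fun _ x ⟨_, _, hx, h⟩ => h x hx⟩

/-- Every function that is regular and nonzero at a point is nonzero near this point, and its
inverse is regular there. -/
def InvertsUnits (X : SpaceWithFunctions.{u, v} k) : Prop :=
  ∀ (f : X → k) (x : X), X.RegularAt f x → f x ≠ 0 →
    (∀ᶠ y in 𝓝 x, f y ≠ 0) ∧ X.RegularAt (fun y => (f y)⁻¹) x

theorem InvertsUnits.sub {X : SpaceWithFunctions.{u, v} k} (hX : X.InvertsUnits) (Z : Set X) :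
    (X.sub Z).InvertsUnits := by
  rintro f z ⟨F, hF, hf⟩ h0
  rw [hf.eq_of_nhds] at h0
  obtain ⟨h1, h2⟩ := hX F z.1 hF h0
  refine ⟨?_, _, h2, ?_⟩
  · filter_upwards [hf, continuous_subtype_val.continuousAt.eventually h1] with y hy hy'
    rwa [hy]
  · filter_upwards [hf] with y hy
    rw [hy]

theorem InvertsUnits.quotient {X : SpaceWithFunctions.{u, v} k} (hX : X.InvertsUnits)
    {Y : Type w} {π : X → Y} : (X.quotient π).InvertsUnits := by
  rintro f y ⟨U, hU, hyU, hf⟩ h0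
  have hπc : @Continuous _ _ _ (X.quotient π).top π := (isMorphism_quotient X π).1
  let N : Set (X.quotient π) := {y | y ∈ U ∧ f y ≠ 0}
  have hN : IsOpen N := by
    refine isOpen_coinduced.2 (isOpen_iff_eventually.2 fun x hx => ?_)
    exact ((hU.preimage hπc).eventually_mem hx.1).and (hX _ x (hf x hx.1) hx.2).1
  refine ⟨?_, N, hN, ⟨hyU, h0⟩, fun x hx => (hX _ x (hf x hx.1) hx.2).2⟩
  filter_upwards [hN.eventually_mem (show y ∈ N from ⟨hyU, h0⟩)] with y' hy' using hy'.2

section Affine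

variable {W : Type w} [AddCommGroup W] [Module k W]

theorem dual_mem_polynomialFunctions (ℓ : Module.Dual k W) :
    (fun x => ℓ x) ∈ polynomialFunctions k W :=
  Algebra.subset_adjoin ⟨ℓ, rfl⟩

theorem isOpen_ne_zero {q : W → k} (hq : q ∈ polynomialFunctions k W) :
    IsOpen (X := affineSpace k W) {x | q x ≠ 0} :=
  TopologicalSpace.isOpen_generateFrom_of_mem ⟨q, hq, rfl⟩

/-- The sets `{q ≠ 0}` form a basis of the Zariski topology. -/
theorem exists_ne_zero_subset {U : Set (affineSpace k W)} (hU : IsOpen U) {x : affineSpace k W}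
    (hx : x ∈ U) : ∃ q ∈ polynomialFunctions k W, q x ≠ 0 ∧ ∀ y, q y ≠ 0 → y ∈ U := by
  have key : ∀ s : Set W, TopologicalSpace.GenerateOpen
      {U : Set W | ∃ p ∈ polynomialFunctions k W, U = {x | p x ≠ 0}} s → ∀ x ∈ s,
      ∃ q ∈ polynomialFunctions k W, q x ≠ 0 ∧ ∀ y, q y ≠ 0 → y ∈ s := by
    intro s hs
    induction hs with
    | basic s hs =>
      obtain ⟨p, hp, rfl⟩ := hs
      exact fun x hx => ⟨p, hp, hx, fun _ h => h⟩
    | univ => exact fun x _ => ⟨1, Subalgebra.one_mem _, one_ne_zero, fun _ _ => trivial⟩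
    | inter s t _ _ hs ht =>
      intro x hx
      obtain ⟨p, hp, h1, h2⟩ := hs x hx.1
      obtain ⟨q, hq, h3, h4⟩ := ht x hx.2
      exact ⟨p * q, Subalgebra.mul_mem _ hp hq, mul_ne_zero h1 h3,
        fun y hy => ⟨h2 y (left_ne_zero_of_mul hy), h4 y (right_ne_zero_of_mul hy)⟩⟩
    | sUnion S _ hS =>
      rintro x ⟨s, hs, hxs⟩
      obtain ⟨q, hq, h1, h2⟩ := hS s hs x hxs
      exact ⟨q, hq, h1, fun y hy => ⟨s, hs, h2 y hy⟩⟩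
  exact key U hU x hx

theorem affineSpace_invertsUnits : (affineSpace k W).InvertsUnits := by
  rintro f x ⟨p, hp, q, hq, hqx, hf⟩ h0
  have hpx : p x ≠ 0 := by
    rw [EventuallyEq.eq_of_nhds (X := affineSpace k W) hf] at h0
    exact (div_ne_zero_iff.1 h0).1
  refine ⟨?_, q, hq, p, hp, hpx, ?_⟩
  · filter_upwards [hf, (isOpen_ne_zero hp).eventually_mem hpx,
      (isOpen_ne_zero hq).eventually_mem hqx] with y h1 h2 h3
    rw [h1]
    exact div_ne_zero h2 h3
  · filter_upwards [hf] with y hy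
    rw [hy, inv_div]

theorem regularAt_of_mem_polynomialFunctions {p : W → k} (hp : p ∈ polynomialFunctions k W)
    (x : affineSpace k W) : (affineSpace k W).RegularAt p x :=
  ⟨p, hp, 1, Subalgebra.one_mem _, one_ne_zero, Eventually.of_forall fun y => by simp⟩

/-- A map to a vector space is a morphism near `x` if its coordinates are regular at `x`. -/
theorem MorphismAt.of_dual {X : SpaceWithFunctions.{u, v} k} (hX : X.InvertsUnits)
    {φ : X → affineSpace k W} {x : X}
    (h : ∀ ℓ : Module.Dual k W, X.RegularAt (fun y => ℓ (φ y)) x) :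
    MorphismAt X (affineSpace k W) φ x := by
  have hpoly : ∀ p ∈ polynomialFunctions k W, X.RegularAt (fun y => p (φ y)) x := by
    intro p hp
    induction hp using Algebra.adjoin_induction with
    | mem p hp =>
      obtain ⟨ℓ, rfl⟩ := hp
      exact h ℓ
    | algebraMap c => exact X.const c x
    | add p q _ _ hp hq => exact X.add hp hq
    | mul p q _ _ hp hq => exact X.mul hp hq
  have hc : ContinuousAt φ x := by
    intro U hU
    obtain ⟨V, hVU, hV, hxV⟩ := mem_nhds_iff.1 hU
    obtain ⟨q, hq, hqx, hqV⟩ := exists_ne_zero_subset hV hxV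
    rw [mem_map]
    filter_upwards [(hX _ x (hpoly q hq) hqx).1] with y hy using hVU (hqV _ hy)
  refine ⟨hc, ?_⟩
  rintro f ⟨p, hp, q, hq, hqx, hf⟩
  refine X.congr ?_ (X.mul (hpoly p hp) (hX _ x (hpoly q hq) hqx).2)
  filter_upwards [hc.eventually hf] with y hy
  rw [hy, div_eq_mul_inv]

/-- A map is polynomial if its composites with the linear functionals are. -/
def IsPolynomialMap {W' : Type*} [AddCommGroup W'] [Module k W'] (h : W → W') : Prop :=
  ∀ ℓ : Module.Dual k W', (fun x => ℓ (h x)) ∈ polynomialFunctions k W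

theorem IsPolynomialMap.isMorphism {W' : Type*} [AddCommGroup W'] [Module k W'] {h : W → W'}
    (hh : IsPolynomialMap (k := k) h) : IsMorphism (affineSpace k W) (affineSpace k W') h :=
  isMorphism_iff_morphismAt.2 fun x => .of_dual affineSpace_invertsUnits fun ℓ =>
    regularAt_of_mem_polynomialFunctions (hh ℓ) x

/-- A function on a quotient of a subset of a vector space is regular where it is given by a
fraction whose denominator has an invariant zero set. -/
theorem quotient_regularAt {C : Set (affineSpace k W)} {Y : Type v}
    {π : (affineSpace k W).sub C → Y} {f : Y → k} {p q : W → k}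
    (hp : p ∈ polynomialFunctions k W) (hq : q ∈ polynomialFunctions k W)
    (hinv : ∀ c c' : C, π c = π c' → q c.1 ≠ 0 → q c'.1 ≠ 0)
    (hf : ∀ c : C, q c.1 ≠ 0 → f (π c) = p c.1 / q c.1) {c : C} (hc : q c.1 ≠ 0) :
    (((affineSpace k W).sub C).quotient π).RegularAt f (π c) := by
  have hopen : IsOpen (X := (affineSpace k W).sub C) {c : C | q c.1 ≠ 0} :=
    (isOpen_ne_zero hq).preimage (isMorphism_subtype_val (affineSpace k W) C).1
  refine ⟨π '' {c : C | q c.1 ≠ 0}, isOpen_coinduced.2 ?_, ⟨c, hc, rfl⟩, ?_⟩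
  · convert hopen
    ext c'
    constructor
    · rintro ⟨c, hc, h⟩
      exact hinv _ _ h hc
    · exact fun h => ⟨c', h, rfl⟩
  · rintro c' ⟨c, hc, h⟩
    have hc' : q c'.1 ≠ 0 := hinv _ _ h hc
    have : (affineSpace k W).RegularAt (fun y => p y / q y) c'.1 :=
      ⟨p, hp, q, hq, hc', Eventually.of_forall fun _ => rfl⟩
    refine ⟨_, this, ?_⟩
    filter_upwards [hopen.eventually_mem hc'] with y hy using hf y hy

end Affine

section Charts

/-- Near each point of `Y` the map `π` has a section that is a morphism. -/
def HasLocalSections (X : SpaceWithFunctions.{u, v} k) {Y : Type w} (π : X → Y) : Prop :=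
  ∀ y : X.quotient π, ∃ σ : X.quotient π → X, Function.RightInverse σ π ∧
    MorphismAt (X.quotient π) X σ y

/-- On a subset of a quotient with local sections, morphisms may be tested on the inverse image. -/
theorem HasLocalSections.isMorphism_sub {X : SpaceWithFunctions.{u, v} k} {Y : Type w} {π : X → Y}
    (hπ : HasLocalSections X π) {Z : Set (X.quotient π)} {T : SpaceWithFunctions k} {φ : Z → T}
    (h : IsMorphism (X.sub (π ⁻¹' Z)) T (fun x => φ ⟨π x.1, x.2⟩)) :
    IsMorphism ((X.quotient π).sub Z) T φ := by
  refine isMorphism_iff_morphismAt.2 fun z => ?_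
  obtain ⟨σ, hσ, hσz⟩ := hπ z.1
  let τ : Z → X.sub (π ⁻¹' Z) := fun y => ⟨σ y.1, by
    change π (σ y.1) ∈ Z
    rw [hσ]
    exact y.2⟩
  have hτ : MorphismAt ((X.quotient π).sub Z) (X.sub (π ⁻¹' Z)) τ z :=
    .of_subtype_val (hσz.comp (isMorphism_iff_morphismAt.1 (isMorphism_subtype_val _ Z) z))
  refine ((isMorphism_iff_morphismAt.1 h (τ z)).comp hτ).congr (Eventually.of_forall fun y => ?_)
  exact congrArg φ (Subtype.ext (hσ y.1))

variable {W : Type w} [AddCommGroup W] [Module k W]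

/-- A map to a quotient of a subset `C` of a vector space is a morphism near a point if it lifts to
a morphism with values in `C`. -/
theorem MorphismAt.of_lift {X : SpaceWithFunctions.{u, v} k} {C : Set (affineSpace k W)}
    {Y : Type*} {π : (affineSpace k W).sub C → Y}
    {ψ : X → ((affineSpace k W).sub C).quotient π} {x : X} {h : X → affineSpace k W}
    (hh : MorphismAt X (affineSpace k W) h x)
    (hψ : ∀ᶠ y in 𝓝 x, ∃ hy : h y ∈ C, π ⟨h y, hy⟩ = ψ y) :
    MorphismAt X (((affineSpace k W).sub C).quotient π) ψ x := by
  classical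
  let τ : X → (affineSpace k W).sub C := fun y =>
    if hy : h y ∈ C then ⟨h y, hy⟩ else ⟨h x, hψ.self_of_nhds.1⟩
  have hτ : MorphismAt X ((affineSpace k W).sub C) τ x := by
    refine .of_subtype_val (hh.congr ?_)
    filter_upwards [hψ] with y hy
    simp [τ, hy.1]
  refine (MorphismAt.comp (isMorphism_iff_morphismAt.1 (isMorphism_quotient _ π) _) hτ).congr ?_
  filter_upwards [hψ] with y hy
  obtain ⟨h1, h2⟩ := hy
  simp [τ, h1, h2]

/-- A map between subsets of quotients is a morphism if locally it is given by polynomial maps in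
homogeneous coordinates. -/
theorem HasLocalSections.isMorphism_of_charts {C : Set (affineSpace k W)} {Y : Type*}
    {π : (affineSpace k W).sub C → Y} (hπ : HasLocalSections ((affineSpace k W).sub C) π)
    {W' : Type*} [AddCommGroup W'] [Module k W'] {C' : Set (affineSpace k W')} {Y' : Type*}
    {π' : (affineSpace k W').sub C' → Y'} {Z : Set (((affineSpace k W).sub C).quotient π)}
    {Z' : Set (((affineSpace k W').sub C').quotient π')} {φ : Z → Z'}
    (H : ∀ c : C, π c ∈ Z → ∃ q ∈ polynomialFunctions k W, q c.1 ≠ 0 ∧ ∃ h : W → W',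
      IsPolynomialMap (k := k) h ∧ ∀ (c' : C) (hc' : π c' ∈ Z), q c'.1 ≠ 0 →
        ∃ hh : h c'.1 ∈ C', π' ⟨h c'.1, hh⟩ = (φ ⟨π c', hc'⟩).1) :
    IsMorphism ((((affineSpace k W).sub C).quotient π).sub Z)
      ((((affineSpace k W').sub C').quotient π').sub Z') φ := by
  refine hπ.isMorphism_sub (T := (((affineSpace k W').sub C').quotient π').sub Z')
    (.of_subtype_val (isMorphism_iff_morphismAt.2 fun c => ?_))
  obtain ⟨q, hq, hqc, h, hh, hψ⟩ := H c.1 c.2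
  have hval : IsMorphism (((affineSpace k W).sub C).sub (π ⁻¹' Z)) (affineSpace k W)
      (fun c => c.1.1) := (isMorphism_subtype_val _ C).comp (isMorphism_subtype_val _ _)
  refine MorphismAt.of_lift (h := fun c => h c.1.1)
    (isMorphism_iff_morphismAt.1 (hh.isMorphism.comp hval) c) ?_
  filter_upwards [((isOpen_ne_zero hq).preimage hval.1).eventually_mem hqc] with c' hc'
  exact hψ c'.1 c'.2 hc'

end Charts

end SpaceWithFunctions

/-! ### Regular functions on closed subsets of affine space -/

namespace SpaceWithFunctions

variable {k : Type u} [Field k]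

theorem dual_apply_eq_sum {n : ℕ} (ℓ : Module.Dual k (Fin n → k)) (c : Fin n → k) :
    ℓ c = ∑ i, c i * ℓ (Pi.single i 1) := by
  rw [LinearMap.pi_apply_eq_sum_univ ℓ c]
  refine Finset.sum_congr rfl fun i _ => ?_
  rw [smul_eq_mul]
  congr 2
  ext j
  simp [Pi.single_apply, eq_comm]

theorem exists_mvPolynomial_of_mem_polynomialFunctions {n : ℕ} {p : (Fin n → k) → k}
    (hp : p ∈ polynomialFunctions k (Fin n → k)) :
    ∃ P : MvPolynomial (Fin n) k, ∀ x, p x = MvPolynomial.eval x P := by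
  induction hp using Algebra.adjoin_induction with
  | mem p hp =>
    obtain ⟨ℓ, rfl⟩ := hp
    refine ⟨∑ i, MvPolynomial.C (ℓ (Pi.single i 1)) * MvPolynomial.X i, fun x => ?_⟩
    simp only [map_sum, map_mul, MvPolynomial.eval_C, MvPolynomial.eval_X]
    rw [dual_apply_eq_sum]
    exact Finset.sum_congr rfl fun i _ => mul_comm _ _
  | algebraMap c => exact ⟨MvPolynomial.C c, fun x => by simp⟩
  | add p q _ _ hp hq =>
    obtain ⟨P, hP⟩ := hp
    obtain ⟨Q, hQ⟩ := hq
    exact ⟨P + Q, fun x => by simp [hP, hQ]⟩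
  | mul p q _ _ hp hq =>
    obtain ⟨P, hP⟩ := hp
    obtain ⟨Q, hQ⟩ := hq
    exact ⟨P * Q, fun x => by simp [hP, hQ]⟩

/-- A function on a Zariski closed subset of `k ^ n` that is regular everywhere is a polynomial:
the polynomials `q` for which `f q` is a polynomial form an ideal without zeros. -/
theorem exists_mvPolynomial_of_regularAt [IsAlgClosed k] {n : ℕ}
    {Z : Set (Fin n → k)} (hZ : IsClosed (X := affineSpace k (Fin n → k)) Z) {f : Z → k}
    (hf : ∀ z, ((affineSpace k (Fin n → k)).sub Z).RegularAt f z) :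
    ∃ P : MvPolynomial (Fin n) k, ∀ z : Z, f z = MvPolynomial.eval z.1 P := by
  let J : Ideal (MvPolynomial (Fin n) k) :=
    { carrier := {q | ∃ p, ∀ z : Z, f z * MvPolynomial.eval z.1 q = MvPolynomial.eval z.1 p}
      add_mem' := by
        rintro a b ⟨p, hp⟩ ⟨q, hq⟩
        exact ⟨p + q, fun z => by rw [map_add, map_add, mul_add, hp, hq]⟩
      zero_mem' := ⟨0, fun z => by simp⟩
      smul_mem' := by
        rintro c a ⟨p, hp⟩
        exact ⟨c * p, fun z => by rw [smul_eq_mul, map_mul, map_mul, ← hp]; ring⟩ }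
  have hJ : MvPolynomial.zeroLocus k J = ∅ := by
    refine Set.eq_empty_iff_forall_notMem.2 fun x hx => ?_
    by_cases hxZ : x ∈ Z
    · obtain ⟨F, ⟨p, hp, q, hq, hqx, hF⟩, hfF⟩ := hf ⟨x, hxZ⟩
      obtain ⟨P, hP⟩ := exists_mvPolynomial_of_mem_polynomialFunctions hp
      obtain ⟨Q, hQ⟩ := exists_mvPolynomial_of_mem_polynomialFunctions hq
      obtain ⟨s, hs, hso, hxs⟩ := eventually_nhds_iff.1
        (hfF.and (continuous_subtype_val.continuousAt.eventually
          (hF.and ((isOpen_ne_zero hq).eventually_mem hqx))))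
      obtain ⟨s', hs', rfl⟩ := isOpen_induced_iff.1 hso
      obtain ⟨r, hr, hrx, hrs⟩ := exists_ne_zero_subset hs' hxs
      obtain ⟨R, hR⟩ := exists_mvPolynomial_of_mem_polynomialFunctions hr
      have hmem : R * Q ∈ J := by
        refine ⟨R * P, fun z => ?_⟩
        rw [map_mul, map_mul, ← hR z.1, ← hQ z.1, ← hP z.1]
        by_cases hz : r z.1 = 0
        · rw [hz]
          ring
        · obtain ⟨h1, h2, h3⟩ := hs z (hrs _ hz)
          have h3' : q z.1 ≠ 0 := h3
          have h4 : f z = p z.1 / q z.1 := h1.trans h2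
          rw [h4]
          field_simp
      have := hx _ hmem
      rw [MvPolynomial.aeval_eq_eval, map_mul, ← hR x, ← hQ x] at this
      exact mul_ne_zero hrx hqx this
    · obtain ⟨q, hq, hqx, hqZ⟩ := exists_ne_zero_subset hZ.isOpen_compl hxZ
      obtain ⟨Q, hQ⟩ := exists_mvPolynomial_of_mem_polynomialFunctions hq
      have hmem : Q ∈ J := by
        refine ⟨0, fun z => ?_⟩
        have : q z.1 = 0 := by
          by_contra h
          exact hqZ _ h z.2
        rw [← hQ, this, mul_zero, map_zero]
      have := hx _ hmem
      rw [MvPolynomial.aeval_eq_eval, ← hQ] at this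
      exact hqx this
  have h1 : (1 : MvPolynomial (Fin n) k) ∈ J := by
    have h := MvPolynomial.vanishingIdeal_zeroLocus_eq_radical (K := k) J
    rw [hJ, MvPolynomial.vanishingIdeal_empty, eq_comm, Ideal.radical_eq_top] at h
    rw [h]
    exact Submodule.mem_top
  obtain ⟨P, hP⟩ := h1
  exact ⟨P, fun z => by rw [← hP, map_one, mul_one]⟩

section

variable {W : Type w} [AddCommGroup W] [Module k W]

theorem isClosed_eq_zero {q : W → k} (hq : q ∈ polynomialFunctions k W) :
    IsClosed (X := affineSpace k W) {x | q x = 0} := by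
  have := (isOpen_ne_zero hq).isClosed_compl
  convert this using 1
  ext x
  simp

/-! ### Local sections of homogeneous coordinates -/

theorem projectiveSpace_hasLocalSections :
    HasLocalSections ((affineSpace k W).sub {x : W | x ≠ 0})
      (Projectivization.mk' k : _ → ℙ k W) := by
  classical
  intro y
  change ℙ k W at y
  induction y with
  | h x hx =>
    obtain ⟨ℓ, hℓ⟩ : ∃ ℓ : Module.Dual k W, ℓ x ≠ 0 := by
      by_contra! h
      exact hx ((Module.forall_dual_apply_eq_zero_iff k x).1 h)
    let a : ℙ k W → k := fun L => if ℓ L.rep = 0 then 1 else (ℓ L.rep)⁻¹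
    have ha : ∀ L, a L ≠ 0 := fun L => by
      simp only [a]
      split_ifs with h
      · exact one_ne_zero
      · exact inv_ne_zero h
    refine ⟨fun L : ℙ k W => (⟨a L • L.rep, smul_ne_zero (ha L) L.rep_nonzero⟩ : {x : W // x ≠ 0}),
      fun L => ?_,
      .of_subtype_val (.of_dual (affineSpace_invertsUnits.sub _).quotient fun ℓ' => ?_)⟩
    · change Projectivization.mk k (a L • Projectivization.rep (K := k) (V := W) L) _ = L
      conv_rhs => rw [← Projectivization.mk_rep (K := k) (V := W) L]
      exact (Projectivization.mk_eq_mk_iff' _ _ _ _ _).2 ⟨a L, rfl⟩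
    · have hinv : ∀ (v w : W) (hv : v ≠ 0) (hw : w ≠ 0),
          Projectivization.mk k v hv = Projectivization.mk k w hw → ℓ v ≠ 0 → ℓ w ≠ 0 := by
        intro v w hv hw h hc
        obtain ⟨b, rfl⟩ := (Projectivization.mk_eq_mk_iff' k v w hv hw).1 h
        rw [map_smul, smul_eq_mul] at hc
        exact right_ne_zero_of_mul hc
      have hval : ∀ (v : W) (hv : v ≠ 0), ℓ v ≠ 0 → ℓ' (a (Projectivization.mk k v hv) •
          (Projectivization.mk k v hv).rep) = ℓ' v / ℓ v := by
        intro v hv hc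
        obtain ⟨b, hb⟩ := Projectivization.exists_smul_eq_mk_rep k v hv
        have : (b : k) ≠ 0 := b.ne_zero
        simp only [a, ← hb, Units.smul_def, map_smul, smul_eq_mul]
        rw [if_neg (mul_ne_zero this hc)]
        field_simp
      exact quotient_regularAt (π := (Projectivization.mk' k : _ → ℙ k W))
        (c := ⟨x, hx⟩) (dual_mem_polynomialFunctions ℓ') (dual_mem_polynomialFunctions ℓ)
        (fun c c' h hc => hinv c.1 c'.1 c.2 c'.2 h hc) (fun c hc => hval c.1 c.2 hc) hℓ

end

end SpaceWithFunctions

namespace FullFlag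

open SpaceWithFunctions

variable {k : Type u} {V : Type v} [Field k] [AddCommGroup V] [Module k V]

theorem exists_smul_eq_of_ker_eq {ξ η : Module.Dual k V} (hξ : ξ ≠ 0)
    (h : LinearMap.ker ξ = LinearMap.ker η) : ∃ b : k, b ≠ 0 ∧ η = b • ξ := by
  obtain ⟨v, hv⟩ := DFunLike.ne_iff.1 hξ
  rw [LinearMap.zero_apply] at hv
  have hv' : η v ≠ 0 := fun h0 => hv (by rwa [← LinearMap.mem_ker, h, LinearMap.mem_ker])
  refine ⟨η v / ξ v, div_ne_zero hv' hv, LinearMap.ext fun x => ?_⟩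
  have : x - (ξ x / ξ v) • v ∈ LinearMap.ker η := by
    rw [← h, LinearMap.mem_ker, map_sub, map_smul, smul_eq_mul, div_mul_cancel₀ _ hv, sub_self]
  rw [LinearMap.mem_ker, map_sub, map_smul, smul_eq_mul, sub_eq_zero] at this
  rw [this, LinearMap.smul_apply, smul_eq_mul]
  ring

variable [Fact (Module.finrank k V = 3)]

instance (priority := 50) finiteDimensional : FiniteDimensional k V :=
  Module.finite_of_finrank_pos (by rw [(Fact.out : Module.finrank k V = 3)]; norm_num)

theorem ofCoordinates_surjective : Function.Surjective (ofCoordinates k V) := by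
  intro F
  obtain ⟨L, P, hP, hL⟩ := F
  have h3 : Module.finrank k V = 3 := Fact.out
  induction L with
  | h x hx =>
    have hlt : P < ⊤ := lt_top_iff_ne_top.2 fun h => by
      rw [h, finrank_top] at hP
      omega
    obtain ⟨ξ, hξ, hξP⟩ := P.exists_le_ker_of_lt_top hlt
    have hPξ : P = LinearMap.ker ξ := by
      refine Submodule.eq_of_le_of_finrank_eq hξP ?_
      have := Module.Dual.finrank_ker_add_one_of_ne_zero hξ
      omega
    rw [Projectivization.submodule_mk, Submodule.span_singleton_le_iff_mem] at hL
    exact ⟨⟨(x, ξ), hx, hξ, hξP hL⟩, FullFlag.ext rfl hPξ.symm⟩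

theorem ofCoordinates_eq_iff {c c' : homogeneousCoordinates k V} :
    ofCoordinates k V c = ofCoordinates k V c' ↔
      ∃ a b : k, a ≠ 0 ∧ b ≠ 0 ∧ c'.1.1 = a • c.1.1 ∧ c'.1.2 = b • c.1.2 := by
  constructor
  · intro h
    obtain ⟨a, ha⟩ := (Projectivization.mk_eq_mk_iff' k _ _ c'.2.1 c.2.1).1
      (congrArg FullFlag.L h).symm
    obtain ⟨b, hb, hb'⟩ := exists_smul_eq_of_ker_eq c.2.2.1 (congrArg FullFlag.P h)
    refine ⟨a, b, ?_, hb, ha.symm, hb'⟩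
    rintro rfl
    exact c'.2.1 (by rw [← ha, zero_smul])
  · rintro ⟨a, b, ha, hb, h1, h2⟩
    refine FullFlag.ext ((Projectivization.mk_eq_mk_iff' k _ _ c.2.1 c'.2.1).2
      ⟨a⁻¹, by rw [h1, inv_smul_smul₀ ha]⟩) ?_
    change LinearMap.ker c.1.2 = LinearMap.ker c'.1.2
    rw [h2, LinearMap.ker_smul _ _ hb]

variable (k V)

theorem hasLocalSections :
    HasLocalSections ((affineSpace k (V × Module.Dual k V)).sub (homogeneousCoordinates k V))
      (ofCoordinates k V) := by
  classical
  intro F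
  obtain ⟨⟨⟨x, ξ⟩, hx, hξ, hξx⟩, rfl⟩ := ofCoordinates_surjective F
  obtain ⟨ℓ, hℓ⟩ : ∃ ℓ : Module.Dual k V, ℓ x ≠ 0 := by
    by_contra! h
    exact hx ((Module.forall_dual_apply_eq_zero_iff k x).1 h)
  obtain ⟨v, hv⟩ := DFunLike.ne_iff.1 hξ
  have hs := Function.rightInverse_surjInv (ofCoordinates_surjective (k := k) (V := V))
  set s := Function.surjInv (ofCoordinates_surjective (k := k) (V := V))
  let a : FullFlag k V → k := fun F => if ℓ (s F).1.1 = 0 then 1 else (ℓ (s F).1.1)⁻¹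
  let b : FullFlag k V → k := fun F => if (s F).1.2 v = 0 then 1 else ((s F).1.2 v)⁻¹
  have ha : ∀ F, a F ≠ 0 := fun F => by
    simp only [a]
    split_ifs with h
    · exact one_ne_zero
    · exact inv_ne_zero h
  have hb : ∀ F, b F ≠ 0 := fun F => by
    simp only [b]
    split_ifs with h
    · exact one_ne_zero
    · exact inv_ne_zero h
  let σ : FullFlag k V → homogeneousCoordinates k V := fun F =>
    ⟨(a F • (s F).1.1, b F • (s F).1.2), smul_ne_zero (ha F) (s F).2.1,
      smul_ne_zero (hb F) (s F).2.2.1, by simp [(s F).2.2.2]⟩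
  refine ⟨σ, fun F => ?_,
    .of_subtype_val (.of_dual (affineSpace_invertsUnits.sub _).quotient fun ℓ' => ?_)⟩
  · conv_rhs => rw [← hs F]
    exact (ofCoordinates_eq_iff.2 ⟨a F, b F, ha F, hb F, rfl, rfl⟩).symm
  · let ℓ₁ : Module.Dual k (V × Module.Dual k V) := ℓ.comp (LinearMap.fst k _ _)
    let ℓ₂ : Module.Dual k (V × Module.Dual k V) :=
      (Module.Dual.eval k V v).comp (LinearMap.snd k _ _)
    let m₁ : Module.Dual k (V × Module.Dual k V) :=
      ℓ'.comp ((LinearMap.inl k _ _).comp (LinearMap.fst k V (Module.Dual k V)))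
    let m₂ : Module.Dual k (V × Module.Dual k V) :=
      ℓ'.comp ((LinearMap.inr k _ _).comp (LinearMap.snd k V (Module.Dual k V)))
    refine quotient_regularAt (π := ofCoordinates k V)
      (c := ⟨(x, ξ), hx, hξ, hξx⟩) (p := (fun c => m₁ c) * (fun c => ℓ₂ c) + (fun c => m₂ c) *
        (fun c => ℓ₁ c)) (q := (fun c => ℓ₁ c) * (fun c => ℓ₂ c))
      (Subalgebra.add_mem _
        (Subalgebra.mul_mem _ (dual_mem_polynomialFunctions _) (dual_mem_polynomialFunctions _))
        (Subalgebra.mul_mem _ (dual_mem_polynomialFunctions _) (dual_mem_polynomialFunctions _)))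
      (Subalgebra.mul_mem _ (dual_mem_polynomialFunctions _) (dual_mem_polynomialFunctions _))
      (fun c c' h hc => ?_) (fun c hc => ?_) (mul_ne_zero hℓ hv)
    · obtain ⟨a, b, ha, hb, h1, h2⟩ := ofCoordinates_eq_iff.1 h
      refine mul_ne_zero ?_ ?_
      · change ℓ c'.1.1 ≠ 0
        rw [h1, map_smul]
        exact smul_ne_zero ha (left_ne_zero_of_mul hc)
      · change c'.1.2 v ≠ 0
        rw [h2]
        exact smul_ne_zero hb (right_ne_zero_of_mul hc)
    · obtain ⟨a', b', ha', hb', h1, h2⟩ := ofCoordinates_eq_iff.1 (hs (ofCoordinates k V c)).symm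
      have hc1 : ℓ c.1.1 ≠ 0 := left_ne_zero_of_mul hc
      have hc2 : c.1.2 v ≠ 0 := right_ne_zero_of_mul hc
      have e1 : a (ofCoordinates k V c) • (s (ofCoordinates k V c)).1.1
          = (ℓ c.1.1)⁻¹ • c.1.1 := by
        simp only [a]
        rw [h1, map_smul, smul_eq_mul, if_neg (mul_ne_zero ha' hc1), smul_smul]
        congr 1
        field_simp
      have e2 : b (ofCoordinates k V c) • (s (ofCoordinates k V c)).1.2
          = (c.1.2 v)⁻¹ • c.1.2 := by
        simp only [b]
        rw [h2, LinearMap.smul_apply, smul_eq_mul, if_neg (mul_ne_zero hb' hc2), smul_smul]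
        congr 1
        field_simp
      change ℓ' (a (ofCoordinates k V c) • (s (ofCoordinates k V c)).1.1,
        b (ofCoordinates k V c) • (s (ofCoordinates k V c)).1.2) = _
      rw [e1, e2]
      have e3 : (((ℓ c.1.1)⁻¹ • c.1.1, (c.1.2 v)⁻¹ • c.1.2) : V × Module.Dual k V) =
          (ℓ c.1.1)⁻¹ • (c.1.1, 0) + (c.1.2 v)⁻¹ • (0, c.1.2) := by simp
      rw [e3, map_add, map_smul, map_smul]
      change _ = (ℓ' (c.1.1, 0) * c.1.2 v + ℓ' (0, c.1.2) * ℓ c.1.1) / (ℓ c.1.1 * c.1.2 v)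
      simp only [smul_eq_mul]
      field_simp

end FullFlag

/-! ### Conic bases -/

section ConicBasis

open LinearMap (GeneralLinearGroup BilinForm)
open Module (Basis)

variable {k : Type u} {V : Type v} [Field k] [AddCommGroup V] [Module k V]

/-- The Gram matrix of the form `(x, x) = 2 (x₁² - x₀ x₂)`. -/
def conicGram (k : Type u) [Field k] : Matrix (Fin 3) (Fin 3) k := !![0, 0, -1; 0, 2, 0; -1, 0, 0]

/-- A basis in which the form is `(x, x) = 2 (x₁² - x₀ x₂)`; the isotropic lines are then spanned by
the vectors with coordinates `(s², s t, t²)`. -/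
def IsConicBasis (B : BilinForm k V) (e : Basis (Fin 3) k V) : Prop :=
  ∀ i j, B (e i) (e j) = conicGram k i j

theorem IsConicBasis.apply {B : BilinForm k V} {e : Basis (Fin 3) k V} (he : IsConicBasis B e)
    (x y : V) : B x y = 2 * (e.coord 1 x * e.coord 1 y) - e.coord 0 x * e.coord 2 y -
      e.coord 2 x * e.coord 0 y := by
  conv_lhs => rw [← e.sum_repr x, ← e.sum_repr y]
  simp only [Fin.sum_univ_three, map_add, map_smul, LinearMap.add_apply, LinearMap.smul_apply,
    smul_eq_mul, he _ _, Basis.coord_apply]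
  simp [conicGram]
  ring

theorem exists_isConicBasis_of_gram [Fact (Module.finrank k V = 3)] (h2 : (2 : k) ≠ 0)
    {B : BilinForm k V} (v : Fin 3 → V) (hv : ∀ i j, B (v i) (v j) = conicGram k i j) :
    ∃ e : Basis (Fin 3) k V, ⇑e = v ∧ IsConicBasis B e := by
  have hli : LinearIndependent k v := by
    refine Fintype.linearIndependent_iff.2 fun c hc => ?_
    have h : ∀ j, ∑ i, c i * conicGram k i j = 0 := fun j => by
      have := congrArg (fun x => B x (v j)) hc
      simpa [LinearMap.sum_apply, hv] using this
    have h0 := h 0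
    have h1 := h 1
    have h3 := h 2
    simp [Fin.sum_univ_three, conicGram] at h0 h1 h3
    intro i
    fin_cases i
    · exact h3
    · exact h1.resolve_right h2
    · exact h0
  have hcard : Fintype.card (Fin 3) = Module.finrank k V := by
    rw [Fintype.card_fin, (Fact.out : Module.finrank k V = 3)]
  refine ⟨basisOfLinearIndependentOfCardEqFinrank hli hcard,
    coe_basisOfLinearIndependentOfCardEqFinrank hli hcard, fun i j => ?_⟩
  rw [coe_basisOfLinearIndependentOfCardEqFinrank]
  exact hv i j

theorem exists_isConicBasis_of_isotropic [Fact (Module.finrank k V = 3)] {B : BilinForm k V}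
    (hs : B.IsSymm) (hB : B.Nondegenerate) (h2 : (2 : k) ≠ 0)
    {v u : V} (hv : v ≠ 0) (hvv : B v v = 0) (hvu : B v u = 0) (huu : B u u = 2) :
    ∃ e : Basis (Fin 3) k V, IsConicBasis B e ∧ e 0 = v ∧ e 1 = u := by
  obtain ⟨w, hw⟩ : ∃ w, B v w ≠ 0 := by
    by_contra! h
    exact hv (hB.1 v h)
  let w₁ := -(B v w)⁻¹ • w
  have h1 : B v w₁ = -1 := by simp [w₁, hw]
  let w₂ := w₁ - (B w₁ u / 2) • u
  have h3 : B v w₂ = -1 := by simp [w₂, h1, hvu]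
  have h4 : B w₂ u = 0 := by simp [w₂, huu, h2]
  let w₃ := w₂ + (B w₂ w₂ / 2) • v
  have h5 : B v w₃ = -1 := by simp [w₃, h3, hvv]
  have h6 : B u w₃ = 0 := by
    rw [hs.eq u w₃]
    simp [w₃, h4, hvu]
  have h7 : B w₃ w₃ = 0 := by
    have : B w₂ v = -1 := by rw [hs.eq, h3]
    simp only [w₃, map_add, map_smul, LinearMap.add_apply, LinearMap.smul_apply, hvv, h3, this,
      smul_eq_mul]
    field_simp
    ring
  obtain ⟨e, he, hbas⟩ := exists_isConicBasis_of_gram (B := B) h2 ![v, u, w₃] (by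
    intro i j
    fin_cases i <;> fin_cases j <;>
      simp [conicGram, hvv, hvu, huu, h5, h6, h7, hs.eq u v, hs.eq w₃ v, hs.eq w₃ u])
  exact ⟨e, hbas, by rw [he]; rfl, by rw [he]; rfl⟩

theorem exists_isConicBasis_zero_eq [Fact (Module.finrank k V = 3)] [IsAlgClosed k]
    {B : BilinForm k V} (hs : B.IsSymm) (hB : B.Nondegenerate) (h2 : (2 : k) ≠ 0) {v : V}
    (hv : v ≠ 0) (hvv : B v v = 0) :
    ∃ e : Basis (Fin 3) k V, IsConicBasis B e ∧ e 0 = v := by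
  have hfin : FiniteDimensional k V :=
    Module.finite_of_finrank_pos (by rw [(Fact.out : Module.finrank k V = 3)]; norm_num)
  obtain ⟨u, hu, huu⟩ : ∃ u, B v u = 0 ∧ B u u ≠ 0 := by
    by_contra! h
    -- otherwise the plane orthogonal to `v` is totally isotropic
    let N := B.orthogonal (k ∙ v)
    have hN : ∀ x, x ∈ N ↔ B v x = 0 := fun x => by
      rw [LinearMap.BilinForm.mem_orthogonal_iff]
      refine ⟨fun hx => hx v (Submodule.mem_span_singleton_self v), fun hx y hy => ?_⟩
      obtain ⟨a, rfl⟩ := Submodule.mem_span_singleton.1 hy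
      rw [map_smul, LinearMap.smul_apply, hx, smul_zero]
    have hNN : N ≤ B.orthogonal N := fun x hx y hy => by
      rw [hN] at hx hy
      have hxy := h (x + y) (by rw [map_add, hx, hy, add_zero])
      rw [map_add, map_add, LinearMap.add_apply, LinearMap.add_apply, h x hx, h y hy, hs.eq x y,
        add_zero, zero_add, ← two_mul] at hxy
      exact (mul_eq_zero.1 hxy).resolve_left h2
    have hd : Module.finrank k N = 2 := by
      rw [LinearMap.BilinForm.finrank_orthogonal hB, (Fact.out : Module.finrank k V = 3),
        finrank_span_singleton hv]
    have := Submodule.finrank_mono hNN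
    rw [LinearMap.BilinForm.finrank_orthogonal hB N, (Fact.out : Module.finrank k V = 3),
      hd] at this
    omega
  obtain ⟨a, ha⟩ := IsAlgClosed.exists_pow_nat_eq (2 / B u u) (n := 2) (by norm_num)
  obtain ⟨e, he, h0, _⟩ := exists_isConicBasis_of_isotropic hs hB h2 hv hvv (u := a • u)
    (by simp [hu]) (by
      simp only [map_smul, LinearMap.smul_apply, smul_eq_mul]
      rw [← mul_assoc, ← pow_two, ha, div_mul_cancel₀ _ huu])
  exact ⟨e, he, h0⟩

theorem exists_isConicBasis_of_orthogonal [Fact (Module.finrank k V = 3)] [IsAlgClosed k]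
    {B : BilinForm k V} (hs : B.IsSymm) (hB : B.Nondegenerate) (h2 : (2 : k) ≠ 0) {a b : V}
    (hab : B a b = 0) (haa : B a a = 2) (hbb : B b b = 2) :
    ∃ e : Basis (Fin 3) k V, IsConicBasis B e ∧ e 1 = a ∧ e 0 - e 2 = b := by
  have hfin : FiniteDimensional k V :=
    Module.finite_of_finrank_pos (by rw [(Fact.out : Module.finrank k V = 3)]; norm_num)
  obtain ⟨w, hw⟩ : ∃ w, w ∉ Submodule.span k (Set.range ![a, b]) := by
    by_contra! h
    have h3 : Module.finrank k V = 3 := Fact.out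
    rw [← finrank_top, ← (Submodule.eq_top_iff'.2 h)] at h3
    have := finrank_range_le_card (R := k) ![a, b]
    rw [Set.finrank, h3] at this
    simp at this
  let u := w - (B a w / 2) • a - (B b w / 2) • b
  have hau : B a u = 0 := by simp [u, haa, hab, h2]
  have hbu : B b u = 0 := by simp [u, hbb, hs.eq b a, hab, h2]
  have ha : a ∈ Submodule.span k (Set.range ![a, b]) := Submodule.subset_span ⟨0, rfl⟩
  have hb : b ∈ Submodule.span k (Set.range ![a, b]) := Submodule.subset_span ⟨1, rfl⟩
  have hu0 : u ≠ 0 := fun h => hw (by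
    have : w = (B a w / 2) • a + (B b w / 2) • b := by
      rw [← sub_eq_zero, ← sub_sub]
      exact h
    rw [this]
    exact add_mem (Submodule.smul_mem _ _ ha) (Submodule.smul_mem _ _ hb))
  have huu : B u u ≠ 0 := fun huu => by
    have hli : LinearIndependent k ![a, b, u] := by
      refine Fintype.linearIndependent_iff.2 fun c hc => ?_
      have hca := congrArg (B a) hc
      have hcb := congrArg (B b) hc
      simp [Fin.sum_univ_three, haa, hab, hau, hbb, hbu, hs.eq b a, h2] at hca hcb
      simp [Fin.sum_univ_three, hca, hcb, hu0] at hc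
      intro i
      fin_cases i
      exacts [hca, hcb, hc]
    have hspan := hli.span_eq_top_of_card_eq_finrank'
      (by rw [Fintype.card_fin, (Fact.out : Module.finrank k V = 3)])
    refine hu0 (hB.1 u fun x => ?_)
    have hx : x ∈ Submodule.span k (Set.range ![a, b, u]) := hspan ▸ Submodule.mem_top
    induction hx using Submodule.span_induction with
    | mem x hx =>
      obtain ⟨i, rfl⟩ := hx
      fin_cases i
      · exact (hs.eq u a).trans hau
      · exact (hs.eq u b).trans hbu
      · exact huu
    | zero => simp
    | add x y _ _ hx hy => rw [map_add, hx, hy, add_zero]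
    | smul c x _ hx => rw [map_smul, hx, smul_zero]
  obtain ⟨d, hd⟩ := IsAlgClosed.exists_pow_nat_eq (-2 / B u u) (n := 2) (by norm_num)
  let c := d • u
  have hcc : B c c = -2 := by
    simp only [c, map_smul, LinearMap.smul_apply, smul_eq_mul]
    rw [← mul_assoc, ← pow_two, hd, div_mul_cancel₀ _ huu]
  have hac : B a c = 0 := by simp [c, hau]
  have hbc : B b c = 0 := by simp [c, hbu]
  have hba : B b a = 0 := by rw [hs.eq, hab]
  have hca : B c a = 0 := by rw [hs.eq, hac]
  have hcb : B c b = 0 := by rw [hs.eq, hbc]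
  obtain ⟨e, he, hbas⟩ := exists_isConicBasis_of_gram (B := B) h2
    ![(2⁻¹ : k) • (b + c), a, (2⁻¹ : k) • (c - b)] (by
    intro i j
    fin_cases i <;> fin_cases j <;>
      simp [conicGram, haa, hab, hac, hba, hbb, hbc, hca, hcb, hcc] <;> field_simp <;> norm_num)
  refine ⟨e, hbas, by rw [he]; rfl, ?_⟩
  rw [he]
  change (2⁻¹ : k) • (b + c) - (2⁻¹ : k) • (c - b) = b
  rw [← smul_sub, show b + c - (c - b) = b + b by abel, ← two_smul k b, inv_smul_smul₀ h2]

/-- The special orthogonal group acts transitively on the bases with a given Gram matrix, up to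
signs: in odd dimension one of `±g` has determinant one. -/
theorem exists_specialOrthogonal_apply_eq [Fact (Module.finrank k V = 3)]
    {B : BilinForm k V} (hB : B.Nondegenerate)
    {e e' : Basis (Fin 3) k V} (h : ∀ i j, B (e i) (e j) = B (e' i) (e' j)) :
    ∃ g ∈ specialOrthogonal B, ∃ c : k, c ≠ 0 ∧ ∀ i, g.1 (e i) = c • e' i := by
  let T : V ≃ₗ[k] V := e.equiv e' (Equiv.refl _)
  have hTe : ∀ i, T (e i) = e' i := fun i => by simp [T]
  have hT : B.comp T.toLinearMap T.toLinearMap = B := by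
    refine e.ext fun i => e.ext fun j => ?_
    rw [LinearMap.BilinForm.comp_apply, LinearEquiv.coe_coe, hTe, hTe, h]
  let d := LinearMap.det T.toLinearMap
  have hd : d ^ 2 = 1 := by
    have h1 := LinearMap.BilinForm.toMatrix_comp e e B T.toLinearMap T.toLinearMap
    rw [hT] at h1
    have h3 := congrArg Matrix.det h1
    have h4 := (LinearMap.BilinForm.nondegenerate_iff_det_ne_zero e).1 hB
    rw [Matrix.det_mul, Matrix.det_mul, Matrix.det_transpose, LinearMap.det_toMatrix] at h3
    refine mul_right_cancel₀ h4 ?_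
    rw [one_mul]
    linear_combination -h3
  have hd0 : d ≠ 0 := fun h0 => by simp [h0] at hd
  let g : GeneralLinearGroup k V :=
    GeneralLinearGroup.ofLinearEquiv (T.trans (LinearEquiv.smulOfNeZero k V d hd0))
  have hg : g.1 = d • T.toLinearMap := rfl
  refine ⟨g, ⟨fun x y => ?_, ?_⟩, d, hd0, fun i => ?_⟩
  · have := LinearMap.congr_fun₂ hT x y
    rw [hg, LinearMap.smul_apply, LinearMap.smul_apply, map_smul, map_smul, LinearMap.smul_apply,
      smul_smul, ← pow_two, hd, one_smul]
    exact this
  · rw [hg, LinearMap.det_smul, (Fact.out : Module.finrank k V = 3)]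
    change d ^ 3 * d = 1
    linear_combination (d ^ 2 + 1) * hd
  · rw [hg, LinearMap.smul_apply, LinearEquiv.coe_coe, hTe]

end ConicBasis

/-! ### Orbits of the special orthogonal group on flags -/

section Orbits

open LinearMap (GeneralLinearGroup BilinForm)
open Module (Basis)
open FullFlag

variable {k : Type u} {V : Type v} [Field k] [AddCommGroup V] [Module k V]

theorem mk_mem_isotropicLines {B : BilinForm k V} {x : V} (hx : x ≠ 0) :
    Projectivization.mk k x hx ∈ isotropicLines B ↔ B x x = 0 := by
  change (Projectivization.mk k x hx).submodule ≤
    B.orthogonal (Projectivization.mk k x hx).submodule ↔ _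
  rw [Projectivization.submodule_mk, Submodule.span_singleton_le_iff_mem,
    LinearMap.BilinForm.mem_orthogonal_iff]
  refine ⟨fun h => h x (Submodule.mem_span_singleton_self x), fun h y hy => ?_⟩
  obtain ⟨a, rfl⟩ := Submodule.mem_span_singleton.1 hy
  rw [map_smul, LinearMap.smul_apply, h, smul_zero]

theorem apply_inv_apply (g : GeneralLinearGroup k V) (x : V) : g.1 (g⁻¹.1 x) = x := by
  rw [← Module.End.mul_apply, ← Units.val_mul, mul_inv_cancel, Units.val_one,
    Module.End.one_apply]

theorem inv_apply_apply (g : GeneralLinearGroup k V) (x : V) : g⁻¹.1 (g.1 x) = x := by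
  rw [← Module.End.mul_apply, ← Units.val_mul, inv_mul_cancel, Units.val_one,
    Module.End.one_apply]

theorem apply_ne_zero (g : GeneralLinearGroup k V) {x : V} (hx : x ≠ 0) : g.1 x ≠ 0 := fun h =>
  hx (by rw [← inv_apply_apply g x, h, map_zero])

theorem mk_mem_smul_isotropicLines {B : BilinForm k V} {g : GeneralLinearGroup k V} {x : V}
    (hx : x ≠ 0) : Projectivization.mk k x hx ∈ g • isotropicLines B ↔
      B (g⁻¹.1 x) (g⁻¹.1 x) = 0 := by
  rw [Set.mem_smul_set_iff_inv_smul_mem, Projectivization.smul_mk]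
  exact mk_mem_isotropicLines (apply_ne_zero g⁻¹ hx)

/-- The line of the standard flag of class `i` with respect to a conic basis is spanned by this
vector. -/
def standardLine (e : Fin 3 → V) : Fin 4 → V := ![e 0, e 0, e 1, e 1]

/-- The plane of the standard flag of class `i` with respect to a conic basis is the orthogonal of
this vector. -/
def standardNormal (e : Fin 3 → V) : Fin 4 → V := ![e 0, e 1, e 0, e 0 - e 2]

theorem standard_mem {B : BilinForm k V} (hB : B.Nondegenerate) {e : Basis (Fin 3) k V}
    (he : IsConicBasis B e) (i : Fin 4) :
    (standardLine e i, B (standardNormal e i)) ∈ homogeneousCoordinates k V := by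
  have h02 : e 0 - e 2 ≠ 0 := sub_ne_zero.2 (e.injective.ne (by decide))
  have hn : ∀ n : V, n ≠ 0 → B n ≠ 0 := fun n hn h => hn (hB.1 n fun x => by
    rw [h, LinearMap.zero_apply])
  refine ⟨?_, hn _ ?_, ?_⟩
  · fin_cases i <;> exact e.ne_zero _
  · fin_cases i
    exacts [e.ne_zero _, e.ne_zero _, e.ne_zero _, h02]
  · fin_cases i <;> simp [standardLine, standardNormal, he _ _, conicGram]

theorem exists_normalize [IsAlgClosed k] (h2 : (2 : k) ≠ 0) {B : BilinForm k V} {u : V}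
    (hu : B u u ≠ 0) : ∃ a : k, a ≠ 0 ∧ B (a • u) (a • u) = 2 := by
  obtain ⟨a, ha⟩ := IsAlgClosed.exists_pow_nat_eq (2 / B u u) (n := 2) (by norm_num)
  have h : B (a • u) (a • u) = 2 := by
    simp only [map_smul, LinearMap.smul_apply, smul_eq_mul]
    rw [← mul_assoc, ← pow_two, ha, div_mul_cancel₀ _ hu]
  refine ⟨a, ?_, h⟩
  rintro rfl
  simp [h2.symm] at h

theorem exists_mem_flagOrbit (B : BilinForm k V) (F : FullFlag k V) : ∃ i, F ∈ flagOrbit B i := by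
  by_cases h1 : F.L ∈ isotropicLines B <;> by_cases h2 : IsTangentPlane B F.P
  exacts [⟨0, h1, h2⟩, ⟨1, h1, h2⟩, ⟨2, h1, h2⟩, ⟨3, h1, h2⟩]

theorem eq_of_mem_flagOrbit {B : BilinForm k V} {F : FullFlag k V} {i j : Fin 4}
    (hi : F ∈ flagOrbit B i) (hj : F ∈ flagOrbit B j) : i = j := by
  fin_cases i <;> fin_cases j <;> simp_all [flagOrbit]

variable [Fact (Module.finrank k V = 3)]

theorem isTangentPlane_ker_iff {B : BilinForm k V} (hs : B.IsSymm) (hB : B.Nondegenerate) {n : V} :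
    IsTangentPlane B (LinearMap.ker (B n)) ↔ B n n = 0 := by
  have h1 : LinearMap.ker (B n) = B.orthogonal (k ∙ n) :=
    (LinearMap.BilinForm.orthogonal_span_singleton_eq_toLin_ker n).symm
  rw [IsTangentPlane, h1, LinearMap.BilinForm.orthogonal_orthogonal hB hs.isRefl, ← h1,
    Submodule.span_singleton_le_iff_mem, LinearMap.mem_ker]

theorem exists_form_eq {B : BilinForm k V} (hB : B.Nondegenerate) (ξ : Module.Dual k V) :
    ∃ n, B n = ξ := by
  refine ⟨(B.toDual hB).symm ξ, LinearMap.ext fun x => ?_⟩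
  rw [LinearMap.BilinForm.apply_toDual_symm_apply]

/-- The tangent planes of a conic form the dual conic. -/
theorem IsConicBasis.isTangentPlane_ker_iff {B : BilinForm k V} {e : Basis (Fin 3) k V}
    (he : IsConicBasis B e) (h2 : (2 : k) ≠ 0) (hs : B.IsSymm) (hB : B.Nondegenerate)
    {ξ : Module.Dual k V} :
    IsTangentPlane B (LinearMap.ker ξ) ↔ ξ (e 1) ^ 2 = 4 * (ξ (e 0) * ξ (e 2)) := by
  obtain ⟨n, rfl⟩ := exists_form_eq hB ξ
  rw [_root_.isTangentPlane_ker_iff hs hB]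
  simp only [he.apply, Basis.coord_apply, Basis.repr_self]
  simp
  constructor <;> intro h
  · linear_combination 2 * h
  · refine mul_left_cancel₀ h2 ?_
    linear_combination h

theorem exists_coordinates_form {B : BilinForm k V} (hB : B.Nondegenerate) (F : FullFlag k V) :
    ∃ (x n : V) (h : (x, B n) ∈ homogeneousCoordinates k V),
      F = ofCoordinates k V ⟨(x, B n), h⟩ := by
  obtain ⟨⟨⟨x, ξ⟩, h⟩, rfl⟩ := ofCoordinates_surjective F
  obtain ⟨n, rfl⟩ := exists_form_eq hB ξ
  exact ⟨x, n, h, rfl⟩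

theorem smul_ofCoordinates (g : GeneralLinearGroup k V) (c : homogeneousCoordinates k V) :
    ∃ h, g • ofCoordinates k V c = ofCoordinates k V ⟨(g.1 c.1.1, c.1.2.comp g⁻¹.1), h⟩ := by
  have h : (g.1 c.1.1, c.1.2.comp g⁻¹.1) ∈ homogeneousCoordinates k V := by
    refine ⟨apply_ne_zero g c.2.1, fun h => c.2.2.1 (LinearMap.ext fun x => ?_), ?_⟩
    · have := LinearMap.congr_fun h (g.1 x)
      rwa [LinearMap.comp_apply, inv_apply_apply] at this
    · rw [LinearMap.comp_apply, inv_apply_apply]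
      exact c.2.2.2
  refine ⟨h, FullFlag.ext rfl ?_⟩
  change (LinearMap.ker c.1.2).map g.1 = LinearMap.ker (c.1.2.comp g⁻¹.1)
  ext x
  rw [Submodule.mem_map, LinearMap.mem_ker, LinearMap.comp_apply]
  constructor
  · rintro ⟨y, hy, rfl⟩
    rwa [inv_apply_apply]
  · exact fun hx => ⟨g⁻¹.1 x, hx, apply_inv_apply g x⟩

/-- The class of a flag is determined by whether its line and the orthogonal of its plane are
isotropic. -/
theorem ofCoordinates_mem_flagOrbit {B : BilinForm k V} (hs : B.IsSymm) (hB : B.Nondegenerate)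
    {x n : V} (h : (x, B n) ∈ homogeneousCoordinates k V) (i : Fin 4) :
    ofCoordinates k V ⟨(x, B n), h⟩ ∈ flagOrbit B i ↔
      (B x x = 0 ↔ i = 0 ∨ i = 1) ∧ (B n n = 0 ↔ i = 0 ∨ i = 2) := by
  have h1 : (ofCoordinates k V ⟨(x, B n), h⟩).L ∈ isotropicLines B ↔ B x x = 0 :=
    mk_mem_isotropicLines h.1
  have h2 : IsTangentPlane B (ofCoordinates k V ⟨(x, B n), h⟩).P ↔ B n n = 0 :=
    isTangentPlane_ker_iff hs hB
  fin_cases i <;> simp [flagOrbit, h1, h2]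

theorem exists_isConicBasis [IsAlgClosed k] (h2 : (2 : k) ≠ 0) {B : BilinForm k V}
    (hs : B.IsSymm) (hB : B.Nondegenerate) : ∃ e : Basis (Fin 3) k V, IsConicBasis B e := by
  have h3 : Module.finrank k V = 3 := Fact.out
  have : Nontrivial V := Module.nontrivial_of_finrank_pos (R := k) (by omega)
  obtain ⟨v, hv, hvv⟩ : ∃ v : V, v ≠ 0 ∧ B v v = 0 := by
    obtain ⟨x, hx⟩ := exists_ne (0 : V)
    by_cases hxx : B x x = 0
    · exact ⟨x, hx, hxx⟩
    have hne : B.orthogonal (k ∙ x) ≠ ⊥ := fun h => by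
      have := LinearMap.BilinForm.finrank_orthogonal hB (k ∙ x)
      rw [h, finrank_bot, h3, finrank_span_singleton hx] at this
      omega
    obtain ⟨y, hy, hy0⟩ := Submodule.exists_mem_ne_zero_of_ne_bot hne
    have hxy : B x y = 0 := hy x (Submodule.mem_span_singleton_self x)
    by_cases hyy : B y y = 0
    · exact ⟨y, hy0, hyy⟩
    obtain ⟨t, ht⟩ := IsAlgClosed.exists_pow_nat_eq (-B x x / B y y) (n := 2) (by norm_num)
    refine ⟨x + t • y, fun h => hxx ?_, ?_⟩
    · simpa [hxy] using congrArg (B x) h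
    · simp only [map_add, map_smul, LinearMap.add_apply, LinearMap.smul_apply, hs.eq y x, hxy,
        smul_eq_mul, mul_zero, add_zero, zero_add]
      rw [← mul_assoc, ← pow_two, ht, div_mul_cancel₀ _ hyy, add_neg_cancel]
  obtain ⟨e, he, _⟩ := exists_isConicBasis_zero_eq hs hB h2 hv hvv
  exact ⟨e, he⟩

theorem exists_standard_eq [IsAlgClosed k] (h2 : (2 : k) ≠ 0) {B : BilinForm k V}
    (hs : B.IsSymm) (hB : B.Nondegenerate) {i : Fin 4} {F : FullFlag k V} (hF : F ∈ flagOrbit B i) :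
    ∃ (e : Basis (Fin 3) k V) (he : IsConicBasis B e),
      F = ofCoordinates k V ⟨_, standard_mem hB he i⟩ := by
  obtain ⟨x, n, h, rfl⟩ := exists_coordinates_form hB F
  rw [ofCoordinates_mem_flagOrbit hs hB] at hF
  have hx : x ≠ 0 := h.1
  have hn : n ≠ 0 := fun h0 => h.2.1 (by simp [h0])
  have hnx : B n x = 0 := h.2.2
  have hxn : B x n = 0 := by rw [hs.eq, hnx]
  -- it suffices to find a conic basis that is adapted to the two vectors up to scalars
  suffices H : ∃ (e : Basis (Fin 3) k V) (a b : k), IsConicBasis B e ∧ a ≠ 0 ∧ b ≠ 0 ∧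
      standardLine e i = a • x ∧ standardNormal e i = b • n by
    obtain ⟨e, a, b, he, ha, hb, h1, h3⟩ := H
    exact ⟨e, he, ofCoordinates_eq_iff.2 ⟨a, b, ha, hb, h1,
      (congrArg B h3).trans (map_smul B b n)⟩⟩
  fin_cases i
  · obtain ⟨hxx, hnn⟩ : B x x = 0 ∧ B n n = 0 := by simpa using hF
    obtain ⟨e, he, h0⟩ := exists_isConicBasis_zero_eq hs hB h2 hx hxx
    have hc2 : e.coord 2 n = 0 := by
      rw [← h0, he.apply] at hnx
      simpa using hnx
    have hc1 : e.coord 1 n = 0 := by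
      rw [he.apply, hc2] at hnn
      simpa [h2] using hnn
    have hn0 : n = e.coord 0 n • e 0 := by
      conv_lhs => rw [← e.sum_repr n]
      rw [Fin.sum_univ_three, ← Basis.coord_apply, ← Basis.coord_apply, ← Basis.coord_apply, hc1,
        hc2, zero_smul, zero_smul, add_zero, add_zero]
    have hc0 : e.coord 0 n ≠ 0 := fun h => hn (by rw [hn0, h, zero_smul])
    refine ⟨e, 1, (e.coord 0 n)⁻¹, he, one_ne_zero, inv_ne_zero hc0, ?_, ?_⟩
    · rw [one_smul, ← h0]
      rfl
    · rw [inv_smul_eq_iff₀ hc0 |>.2 hn0]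
      rfl
  · obtain ⟨hxx, hnn⟩ : B x x = 0 ∧ B n n ≠ 0 := by simpa using hF
    obtain ⟨a, ha, han⟩ := exists_normalize h2 hnn
    obtain ⟨e, he, h0, h1⟩ := exists_isConicBasis_of_isotropic hs hB h2 hx hxx
      (by rw [map_smul, hxn, smul_zero]) han
    exact ⟨e, 1, a, he, one_ne_zero, ha, by rw [one_smul, ← h0]; rfl, h1⟩
  · obtain ⟨hxx, hnn⟩ : B x x ≠ 0 ∧ B n n = 0 := by simpa using hF
    obtain ⟨a, ha, hax⟩ := exists_normalize h2 hxx
    obtain ⟨e, he, h0, h1⟩ := exists_isConicBasis_of_isotropic hs hB h2 hn hnn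
      (by rw [map_smul, hnx, smul_zero]) hax
    exact ⟨e, a, 1, he, ha, one_ne_zero, h1, by rw [one_smul, ← h0]; rfl⟩
  · obtain ⟨hxx, hnn⟩ : B x x ≠ 0 ∧ B n n ≠ 0 := by simpa using hF
    obtain ⟨a, ha, hax⟩ := exists_normalize h2 hxx
    obtain ⟨b, hb, hbn⟩ := exists_normalize h2 hnn
    obtain ⟨e, he, h0, h1⟩ := exists_isConicBasis_of_orthogonal hs hB h2 (a := a • x) (b := b • n)
      (by rw [map_smul, map_smul, LinearMap.smul_apply, hxn, smul_zero, smul_zero]) hax hbn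
    exact ⟨e, a, b, he, ha, hb, h0, h1⟩

theorem standard_mem_flagOrbit (h2 : (2 : k) ≠ 0) {B : BilinForm k V}
    (hs : B.IsSymm) (hB : B.Nondegenerate) {e : Basis (Fin 3) k V} (he : IsConicBasis B e)
    (i : Fin 4) : ofCoordinates k V ⟨_, standard_mem hB he i⟩ ∈ flagOrbit B i := by
  rw [ofCoordinates_mem_flagOrbit hs hB]
  have h2' : (1 + 1 : k) ≠ 0 := by rwa [one_add_one_eq_two]
  fin_cases i <;> simp [standardLine, standardNormal, he _ _, conicGram, h2, h2']

theorem orbit_eq_flagOrbit [IsAlgClosed k] (h2 : (2 : k) ≠ 0) {B : BilinForm k V}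
    (hs : B.IsSymm) (hB : B.Nondegenerate) {i : Fin 4} {F : FullFlag k V} (hF : F ∈ flagOrbit B i) :
    MulAction.orbit (specialOrthogonal B) F = flagOrbit B i := by
  refine Set.Subset.antisymm ?_ fun F' hF' => ?_
  · rintro _ ⟨⟨g, hg⟩, rfl⟩
    obtain ⟨x, n, h, rfl⟩ := exists_coordinates_form hB F
    have hgn : (B n).comp g⁻¹.1 = B (g.1 n) := LinearMap.ext fun y => by
      rw [LinearMap.comp_apply, ← hg.1 n, apply_inv_apply]
    obtain ⟨h', he⟩ := smul_ofCoordinates g ⟨(x, B n), h⟩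
    change g • ofCoordinates k V ⟨(x, B n), h⟩ ∈ _
    rw [he]
    simp only [hgn] at h' ⊢
    rw [ofCoordinates_mem_flagOrbit hs hB] at hF ⊢
    rwa [hg.1, hg.1]
  · obtain ⟨e, he, rfl⟩ := exists_standard_eq h2 hs hB hF
    obtain ⟨e', he', rfl⟩ := exists_standard_eq h2 hs hB hF'
    obtain ⟨g, hg, c, hc, hge⟩ := exists_specialOrthogonal_apply_eq hB (e := e) (e' := e')
      fun a b => by rw [he, he']
    refine ⟨⟨g, hg⟩, ?_⟩
    obtain ⟨h', hsm⟩ := smul_ofCoordinates g ⟨_, standard_mem hB he i⟩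
    have hgn : (B (standardNormal e i)).comp g⁻¹.1 = B (g.1 (standardNormal e i)) :=
      LinearMap.ext fun y => by
        rw [LinearMap.comp_apply, ← hg.1 (standardNormal e i), apply_inv_apply]
    have h1 : g.1 (standardLine e i) = c • standardLine e' i := by
      fin_cases i <;> simp [standardLine, hge]
    have h3 : g.1 (standardNormal e i) = c • standardNormal e' i := by
      fin_cases i <;> simp [standardNormal, hge, smul_sub]
    refine hsm.trans (ofCoordinates_eq_iff.2 ⟨c⁻¹, c⁻¹, inv_ne_zero hc, inv_ne_zero hc, ?_, ?_⟩)
    · exact ((inv_smul_eq_iff₀ hc).2 h1).symm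
    · refine ((inv_smul_eq_iff₀ hc).2 (hgn.trans ?_)).symm
      rw [h3, map_smul]

theorem flagOrbit_injective_and_range [IsAlgClosed k] (h2 : (2 : k) ≠ 0) {B : BilinForm k V}
    (hs : B.IsSymm) (hB : B.Nondegenerate) : Function.Injective (flagOrbit B) ∧
      Set.range (fun F : FullFlag k V => MulAction.orbit (specialOrthogonal B) F) =
        Set.range (flagOrbit B) := by
  obtain ⟨e, he⟩ := exists_isConicBasis (V := V) h2 hs hB
  have hmem := standard_mem_flagOrbit h2 hs hB he
  refine ⟨fun i j hij => eq_of_mem_flagOrbit (hmem i) (hij ▸ hmem i), Set.Subset.antisymm ?_ ?_⟩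
  · rintro _ ⟨F, rfl⟩
    obtain ⟨i, hi⟩ := exists_mem_flagOrbit B F
    exact ⟨i, (orbit_eq_flagOrbit h2 hs hB hi).symm⟩
  · rintro _ ⟨i, rfl⟩
    exact ⟨_, orbit_eq_flagOrbit h2 hs hB (hmem i)⟩

end Orbits

/-! ### Closures of the orbits -/

section Closures

open LinearMap (GeneralLinearGroup BilinForm)
open Module (Basis)
open FullFlag SpaceWithFunctions

variable {k : Type u} [Field k]

theorem exists_polynomial_eval_line {W : Type w} [AddCommGroup W] [Module k W] {p : W → k}
    (hp : p ∈ polynomialFunctions k W) (a b : W) :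
    ∃ P : Polynomial k, ∀ t : k, p (a + t • b) = P.eval t := by
  induction hp using Algebra.adjoin_induction with
  | mem p hp =>
    obtain ⟨ℓ, rfl⟩ := hp
    exact ⟨.C (ℓ a) + .C (ℓ b) * .X, fun t => by simp [mul_comm t]⟩
  | algebraMap c => exact ⟨.C c, fun t => by simp⟩
  | add p q _ _ hp hq =>
    obtain ⟨P, hP⟩ := hp
    obtain ⟨Q, hQ⟩ := hq
    exact ⟨P + Q, fun t => by simp [hP, hQ]⟩
  | mul p q _ _ hp hq =>
    obtain ⟨P, hP⟩ := hp
    obtain ⟨Q, hQ⟩ := hq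
    exact ⟨P * Q, fun t => by simp [hP, hQ]⟩

theorem Polynomial.exists_ne_eval_ne_zero [Infinite k] {P : Polynomial k} (hP : P ≠ 0) (a : k) :
    ∃ t, t ≠ a ∧ P.eval t ≠ 0 := by
  by_contra! h
  refine hP (Polynomial.eq_zero_of_infinite_isRoot P (Set.Infinite.mono (s := {a}ᶜ)
    (fun t ht => h t ht) (Set.finite_singleton a).infinite_compl))

variable {V : Type v} [AddCommGroup V] [Module k V] [Fact (Module.finrank k V = 3)]

theorem isClosed_of_ofCoordinates_mem_iff {Z : Set (FullFlag k V)} {q : V × Module.Dual k V → k}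
    (hq : q ∈ polynomialFunctions k (V × Module.Dual k V))
    (h : ∀ c, ofCoordinates k V c ∈ Z ↔ q c.1 = 0) : IsClosed (X := FullFlag.variety k V) Z := by
  refine isClosed_coinduced.2 ?_
  have hpre : ofCoordinates k V ⁻¹' Z = {c | q c.1 = 0} := Set.ext h
  have hcl : IsClosed (X := (affineSpace k _).sub (homogeneousCoordinates k V)) {c | q c.1 = 0} :=
    (isClosed_eq_zero hq).preimage
    (isMorphism_subtype_val (affineSpace k (V × Module.Dual k V)) (homogeneousCoordinates k V)).1
  exact hpre ▸ hcl

/-- If the points with parameter `t ≠ 0` on a line in the space of homogeneous coordinates lie in a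
set of flags, then the point with parameter `0` lies in the closure of this set. -/
theorem mem_closure_of_line [Infinite k] {S : Set (FullFlag k V)} (a b : V × Module.Dual k V)
    (hC : ∀ t : k, a + t • b ∈ homogeneousCoordinates k V)
    (hS : ∀ t : k, t ≠ 0 → ofCoordinates k V ⟨a + t • b, hC t⟩ ∈ S)
    (ha : a ∈ homogeneousCoordinates k V) :
    ofCoordinates k V ⟨a, ha⟩ ∈ closure (X := FullFlag.variety k V) S := by
  refine (mem_closure_iff (X := FullFlag.variety k V)).2 fun U hU haU => ?_
  obtain ⟨O, hO, hOU⟩ := isOpen_induced_iff.1 (isOpen_coinduced.1 hU)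
  have hmem : ∀ c, ofCoordinates k V c ∈ U ↔ c.1 ∈ O := fun c =>
    (Set.ext_iff.1 hOU c).symm
  obtain ⟨q, hq, hqa, hqO⟩ := exists_ne_zero_subset hO ((hmem ⟨a, ha⟩).1 haU)
  obtain ⟨P, hP⟩ := exists_polynomial_eval_line hq a b
  have hP0 : P ≠ 0 := by
    rintro rfl
    have := hP 0
    rw [zero_smul, add_zero, Polynomial.eval_zero] at this
    exact hqa this
  obtain ⟨t, ht, hPt⟩ := Polynomial.exists_ne_eval_ne_zero hP0 0
  exact ⟨_, (hmem ⟨a + t • b, hC t⟩).2 (hqO _ (by rwa [hP])), hS t ht⟩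

/-- The linear form `(x, ξ) ↦ xᵢ` on homogeneous coordinates of flags. -/
noncomputable def lineCoord (e : Basis (Fin 3) k V) (i : Fin 3) :
    Module.Dual k (V × Module.Dual k V) :=
  (e.coord i).comp (LinearMap.fst k _ _)

/-- The linear form `(x, ξ) ↦ ξ v` on homogeneous coordinates of flags. -/
def planeCoord (v : V) : Module.Dual k (V × Module.Dual k V) :=
  (Module.Dual.eval k V v).comp (LinearMap.snd k _ _)

variable {B : BilinForm k V}

theorem isClosed_isotropicLines {e : Basis (Fin 3) k V} (he : IsConicBasis B e) :
    IsClosed (X := FullFlag.variety k V) {F | F.L ∈ isotropicLines B} := by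
  refine isClosed_of_ofCoordinates_mem_iff
    (q := fun c => 2 * (lineCoord e 1 c * lineCoord e 1 c) - lineCoord e 0 c * lineCoord e 2 c -
      lineCoord e 2 c * lineCoord e 0 c) ?_ fun c => ?_
  · have h := fun i => dual_mem_polynomialFunctions (lineCoord e i)
    exact Subalgebra.sub_mem _ (Subalgebra.sub_mem _ (Subalgebra.mul_mem _
      (Subalgebra.algebraMap_mem _ (2 : k)) (Subalgebra.mul_mem _ (h 1) (h 1)))
      (Subalgebra.mul_mem _ (h 0) (h 2))) (Subalgebra.mul_mem _ (h 2) (h 0))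
  · refine (mk_mem_isotropicLines c.2.1).trans ?_
    rw [he.apply]
    rfl

theorem isClosed_isTangentPlane (h2 : (2 : k) ≠ 0) (hs : B.IsSymm) (hB : B.Nondegenerate)
    {e : Basis (Fin 3) k V} (he : IsConicBasis B e) :
    IsClosed (X := FullFlag.variety k V) {F | IsTangentPlane B F.P} := by
  refine isClosed_of_ofCoordinates_mem_iff
    (q := fun c => planeCoord (e 1) c * planeCoord (e 1) c -
      4 * (planeCoord (e 0) c * planeCoord (e 2) c)) ?_ fun c => ?_
  · have h := fun i => dual_mem_polynomialFunctions (planeCoord (k := k) (e i))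
    exact Subalgebra.sub_mem _ (Subalgebra.mul_mem _ (h 1) (h 1)) (Subalgebra.mul_mem _
      (Subalgebra.algebraMap_mem _ (4 : k)) (Subalgebra.mul_mem _ (h 0) (h 2)))
  · refine (he.isTangentPlane_ker_iff h2 hs hB).trans ?_
    rw [pow_two, sub_eq_zero]
    rfl

theorem flagOrbitClosure_one [IsAlgClosed k] (h2 : (2 : k) ≠ 0) (hs : B.IsSymm)
    (hB : B.Nondegenerate) : flagOrbitClosure B 1 = {F | F.L ∈ isotropicLines B} := by
  obtain ⟨e, he⟩ := exists_isConicBasis (V := V) h2 hs hB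
  have := IsAlgClosed.instInfinite (K := k)
  refine Set.Subset.antisymm (closure_minimal (X := FullFlag.variety k V) (fun F hF => hF.1)
    (isClosed_isotropicLines he)) fun F hF => ?_
  by_cases hP : IsTangentPlane B F.P
  · obtain ⟨e, he, rfl⟩ := exists_standard_eq (i := 0) h2 hs hB ⟨hF, hP⟩
    -- rotate the tangent plane about its point of contact
    have hC : ∀ t : k, (e 0, B (e 0 + t • e 1)) ∈ homogeneousCoordinates k V := fun t => by
      refine ⟨e.ne_zero 0, fun h => ?_, by simp [he _ _, conicGram]⟩
      have := LinearMap.congr_fun h (e 2)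
      simp [he _ _, conicGram] at this
    have hC' : ∀ t : k, (e 0, B (e 0)) + t • ((0 : V), B (e 1)) = (e 0, B (e 0 + t • e 1)) :=
      fun t => by simp
    refine mem_closure_of_line (e 0, B (e 0)) (0, B (e 1)) (fun t => by rw [hC']; exact hC t)
      (fun t ht => ?_) (standard_mem hB he 0)
    simp only [hC']
    rw [ofCoordinates_mem_flagOrbit hs hB]
    simp [he _ _, conicGram, ht, h2]
  · exact subset_closure (X := FullFlag.variety k V) ⟨hF, hP⟩

theorem flagOrbitClosure_two [IsAlgClosed k] (h2 : (2 : k) ≠ 0) (hs : B.IsSymm)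
    (hB : B.Nondegenerate) : flagOrbitClosure B 2 = {F | IsTangentPlane B F.P} := by
  obtain ⟨e, he⟩ := exists_isConicBasis (V := V) h2 hs hB
  have := IsAlgClosed.instInfinite (K := k)
  refine Set.Subset.antisymm (closure_minimal (X := FullFlag.variety k V) (fun F hF => hF.2)
    (isClosed_isTangentPlane h2 hs hB he)) fun F hF => ?_
  by_cases hL : F.L ∈ isotropicLines B
  · obtain ⟨e, he, rfl⟩ := exists_standard_eq (i := 0) h2 hs hB ⟨hL, hF⟩
    -- move the point of contact along the tangent
    have hC : ∀ t : k, (e 0 + t • e 1, B (e 0)) ∈ homogeneousCoordinates k V := fun t => by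
      refine ⟨fun h => ?_, (standard_mem hB he 0).2.1, by simp [he _ _, conicGram]⟩
      have := congrArg (B (e 2)) h
      simp [he _ _, conicGram] at this
    have hC' : ∀ t : k, (e 0, B (e 0)) + t • (e 1, (0 : Module.Dual k V)) =
        (e 0 + t • e 1, B (e 0)) := fun t => by simp
    refine mem_closure_of_line (e 0, B (e 0)) (e 1, 0) (fun t => by rw [hC']; exact hC t)
      (fun t ht => ?_) (standard_mem hB he 0)
    simp only [hC']
    rw [ofCoordinates_mem_flagOrbit hs hB]
    simp [he _ _, conicGram, ht, h2]
  · exact subset_closure (X := FullFlag.variety k V) ⟨hL, hF⟩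

end Closures

/-! ### Pairs of conics that meet in four points -/

section ConicPairs

open LinearMap (GeneralLinearGroup BilinForm)
open Module (Basis)
open FullFlag SpaceWithFunctions

variable {k : Type u} {V : Type v} [Field k] [AddCommGroup V] [Module k V]

theorem smul_isotropicLines (B : BilinForm k V) (g : GeneralLinearGroup k V) :
    g • isotropicLines B = isotropicLines (B.comp g⁻¹.1 g⁻¹.1) := by
  ext L
  induction L with
  | h x hx =>
    exact (mk_mem_smul_isotropicLines hx).trans
      (mk_mem_isotropicLines (B := B.comp g⁻¹.1 g⁻¹.1) hx).symm

theorem isSymm_comp {B : BilinForm k V} (hs : B.IsSymm) (g : GeneralLinearGroup k V) :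
    (B.comp g⁻¹.1 g⁻¹.1).IsSymm := ⟨fun x y => hs.eq (g⁻¹.1 x) (g⁻¹.1 y)⟩

theorem nondegenerate_comp {B : BilinForm k V} (hB : B.Nondegenerate)
    (g : GeneralLinearGroup k V) : (B.comp g⁻¹.1 g⁻¹.1).Nondegenerate := by
  refine ⟨fun x h => ?_, fun x h => ?_⟩
  · rw [← apply_inv_apply g x, hB.1 (g⁻¹.1 x) fun y => ?_, map_zero]
    simpa [inv_apply_apply] using h (g.1 y)
  · rw [← apply_inv_apply g x, hB.2 (g⁻¹.1 x) fun y => ?_, map_zero]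
    simpa [inv_apply_apply] using h (g.1 y)

/-- The point with parameter `s / t` of the conic given by a conic basis. -/
def conicPoint (e : Fin 3 → V) (s t : k) : V := s ^ 2 • e 0 + (s * t) • e 1 + t ^ 2 • e 2

theorem coord_conicPoint (e : Basis (Fin 3) k V) (s t : k) : e.coord 0 (conicPoint e s t) = s ^ 2 ∧
    e.coord 1 (conicPoint e s t) = s * t ∧ e.coord 2 (conicPoint e s t) = t ^ 2 := by
  refine ⟨?_, ?_, ?_⟩ <;> simp [conicPoint]

theorem conicPoint_ne_zero (e : Basis (Fin 3) k V) {s t : k} (h : s ≠ 0 ∨ t ≠ 0) :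
    conicPoint e s t ≠ 0 := by
  intro h0
  obtain ⟨h1, _, h3⟩ := coord_conicPoint e s t
  rw [h0, map_zero, eq_comm] at h1 h3
  rcases h with h | h
  · exact h (pow_eq_zero_iff two_ne_zero |>.1 h1)
  · exact h (pow_eq_zero_iff two_ne_zero |>.1 h3)

theorem eq_sum_coord (e : Basis (Fin 3) k V) (x : V) :
    x = e.coord 0 x • e 0 + e.coord 1 x • e 1 + e.coord 2 x • e 2 := by
  conv_lhs => rw [← e.sum_repr x]
  rw [Fin.sum_univ_three]
  rfl

theorem IsConicBasis.conicPoint_isotropic {B : BilinForm k V} {e : Basis (Fin 3) k V}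
    (he : IsConicBasis B e) (s t : k) : B (conicPoint e s t) (conicPoint e s t) = 0 := by
  obtain ⟨h1, h3, h4⟩ := coord_conicPoint e s t
  rw [he.apply, h1, h3, h4]
  ring

theorem exists_sq_eq_of_sq_eq_mul [IsAlgClosed k] {a b c : k} (h : b ^ 2 = a * c) :
    ∃ s t : k, s ^ 2 = a ∧ s * t = b ∧ t ^ 2 = c := by
  obtain ⟨s, hs⟩ := IsAlgClosed.exists_pow_nat_eq a (n := 2) (by norm_num)
  by_cases hs0 : s = 0
  · obtain ⟨t, ht⟩ := IsAlgClosed.exists_pow_nat_eq c (n := 2) (by norm_num)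
    refine ⟨s, t, hs, ?_, ht⟩
    rw [← hs, hs0, zero_pow two_ne_zero, zero_mul] at h
    rw [hs0, zero_mul, pow_eq_zero_iff two_ne_zero |>.1 h]
  · refine ⟨s, b / s, hs, mul_div_cancel₀ _ hs0, ?_⟩
    rw [div_pow, h, ← hs, mul_div_cancel_left₀ _ (pow_ne_zero 2 hs0)]

theorem IsConicBasis.exists_eq_conicPoint [IsAlgClosed k] (h2 : (2 : k) ≠ 0) {B : BilinForm k V}
    {e : Basis (Fin 3) k V} (he : IsConicBasis B e) {x : V} (hx : x ≠ 0) (hxx : B x x = 0) :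
    ∃ s t : k, (s ≠ 0 ∨ t ≠ 0) ∧ x = conicPoint e s t := by
  have hq : e.coord 1 x ^ 2 = e.coord 0 x * e.coord 2 x := by
    rw [he.apply] at hxx
    refine mul_left_cancel₀ h2 ?_
    linear_combination hxx
  obtain ⟨s, t, hs, hst, ht⟩ := exists_sq_eq_of_sq_eq_mul hq
  have hxe : x = conicPoint e s t := by
    conv_lhs => rw [eq_sum_coord e x]
    rw [← hs, ← ht, ← hst]
    rfl
  refine ⟨s, t, ?_, hxe⟩
  by_contra! h
  exact hx (by rw [hxe, h.1, h.2]; simp [conicPoint])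

theorem mul_eq_mul_of_sq_eq {a s t s' t' : k} (h1 : a * s' ^ 2 = s ^ 2)
    (h2 : a * (s' * t') = s * t) (h3 : a * t' ^ 2 = t ^ 2) : s * t' = s' * t := by
  rw [← sub_eq_zero, ← pow_eq_zero_iff two_ne_zero]
  linear_combination (-t' ^ 2) * h1 + 2 * s' * t' * h2 - s' ^ 2 * h3

theorem exists_eq_mul_of_mul_eq_mul {s t s' t' : k} (h' : s' ≠ 0 ∨ t' ≠ 0) (h : s * t' = s' * t) :
    ∃ c, s = c * s' ∧ t = c * t' := by
  rcases h' with h' | h'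
  · refine ⟨s / s', by field_simp, ?_⟩
    field_simp
    linear_combination -h
  · refine ⟨t / t', ?_, by field_simp⟩
    field_simp
    linear_combination h

theorem mk_conicPoint_eq_iff (e : Basis (Fin 3) k V) {s t s' t' : k} (h : s ≠ 0 ∨ t ≠ 0)
    (h' : s' ≠ 0 ∨ t' ≠ 0) :
    Projectivization.mk k _ (conicPoint_ne_zero e h) =
      Projectivization.mk k _ (conicPoint_ne_zero e h') ↔ s * t' = s' * t := by
  rw [Projectivization.mk_eq_mk_iff']
  constructor
  · rintro ⟨a, ha⟩
    obtain ⟨h1, h3, h4⟩ := coord_conicPoint e s t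
    obtain ⟨h1', h3', h4'⟩ := coord_conicPoint e s' t'
    rw [← ha, map_smul, smul_eq_mul] at h1 h3 h4
    rw [h1'] at h1
    rw [h3'] at h3
    rw [h4'] at h4
    exact mul_eq_mul_of_sq_eq h1 h3 h4
  · intro hst
    obtain ⟨c, rfl, rfl⟩ := exists_eq_mul_of_mul_eq_mul h' hst
    refine ⟨c ^ 2, ?_⟩
    simp only [conicPoint]
    module

/-- Parametrising the first conic, its points on a second conic through `e 0` are `e 0` and the
zeros of a polynomial in the parameter. -/
theorem encard_isotropicLines_inter [IsAlgClosed k] (h2 : (2 : k) ≠ 0) {B B' : BilinForm k V}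
    {e : Basis (Fin 3) k V} (he : IsConicBasis B e) (h0 : B' (e 0) (e 0) = 0) :
    (isotropicLines B ∩ isotropicLines B').encard =
      {s : k | B' (conicPoint e s 1) (conicPoint e s 1) = 0}.encard + 1 := by
  let φ : k → ℙ k V := fun s =>
    Projectivization.mk k (conicPoint e s 1) (conicPoint_ne_zero e (Or.inr one_ne_zero))
  have hφ : Function.Injective φ := fun s s' h => by
    simpa using (mk_conicPoint_eq_iff e (Or.inr one_ne_zero) (Or.inr one_ne_zero)).1 h
  have hp : ∀ s, φ s ≠ Projectivization.mk k (conicPoint e (1 : k) 0)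
      (conicPoint_ne_zero e (Or.inl one_ne_zero)) := fun s h => by
    simpa using (mk_conicPoint_eq_iff e (Or.inr one_ne_zero) (Or.inl one_ne_zero)).1 h
  have h10 : conicPoint e (1 : k) 0 = e 0 := by simp [conicPoint]
  rw [← hφ.injOn.encard_image, ← Set.encard_insert_of_notMem
    (a := Projectivization.mk k (conicPoint e (1 : k) 0)
      (conicPoint_ne_zero e (Or.inl one_ne_zero)))]
  · congr 1
    ext L
    induction L with
    | h x hx =>
      rw [Set.mem_inter_iff, mk_mem_isotropicLines, mk_mem_isotropicLines]
      constructor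
      · rintro ⟨hxx, hxx'⟩
        obtain ⟨s, t, hst, rfl⟩ := he.exists_eq_conicPoint h2 hx hxx
        by_cases ht : t = 0
        · left
          rw [mk_conicPoint_eq_iff e hst (Or.inl one_ne_zero), ht]
          simp
        · right
          have hmk := (mk_conicPoint_eq_iff e (s' := s / t) hst (Or.inr one_ne_zero)).2
            (by field_simp)
          have hmem := (mk_mem_isotropicLines (B := B') hx).2 hxx'
          rw [hmk, mk_mem_isotropicLines] at hmem
          exact ⟨s / t, hmem, hmk.symm⟩
      · rw [← mk_mem_isotropicLines (B := B) hx, ← mk_mem_isotropicLines (B := B') hx]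
        rintro (h | ⟨s, hs, h⟩)
        · rw [h, mk_mem_isotropicLines, mk_mem_isotropicLines]
          refine ⟨he.conicPoint_isotropic _ _, ?_⟩
          rwa [h10]
        · rw [← h, mk_mem_isotropicLines, mk_mem_isotropicLines]
          exact ⟨he.conicPoint_isotropic _ _, hs⟩
  · rintro ⟨s, _, hs⟩
    exact hp s hs

theorem apply_conicPoint {B' : BilinForm k V} (hs' : B'.IsSymm) (e : Fin 3 → V) (s : k) :
    B' (conicPoint e s 1) (conicPoint e s 1) = B' (e 0) (e 0) * s ^ 4 + 2 * B' (e 0) (e 1) * s ^ 3 +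
      (B' (e 1) (e 1) + 2 * B' (e 0) (e 2)) * s ^ 2 + 2 * B' (e 1) (e 2) * s + B' (e 2) (e 2) := by
  simp only [conicPoint, map_add, map_smul, LinearMap.add_apply, LinearMap.smul_apply, smul_eq_mul,
    hs'.eq (e 1) (e 0), hs'.eq (e 2) (e 0), hs'.eq (e 2) (e 1)]
  ring

/-- Conic bases `e` of `B` and `f` of `B'` that are adapted to a common point of the two conics: the
point `e 0 = f 0`. -/
structure IsConicFrame (B B' : BilinForm k V) (e f : Basis (Fin 3) k V) (α₀ α₁ β₀ β₁ : k) :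
    Prop where
  left : IsConicBasis B e
  right : IsConicBasis B' f
  zero_eq : e 0 = f 0
  one_eq : e 1 = α₀ • f 0 + α₁ • f 1 - f 2
  two_eq : e 2 = β₀ • f 0 + β₁ • f 1

theorem IsConicFrame.apply_conicPoint {B B' : BilinForm k V} {e f : Basis (Fin 3) k V}
    {α₀ α₁ β₀ β₁ : k} (h : IsConicFrame B B' e f α₀ α₁ β₀ β₁) (s : k) :
    B' (conicPoint e s 1) (conicPoint e s 1) =
      2 * (s ^ 3 + (α₀ + α₁ ^ 2) * s ^ 2 + (β₀ + 2 * α₁ * β₁) * s + β₁ ^ 2) := by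
  have hx : conicPoint e s 1 = (s ^ 2 + α₀ * s + β₀) • f 0 + (α₁ * s + β₁) • f 1 + (-s) • f 2 := by
    rw [conicPoint, h.zero_eq, h.one_eq, h.two_eq]
    module
  rw [hx, h.right.apply]
  simp
  ring

theorem encard_eq_of_ncard_eq_four {α : Type*} {s : Set α} (h : s.ncard = 4) : s.encard = 4 := by
  rw [← (Set.finite_of_ncard_ne_zero (by omega : s.ncard ≠ 0)).cast_ncard_eq, h]
  rfl

/-- The three intersections of the conics other than `e 0` have distinct parameters. -/
theorem IsConicFrame.exists_roots [IsAlgClosed k] (h2 : (2 : k) ≠ 0) {B B' : BilinForm k V}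
    {e f : Basis (Fin 3) k V} {α₀ α₁ β₀ β₁ : k} (h : IsConicFrame B B' e f α₀ α₁ β₀ β₁)
    (h4 : (isotropicLines B ∩ isotropicLines B').ncard = 4) :
    ∃ r₁ r₂ r₃ : k, r₁ ≠ r₂ ∧ r₁ ≠ r₃ ∧ r₂ ≠ r₃ ∧ α₀ + α₁ ^ 2 = -(r₁ + r₂ + r₃) ∧
      β₀ + 2 * α₁ * β₁ = r₁ * r₂ + r₁ * r₃ + r₂ * r₃ ∧ β₁ ^ 2 = -(r₁ * r₂ * r₃) := by
  have h0 : B' (e 0) (e 0) = 0 := by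
    rw [h.zero_eq, h.right]
    rfl
  have hcard := encard_isotropicLines_inter h2 h.left h0
  rw [encard_eq_of_ncard_eq_four h4, show (4 : ℕ∞) = 3 + 1 from rfl] at hcard
  have hcard' := (ENat.add_left_injective_of_ne_top ENat.one_ne_top hcard).symm
  obtain ⟨r₁, r₂, r₃, h12, h13, h23, hr⟩ := Set.encard_eq_three.1 hcard'
  have hroot : ∀ r ∈ ({r₁, r₂, r₃} : Set k),
      r ^ 3 + (α₀ + α₁ ^ 2) * r ^ 2 + (β₀ + 2 * α₁ * β₁) * r + β₁ ^ 2 = 0 := fun r hr' => by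
    rw [← hr, Set.mem_ofPred_eq, h.apply_conicPoint] at hr'
    exact (mul_eq_zero.1 hr').resolve_left h2
  have e1 := hroot r₁ (by simp)
  have e2 := hroot r₂ (by simp)
  have e3 := hroot r₃ (by simp)
  have d12 : r₁ ^ 2 + r₁ * r₂ + r₂ ^ 2 + (α₀ + α₁ ^ 2) * (r₁ + r₂) + (β₀ + 2 * α₁ * β₁) = 0 := by
    refine mul_left_cancel₀ (sub_ne_zero.2 h12) ?_
    linear_combination e1 - e2
  have d13 : r₁ ^ 2 + r₁ * r₃ + r₃ ^ 2 + (α₀ + α₁ ^ 2) * (r₁ + r₃) + (β₀ + 2 * α₁ * β₁) = 0 := by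
    refine mul_left_cancel₀ (sub_ne_zero.2 h13) ?_
    linear_combination e1 - e3
  have hA : α₀ + α₁ ^ 2 = -(r₁ + r₂ + r₃) := by
    refine mul_left_cancel₀ (sub_ne_zero.2 h23) ?_
    linear_combination d12 - d13
  refine ⟨r₁, r₂, r₃, h12, h13, h23, hA, ?_, ?_⟩
  · rw [hA] at d12
    linear_combination d12
  · rw [hA] at e1 d12
    linear_combination e1 - r₁ * d12

/-- The Weierstrass equation `Y² + 2 (α₁ X + β₁) Y = X³ + α₀ X² + β₀ X` of a conic frame. -/
def frameCurve (α₀ α₁ β₀ β₁ : k) : WeierstrassCurve k := ⟨2 * α₁, α₀, 2 * β₁, β₀, 0⟩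

theorem IsConicFrame.isElliptic [IsAlgClosed k] (h2 : (2 : k) ≠ 0) {B B' : BilinForm k V}
    {e f : Basis (Fin 3) k V} {α₀ α₁ β₀ β₁ : k} (h : IsConicFrame B B' e f α₀ α₁ β₀ β₁)
    (h4 : (isotropicLines B ∩ isotropicLines B').ncard = 4) :
    (frameCurve α₀ α₁ β₀ β₁).IsElliptic := by
  obtain ⟨r₁, r₂, r₃, h12, h13, h23, hA, hb, hc⟩ := h.exists_roots h2 h4
  refine ⟨isUnit_iff_ne_zero.2 ?_⟩
  have hΔ : (frameCurve α₀ α₁ β₀ β₁).Δ =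
      2 ^ 4 * ((r₁ - r₂) * (r₁ - r₃) * (r₂ - r₃)) ^ 2 := by
    have hΔ' : (frameCurve α₀ α₁ β₀ β₁).Δ = 2 ^ 4 * ((α₀ + α₁ ^ 2) ^ 2 * (β₀ + 2 * α₁ * β₁) ^ 2 -
        4 * (β₀ + 2 * α₁ * β₁) ^ 3 - 4 * (α₀ + α₁ ^ 2) ^ 3 * β₁ ^ 2 - 27 * (β₁ ^ 2) ^ 2 +
        18 * (α₀ + α₁ ^ 2) * (β₀ + 2 * α₁ * β₁) * β₁ ^ 2) := by
      simp only [frameCurve, WeierstrassCurve.Δ, WeierstrassCurve.b₂, WeierstrassCurve.b₄,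
        WeierstrassCurve.b₆, WeierstrassCurve.b₈]
      ring
    rw [hΔ', hA, hb, hc]
    ring
  rw [hΔ]
  exact mul_ne_zero (pow_ne_zero _ h2) (pow_ne_zero _ (mul_ne_zero (mul_ne_zero
    (sub_ne_zero.2 h12) (sub_ne_zero.2 h13)) (sub_ne_zero.2 h23)))

variable [Fact (Module.finrank k V = 3)]

/-- Two conics with four common points have different tangents at each of them: otherwise the
polynomial of the other intersections has degree at most two. -/
theorem exists_transversal [IsAlgClosed k] (h2 : (2 : k) ≠ 0) {B B' : BilinForm k V}
    (hs : B.IsSymm) (hB : B.Nondegenerate) (hs' : B'.IsSymm)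
    (h4 : (isotropicLines B ∩ isotropicLines B').ncard = 4) {x : V} (hx : x ≠ 0)
    (hxx : B x x = 0) (hxx' : B' x x = 0) : ∃ u, B x u = 0 ∧ B' x u ≠ 0 := by
  obtain ⟨e, he, rfl⟩ := exists_isConicBasis_zero_eq hs hB h2 hx hxx
  refine ⟨e 1, by simp [he _ _, conicGram], fun h01 => ?_⟩
  have hcard := encard_isotropicLines_inter h2 he hxx'
  rw [encard_eq_of_ncard_eq_four h4] at hcard
  let p : Polynomial k := .C (B' (e 1) (e 1) + 2 * B' (e 0) (e 2)) * .X ^ 2 +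
    .C (2 * B' (e 1) (e 2)) * .X + .C (B' (e 2) (e 2))
  have hp : {s : k | B' (conicPoint e s 1) (conicPoint e s 1) = 0} = {s | p.IsRoot s} := by
    ext s
    rw [Set.mem_ofPred_eq, apply_conicPoint hs', hxx', h01]
    simp [p]
  rw [hp] at hcard
  have := IsAlgClosed.instInfinite (K := k)
  by_cases hp0 : p = 0
  · have huniv : {s : k | p.IsRoot s} = Set.univ := by
      rw [hp0]
      exact Set.eq_univ_of_forall fun s => Polynomial.eval_zero
    rw [huniv, Set.encard_eq_top Set.infinite_univ] at hcard
    simp at hcard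
  · have hle : {s : k | p.IsRoot s}.encard ≤ 2 := by
      classical
      have hsub : {s : k | p.IsRoot s} = (p.roots.toFinset : Set k) := by
        ext s
        simp [hp0]
      rw [hsub, Set.encard_coe_eq_coe_finsetCard]
      have h1 := (Multiset.toFinset_card_le p.roots).trans (p.card_roots')
      have h3 : p.natDegree ≤ 2 := Polynomial.natDegree_quadratic_le
      exact_mod_cast h1.trans h3
    have : (4 : ℕ∞) ≤ 2 + 1 := hcard ▸ add_le_add_left hle 1
    exact absurd this (by decide)

/-- Every common point of two conics with four common points carries a conic frame. -/
theorem exists_isConicFrame [IsAlgClosed k] (h2 : (2 : k) ≠ 0) {B B' : BilinForm k V}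
    (hs : B.IsSymm) (hB : B.Nondegenerate) (hs' : B'.IsSymm) (hB' : B'.Nondegenerate)
    (h4 : (isotropicLines B ∩ isotropicLines B').ncard = 4) {x : V} (hx : x ≠ 0)
    (hxx : B x x = 0) (hxx' : B' x x = 0) :
    ∃ (e f : Basis (Fin 3) k V) (α₀ α₁ β₀ β₁ a : k), IsConicFrame B B' e f α₀ α₁ β₀ β₁ ∧
      a ≠ 0 ∧ e 0 = a • x := by
  obtain ⟨e, he, he0⟩ := exists_isConicBasis_zero_eq hs hB h2 hx hxx
  obtain ⟨f, hf, hf0⟩ := exists_isConicBasis_zero_eq hs' hB' h2 hx hxx'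
  have h01 : B' x (e 1) ≠ 0 := fun h01 => by
    obtain ⟨u, hu, hu'⟩ := exists_transversal h2 hs hB hs' h4 hx hxx hxx'
    refine hu' ?_
    have hc : e.coord 2 u = 0 := by
      rw [← he0, he.apply] at hu
      simpa using hu
    rw [eq_sum_coord e u, hc, he0]
    simp [h01, hxx']
  -- a torus element and a unipotent element of the stabiliser of the point normalise the bases
  let a := (B' x (e 1))⁻¹
  let c := -B' x (e 2)
  have ha : a ≠ 0 := inv_ne_zero h01
  obtain ⟨e', hee, he'⟩ := exists_isConicBasis_of_gram (B := B) h2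
    ![a • x, e 1 + (2 * c) • (a • x), a⁻¹ • e 2 + c • e 1 + c ^ 2 • (a • x)] (by
      rw [← he0]
      intro i j
      fin_cases i <;> fin_cases j <;> simp [conicGram, he _ _, ha] <;> field_simp <;> ring)
  obtain ⟨f', hff, hf'⟩ := exists_isConicBasis_of_gram (B := B') h2 ![a • x, f 1, a⁻¹ • f 2] (by
      rw [← hf0]
      intro i j
      fin_cases i <;> fin_cases j <;> simp [conicGram, hf _ _, ha])
  have he'0 : e' 0 = a • x := by rw [hee]; rfl
  have he'1 : e' 1 = e 1 + (2 * c) • (a • x) := by rw [hee]; rfl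
  have he'2 : e' 2 = a⁻¹ • e 2 + c • e 1 + c ^ 2 • (a • x) := by rw [hee]; rfl
  have hf'0 : f' 0 = a • x := by rw [hff]; rfl
  have hcoord : ∀ y, f'.coord 2 y = -(a * B' x y) := fun y => by
    have h : B' (f' 0) y = -f'.coord 2 y := by
      rw [hf'.apply]
      simp
    rw [← neg_eq_iff_eq_neg, ← h, hf'0, map_smul, LinearMap.smul_apply, smul_eq_mul]
  have h1 : f'.coord 2 (e' 1) = -1 := by
    rw [hcoord, he'1]
    simp [hxx', a, h01]
  have h3 : f'.coord 2 (e' 2) = 0 := by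
    rw [hcoord, he'2]
    simp [hxx', a, c, h01]
    ring
  refine ⟨e', f', f'.coord 0 (e' 1), f'.coord 1 (e' 1), f'.coord 0 (e' 2), f'.coord 1 (e' 2), a,
    ⟨he', hf', he'0.trans hf'0.symm, ?_, ?_⟩, ha, he'0⟩
  · conv_lhs => rw [eq_sum_coord f' (e' 1), h1]
    rw [neg_one_smul, ← sub_eq_add_neg]
  · conv_lhs => rw [eq_sum_coord f' (e' 2), h3]
    rw [zero_smul, add_zero]

end ConicPairs

/-! ### Counting common points and common tangents -/

section Counting

open LinearMap (GeneralLinearGroup BilinForm)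
open Module (Basis)
open FullFlag SpaceWithFunctions

variable {k : Type u} {V : Type v} [Field k] [AddCommGroup V] [Module k V]

/-- The linear form whose kernel is the tangent plane with parameter `v / w` of the conic given by
a conic basis. -/
noncomputable def tangentForm (f : Basis (Fin 3) k V) (v w : k) : Module.Dual k V :=
  w ^ 2 • f.coord 0 - (2 * (v * w)) • f.coord 1 + v ^ 2 • f.coord 2

theorem tangentForm_apply_basis (f : Basis (Fin 3) k V) (v w : k) :
    tangentForm f v w (f 0) = w ^ 2 ∧ tangentForm f v w (f 1) = -(2 * (v * w)) ∧
      tangentForm f v w (f 2) = v ^ 2 := by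
  refine ⟨?_, ?_, ?_⟩ <;> simp [tangentForm]

theorem tangentForm_ne_zero (f : Basis (Fin 3) k V) {v w : k} (h : v ≠ 0 ∨ w ≠ 0) :
    tangentForm f v w ≠ 0 := by
  intro h0
  obtain ⟨h1, _, h3⟩ := tangentForm_apply_basis f v w
  rw [h0, LinearMap.zero_apply, eq_comm] at h1 h3
  rcases h with h | h
  · exact h (pow_eq_zero_iff two_ne_zero |>.1 h3)
  · exact h (pow_eq_zero_iff two_ne_zero |>.1 h1)

theorem ker_tangentForm_eq_iff (h2 : (2 : k) ≠ 0) (f : Basis (Fin 3) k V) {v w v' w' : k}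
    (h : v ≠ 0 ∨ w ≠ 0) (h' : v' ≠ 0 ∨ w' ≠ 0) :
    LinearMap.ker (tangentForm f v w) = LinearMap.ker (tangentForm f v' w') ↔ v * w' = v' * w := by
  constructor
  · intro hker
    obtain ⟨a, _, ha⟩ := exists_smul_eq_of_ker_eq (tangentForm_ne_zero f h') hker.symm
    obtain ⟨h1, h3, h4⟩ := tangentForm_apply_basis f v w
    obtain ⟨h1', h3', h4'⟩ := tangentForm_apply_basis f v' w'
    rw [ha, LinearMap.smul_apply, smul_eq_mul] at h1 h3 h4
    rw [h1'] at h1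
    rw [h3'] at h3
    rw [h4'] at h4
    refine mul_eq_mul_of_sq_eq h4 ?_ h1
    refine mul_left_cancel₀ h2 ?_
    linear_combination -h3
  · intro hvw
    obtain ⟨c, rfl, rfl⟩ := exists_eq_mul_of_mul_eq_mul h' hvw
    have hc : c ≠ 0 := by
      rintro rfl
      simp at h
    have : tangentForm f (c * v') (c * w') = c ^ 2 • tangentForm f v' w' := by
      simp only [tangentForm]
      module
    rw [this, LinearMap.ker_smul _ _ (pow_ne_zero 2 hc)]

theorem smul_flagOrbit [Fact (Module.finrank k V = 3)] {B : BilinForm k V} (hs : B.IsSymm)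
    (hB : B.Nondegenerate) (g : GeneralLinearGroup k V) (i : Fin 4) :
    g • flagOrbit B i = flagOrbit (B.comp g⁻¹.1 g⁻¹.1) i := by
  ext F
  obtain ⟨x, n, h, rfl⟩ := exists_coordinates_form (nondegenerate_comp hB g) F
  rw [ofCoordinates_mem_flagOrbit (isSymm_comp hs g) (nondegenerate_comp hB g),
    Set.mem_smul_set_iff_inv_smul_mem]
  obtain ⟨h', he⟩ := smul_ofCoordinates g⁻¹ ⟨(x, B.comp g⁻¹.1 g⁻¹.1 n), h⟩
  rw [he]
  have hn : (B.comp g⁻¹.1 g⁻¹.1 n).comp g⁻¹⁻¹.1 = B (g⁻¹.1 n) := LinearMap.ext fun y => by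
    rw [LinearMap.comp_apply, LinearMap.BilinForm.comp_apply, inv_inv, inv_apply_apply]
  simp only [hn] at h' ⊢
  rw [ofCoordinates_mem_flagOrbit hs hB]
  rfl

theorem isTangentPlane_eq_union (B : BilinForm k V) :
    {F : FullFlag k V | IsTangentPlane B F.P} = flagOrbit B 0 ∪ flagOrbit B 2 := by
  ext F
  by_cases h : F.L ∈ isotropicLines B <;> simp [flagOrbit, h]

theorem smul_isTangentPlane [Fact (Module.finrank k V = 3)] {B : BilinForm k V} (hs : B.IsSymm)
    (hB : B.Nondegenerate) (g : GeneralLinearGroup k V) :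
    g • {F : FullFlag k V | IsTangentPlane B F.P} =
      {F | IsTangentPlane (B.comp g⁻¹.1 g⁻¹.1) F.P} := by
  rw [isTangentPlane_eq_union, Set.smul_set_union, smul_flagOrbit hs hB, smul_flagOrbit hs hB,
    isTangentPlane_eq_union]

theorem IsConicBasis.exists_eq_tangentForm [Fact (Module.finrank k V = 3)] [IsAlgClosed k]
    (h2 : (2 : k) ≠ 0) {B : BilinForm k V} (hs : B.IsSymm) (hB : B.Nondegenerate)
    {f : Basis (Fin 3) k V} (hf : IsConicBasis B f) {ξ : Module.Dual k V} (hξ : ξ ≠ 0)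
    (h : IsTangentPlane B (LinearMap.ker ξ)) :
    ∃ v w : k, (v ≠ 0 ∨ w ≠ 0) ∧ ξ = tangentForm f v w := by
  rw [hf.isTangentPlane_ker_iff h2 hs hB] at h
  have hq : (-ξ (f 1) / 2) ^ 2 = ξ (f 2) * ξ (f 0) := by
    field_simp
    linear_combination h
  obtain ⟨v, w, hv, hvw, hw⟩ := exists_sq_eq_of_sq_eq_mul hq
  have hξe : ξ = tangentForm f v w := by
    obtain ⟨h0, h1, h3⟩ := tangentForm_apply_basis f v w
    refine f.ext fun i => ?_
    fin_cases i
    · exact (hw.symm.trans h0.symm)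
    · refine Eq.trans ?_ h1.symm
      change ξ (f 1) = _
      rw [hvw]
      field_simp
    · exact (hv.symm.trans h3.symm)
  refine ⟨v, w, ?_, hξe⟩
  by_contra! h0
  exact hξ (by rw [hξe, h0.1, h0.2]; simp [tangentForm])

theorem isTangentPlane_tangentForm [Fact (Module.finrank k V = 3)]
    (h2 : (2 : k) ≠ 0) {B : BilinForm k V} (hs : B.IsSymm) (hB : B.Nondegenerate)
    {f : Basis (Fin 3) k V} (hf : IsConicBasis B f) (v w : k) :
    IsTangentPlane B (LinearMap.ker (tangentForm f v w)) := by
  obtain ⟨h0, h1, h3⟩ := tangentForm_apply_basis f v w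
  rw [hf.isTangentPlane_ker_iff h2 hs hB, h0, h1, h3]
  ring

/-- A tangent of the second conic, with parameter `t`, is tangent to the first conic if and only if
`t` is a zero of a quartic polynomial. A double zero of the quartic would give a double zero of the
cubic whose zeros are the parameters of the common points. -/
theorem IsConicFrame.encard_tangents [IsAlgClosed k] {B B' : BilinForm k V} (h2 : (2 : k) ≠ 0)
    {e f : Basis (Fin 3) k V} {α₀ α₁ β₀ β₁ : k} (h : IsConicFrame B B' e f α₀ α₁ β₀ β₁)
    (h4 : (isotropicLines B ∩ isotropicLines B').ncard = 4) :
    {t : k | (t ^ 2 + 2 * α₁ * t - α₀) ^ 2 - 4 * (β₀ - 2 * β₁ * t) = 0}.encard = 4 := by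
  classical
  obtain ⟨r₁, r₂, r₃, h12, h13, h23, hA, hb, hc⟩ := h.exists_roots h2 h4
  let q : Polynomial k :=
    (.X ^ 2 + .C (2 * α₁) * .X - .C α₀) ^ 2 - .C 4 * (.C β₀ - .C (2 * β₁) * .X)
  have hdeg : q.natDegree = 4 := by
    have h1 : (Polynomial.X ^ 2 + .C (2 * α₁) * .X - .C α₀ : Polynomial k).natDegree = 2 := by
      compute_degree!
    have h3 : ((.X ^ 2 + .C (2 * α₁) * .X - .C α₀ : Polynomial k) ^ 2).natDegree = 4 := by
      rw [Polynomial.natDegree_pow, h1]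
    have h5 : (.C 4 * (.C β₀ - .C (2 * β₁) * .X) : Polynomial k).natDegree ≤ 1 := by
      compute_degree
    rw [Polynomial.natDegree_sub_eq_left_of_natDegree_lt (by omega), h3]
  have hq0 : q ≠ 0 := fun h0 => by
    rw [h0, Polynomial.natDegree_zero] at hdeg
    omega
  have hsimple : ∀ t, q.IsRoot t → ¬ q.derivative.IsRoot t := by
    intro t ht ht'
    have e1 : (t ^ 2 + 2 * α₁ * t - α₀) ^ 2 - 4 * (β₀ - 2 * β₁ * t) = 0 := by
      simpa [q, Polynomial.IsRoot] using ht
    have e2 : 2 * (t ^ 2 + 2 * α₁ * t - α₀) * (2 * t + 2 * α₁) + 4 * (2 * β₁) = 0 := by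
      have := ht'
      simp [q, Polynomial.IsRoot, Polynomial.derivative_pow] at this
      linear_combination this
    -- the point of contact has parameter `s`
    obtain ⟨s, hs⟩ : ∃ s, 2 * s = t ^ 2 + 2 * α₁ * t - α₀ := ⟨_, mul_div_cancel₀ _ h2⟩
    have h4' : (4 : k) ≠ 0 := by
      rw [show (4 : k) = 2 * 2 by norm_num]
      exact mul_ne_zero h2 h2
    have hF : s ^ 2 + s * (α₀ - 2 * α₁ * t - t ^ 2) + β₀ - 2 * β₁ * t = 0 := by
      refine mul_left_cancel₀ h4' ?_
      rw [← hs] at e1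
      linear_combination -e1 + 4 * s * hs
    have hFt : s * t + α₁ * s + β₁ = 0 := by
      refine mul_left_cancel₀ h4' (mul_left_cancel₀ h2 ?_)
      linear_combination e2 + 2 * (2 * t + 2 * α₁) * hs
    have hc0 : (s - r₁) * (s - r₂) * (s - r₃) = 0 := by
      linear_combination s * hF + (s * t + α₁ * s + β₁) * hFt - s ^ 2 * hA - s * hb - hc
    have hc1 : (s - r₁) * (s - r₂) + (s - r₁) * (s - r₃) + (s - r₂) * (s - r₃) = 0 := by
      linear_combination hF + s * hs + 2 * (t + α₁) * hFt - 2 * s * hA - hb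
    rcases mul_eq_zero.1 hc0 with h0 | h0
    · rcases mul_eq_zero.1 h0 with h0 | h0
      · rw [h0] at hc1
        obtain rfl : s = r₁ := sub_eq_zero.1 h0
        simp [sub_ne_zero.2 h12, sub_ne_zero.2 h13] at hc1
      · rw [h0] at hc1
        obtain rfl : s = r₂ := sub_eq_zero.1 h0
        simp [sub_ne_zero.2 h12.symm, sub_ne_zero.2 h23] at hc1
    · rw [h0] at hc1
      obtain rfl : s = r₃ := sub_eq_zero.1 h0
      simp [sub_ne_zero.2 h13.symm, sub_ne_zero.2 h23.symm] at hc1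
  have hnodup : q.roots.Nodup := by
    refine Multiset.nodup_iff_count_le_one.2 fun t => ?_
    rw [Polynomial.count_roots]
    by_contra! hlt
    obtain ⟨ht, ht'⟩ := (Polynomial.one_lt_rootMultiplicity_iff_isRoot hq0).1 hlt
    exact hsimple t ht ht'
  have hset : {t : k | (t ^ 2 + 2 * α₁ * t - α₀) ^ 2 - 4 * (β₀ - 2 * β₁ * t) = 0} =
      (q.roots.toFinset : Set k) := by
    ext t
    rw [Finset.mem_coe, Multiset.mem_toFinset, Polynomial.mem_roots hq0]
    simp [q, Polynomial.IsRoot]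
  rw [hset, Set.encard_coe_eq_coe_finsetCard, Multiset.toFinset_card_of_nodup hnodup,
    ← (IsAlgClosed.splits q).natDegree_eq_card_roots, hdeg]
  rfl

section

variable [Fact (Module.finrank k V = 3)] [IsAlgClosed k] {B B' : BilinForm k V}

/-- A flag of class zero is determined by its line: its plane is the tangent. -/
theorem plane_eq_of_mem_flagOrbit_zero (h2 : (2 : k) ≠ 0) (hs : B.IsSymm) (hB : B.Nondegenerate)
    {F : FullFlag k V} (hF : F ∈ flagOrbit B 0) {x : V} (hx : x ≠ 0)
    (hL : F.L = Projectivization.mk k x hx) : F.P = LinearMap.ker (B x) := by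
  obtain ⟨e, he, rfl⟩ := exists_standard_eq h2 hs hB hF
  obtain ⟨a, ha⟩ := (Projectivization.mk_eq_mk_iff k _ _ (e.ne_zero 0) hx).1 hL
  change LinearMap.ker (B (e 0)) = _
  rw [← ha, Units.smul_def, map_smul, LinearMap.ker_smul _ _ a.ne_zero]

/-- A flag of class zero is determined by its plane: its line is the point of contact. -/
theorem eq_of_plane_eq (h2 : (2 : k) ≠ 0) (hs : B.IsSymm) (hB : B.Nondegenerate)
    {F F' : FullFlag k V} (hF : F ∈ flagOrbit B 0) (hF' : F' ∈ flagOrbit B 0) (h : F.P = F'.P) :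
    F = F' := by
  obtain ⟨e, he, rfl⟩ := exists_standard_eq h2 hs hB hF
  obtain ⟨e', he', rfl⟩ := exists_standard_eq h2 hs hB hF'
  obtain ⟨b, hb, hbe⟩ := exists_smul_eq_of_ker_eq (standard_mem hB he 0).2.1 h
  have hee : e' 0 = b • e 0 := by
    rw [← sub_eq_zero]
    refine hB.1 _ fun y => ?_
    have := LinearMap.congr_fun hbe y
    rw [map_sub, map_smul, LinearMap.sub_apply, sub_eq_zero]
    exact this
  exact ofCoordinates_eq_iff.2 ⟨b, b, hb, hb, hee, hbe⟩

theorem disjoint_flagOrbit_zero (h2 : (2 : k) ≠ 0) (hs : B.IsSymm) (hB : B.Nondegenerate)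
    (hs' : B'.IsSymm) (hB' : B'.Nondegenerate)
    (h4 : (isotropicLines B ∩ isotropicLines B').ncard = 4) {F : FullFlag k V}
    (hF : F ∈ flagOrbit B 0) : F ∉ flagOrbit B' 0 := by
  intro hF'
  obtain ⟨L, hL⟩ : ∃ L, F.L = L := ⟨_, rfl⟩
  induction L with
  | h x hx =>
    have h1 := plane_eq_of_mem_flagOrbit_zero h2 hs hB hF hx hL
    have h3 := plane_eq_of_mem_flagOrbit_zero h2 hs' hB' hF' hx hL
    obtain ⟨u, hu, hu'⟩ := exists_transversal h2 hs hB hs' h4 hx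
      ((mk_mem_isotropicLines hx).1 (hL ▸ hF.1)) ((mk_mem_isotropicLines hx).1 (hL ▸ hF'.1))
    have hmem : u ∈ LinearMap.ker (B x) := hu
    rw [← h1, h3] at hmem
    exact hu' hmem

/-- The flags formed by a common point of two conics and the tangent of the second one. -/
theorem ncard_flagOrbit_one_inter_zero (h2 : (2 : k) ≠ 0) (hs : B.IsSymm) (hB : B.Nondegenerate)
    (hs' : B'.IsSymm) (hB' : B'.Nondegenerate)
    (h4 : (isotropicLines B ∩ isotropicLines B').ncard = 4) :
    (flagOrbit B 1 ∩ flagOrbit B' 0).ncard = 4 := by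
  have himage : FullFlag.L '' (flagOrbit B 1 ∩ flagOrbit B' 0) =
      isotropicLines B ∩ isotropicLines B' := by
    ext L
    constructor
    · rintro ⟨F, hF, rfl⟩
      exact ⟨hF.1.1, hF.2.1⟩
    · induction L with
      | h x hx =>
        rintro ⟨hL, hL'⟩
        have hxx : B' x x = 0 := (mk_mem_isotropicLines hx).1 hL'
        have hmem : (x, B' x) ∈ homogeneousCoordinates k V :=
          ⟨hx, fun h => hx (hB'.1 x fun y => LinearMap.congr_fun h y), hxx⟩
        have hF' : ofCoordinates k V ⟨(x, B' x), hmem⟩ ∈ flagOrbit B' 0 := by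
          rw [ofCoordinates_mem_flagOrbit hs' hB']
          simp [hxx]
        exact ⟨_, ⟨⟨hL, fun hP => disjoint_flagOrbit_zero h2 hs hB hs' hB' h4 ⟨hL, hP⟩ hF'⟩, hF'⟩,
          rfl⟩
  have hinj : Set.InjOn FullFlag.L (flagOrbit B 1 ∩ flagOrbit B' 0) := by
    rintro F ⟨_, hF⟩ F' ⟨_, hF'⟩ h
    obtain ⟨L, hL⟩ : ∃ L, F.L = L := ⟨_, rfl⟩
    induction L with
    | h x hx =>
      refine FullFlag.ext h ?_
      rw [plane_eq_of_mem_flagOrbit_zero h2 hs' hB' hF hx hL,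
        plane_eq_of_mem_flagOrbit_zero h2 hs' hB' hF' hx (h ▸ hL)]
  rw [← hinj.ncard_image, himage, h4]

/-- The flags formed by a common tangent of two conics and its point of contact with the first
one. -/
theorem ncard_flagOrbit_zero_inter_two (h2 : (2 : k) ≠ 0) (hs : B.IsSymm) (hB : B.Nondegenerate)
    (hs' : B'.IsSymm) (hB' : B'.Nondegenerate)
    (h4 : (isotropicLines B ∩ isotropicLines B').ncard = 4) :
    (flagOrbit B 0 ∩ flagOrbit B' 2).ncard = 4 := by
  obtain ⟨L, hL, hL'⟩ : (isotropicLines B ∩ isotropicLines B').Nonempty :=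
    Set.nonempty_of_ncard_ne_zero (by omega)
  induction L with
  | h x hx =>
    obtain ⟨e, f, α₀, α₁, β₀, β₁, _, h, _, _⟩ := exists_isConicFrame h2 hs hB hs' hB' h4 hx
      ((mk_mem_isotropicLines hx).1 hL) ((mk_mem_isotropicLines hx).1 hL')
    have hξ : ∀ t : k, tangentForm f t 1 ≠ 0 := fun t =>
      tangentForm_ne_zero f (Or.inr one_ne_zero)
    have htan : ∀ t : k, IsTangentPlane B (LinearMap.ker (tangentForm f t 1)) ↔
        (t ^ 2 + 2 * α₁ * t - α₀) ^ 2 - 4 * (β₀ - 2 * β₁ * t) = 0 := fun t => by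
      obtain ⟨h0, h1, h3⟩ := tangentForm_apply_basis f t 1
      rw [h.left.isTangentPlane_ker_iff h2 hs hB, h.zero_eq, h.one_eq, h.two_eq, ← sub_eq_zero]
      simp only [map_add, map_sub, map_smul, h0, h1, h3, smul_eq_mul]
      ring_nf
    have himage : FullFlag.P '' (flagOrbit B 0 ∩ flagOrbit B' 2) =
        (fun t => LinearMap.ker (tangentForm f t 1)) ''
          {t : k | (t ^ 2 + 2 * α₁ * t - α₀) ^ 2 - 4 * (β₀ - 2 * β₁ * t) = 0} := by
      ext P
      constructor
      · rintro ⟨F, ⟨hF, hF'⟩, rfl⟩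
        obtain ⟨⟨⟨y, ξ⟩, hy⟩, rfl⟩ := ofCoordinates_surjective F
        obtain ⟨v, w, hvw, rfl⟩ := h.right.exists_eq_tangentForm h2 hs' hB' hy.2.1 hF'.2
        have hw : w ≠ 0 := by
          rintro rfl
          have := (h.left.isTangentPlane_ker_iff h2 hs hB).1 hF.2
          obtain ⟨h0, h1, h3⟩ := tangentForm_apply_basis f v 0
          rw [h.zero_eq, h.one_eq, h.two_eq] at this
          simp only [map_add, map_sub, map_smul, h0, h1, h3, smul_eq_mul] at this
          have hv : v = 0 := by simpa using this
          simp [hv] at hvw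
        have hker := (ker_tangentForm_eq_iff h2 f (v' := v / w) (w' := 1) hvw
          (Or.inr one_ne_zero)).2 (by field_simp)
        refine ⟨v / w, (htan _).1 ?_, hker.symm⟩
        rw [← hker]
        exact hF.2
      · rintro ⟨t, ht, rfl⟩
        obtain ⟨n, hn⟩ := exists_form_eq hB (tangentForm f t 1)
        have ht' := (htan t).2 ht
        rw [← hn, isTangentPlane_ker_iff hs hB] at ht'
        have hmem : (n, B n) ∈ homogeneousCoordinates k V :=
          ⟨fun h0 => hξ t (by rw [← hn, show n = 0 from h0, map_zero]), hn ▸ hξ t, ht'⟩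
        have hF : ofCoordinates k V ⟨(n, B n), hmem⟩ ∈ flagOrbit B 0 := by
          rw [ofCoordinates_mem_flagOrbit hs hB]
          simp [ht']
        have hP : IsTangentPlane B' (LinearMap.ker (B n)) := by
          rw [hn]
          exact isTangentPlane_tangentForm h2 hs' hB' h.right t 1
        exact ⟨_, ⟨hF, fun hL => disjoint_flagOrbit_zero h2 hs hB hs' hB' h4 hF ⟨hL, hP⟩, hP⟩,
          congrArg LinearMap.ker hn⟩
    have hinj : Function.Injective fun t : k => LinearMap.ker (tangentForm f t 1) := by
      intro t t' ht
      simpa using (ker_tangentForm_eq_iff h2 f (Or.inr one_ne_zero) (Or.inr one_ne_zero)).1 ht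
    have hinj' : Set.InjOn FullFlag.P (flagOrbit B 0 ∩ flagOrbit B' 2) :=
      fun F hF F' hF' => eq_of_plane_eq h2 hs hB hF.1 hF'.1
    rw [← hinj'.ncard_image, himage, Set.ncard_image_of_injective _ hinj, Set.ncard,
      h.encard_tangents h2 h4]
    rfl

/-- A pair of conics with four common points, given by a conic frame: the common points have the
parameters `∞, 1, -1, r`. -/
theorem exists_ncard_inter_eq_four (h2 : (2 : k) ≠ 0) (hs : B.IsSymm) (hB : B.Nondegenerate) :
    ∃ g : GeneralLinearGroup k V, (isotropicLines B ∩ g • isotropicLines B).ncard = 4 := by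
  have := IsAlgClosed.instInfinite (K := k)
  obtain ⟨e, he⟩ := exists_isConicBasis (V := V) h2 hs hB
  obtain ⟨r, hr⟩ := Set.Infinite.nonempty (Set.Finite.infinite_compl
    ((Set.finite_singleton (-1 : k)).insert 1 |>.insert 0))
  simp only [Set.mem_compl_iff, Set.mem_insert_iff, Set.mem_singleton_iff, not_or] at hr
  obtain ⟨hr0, hr1, hr2⟩ := hr
  obtain ⟨b, hb⟩ := IsAlgClosed.exists_pow_nat_eq r (n := 2) (by norm_num)
  have hb0 : b ≠ 0 := by
    rintro rfl
    exact hr0 (by rw [← hb]; simp)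
  let T : V →ₗ[k] V := Matrix.toLin e e !![1, -r, -1; 0, 0, b; 0, -1, 0]
  have hdet : LinearMap.det T ≠ 0 := by
    rw [LinearMap.det_toLin, Matrix.det_fin_three]
    simpa using hb0
  let g : GeneralLinearGroup k V :=
    (GeneralLinearGroup.ofLinearEquiv (LinearMap.equivOfDetNeZero T hdet))⁻¹
  have hg : g⁻¹.1 = T := by
    simp only [g, inv_inv]
    rfl
  have hT0 : T (e 0) = e 0 := by simp [T, Matrix.toLin_self, Fin.sum_univ_three]
  have hT1 : T (e 1) = (-r) • e 0 - e 2 := by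
    simp [T, Matrix.toLin_self, Fin.sum_univ_three, sub_eq_add_neg]
  have hT2 : T (e 2) = -e 0 + b • e 1 := by simp [T, Matrix.toLin_self, Fin.sum_univ_three]
  refine ⟨g, ?_⟩
  rw [smul_isotropicLines, Set.ncard, encard_isotropicLines_inter h2 he]
  · have hset : {s : k | (B.comp g⁻¹.1 g⁻¹.1) (conicPoint e s 1) (conicPoint e s 1) = 0} =
        {1, -1, r} := by
      ext s
      have hTs : T (conicPoint e s 1) = (s ^ 2 - r * s - 1) • e 0 + b • e 1 + (-s) • e 2 := by
        simp only [conicPoint, map_add, map_smul, hT0, hT1, hT2]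
        module
      obtain ⟨c0, c1, c2⟩ : e.coord 0 (T (conicPoint e s 1)) = s ^ 2 - r * s - 1 ∧
          e.coord 1 (T (conicPoint e s 1)) = b ∧ e.coord 2 (T (conicPoint e s 1)) = -s := by
        rw [hTs]
        refine ⟨?_, ?_, ?_⟩ <;> simp
      rw [Set.mem_ofPred_eq, LinearMap.BilinForm.comp_apply, hg, he.apply, c0, c1, c2]
      have hval : (2 : k) * (b * b) - (s ^ 2 - r * s - 1) * (-s) - (-s) * (s ^ 2 - r * s - 1) =
          2 * ((s - 1) * (s + 1) * (s - r)) := by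
        rw [← pow_two, hb]
        ring
      rw [hval]
      simp [h2, sub_eq_zero, add_eq_zero_iff_eq_neg, or_assoc]
    rw [hset, Set.encard_insert_of_notMem, Set.encard_pair]
    · rfl
    · exact fun h => hr2 h.symm
    · have h11 : (1 : k) ≠ -1 := fun h => h2 (by linear_combination h)
      simp [h11, Ne.symm hr1]
  · rw [LinearMap.BilinForm.comp_apply, hg, hT0, he]
    rfl

end

end Counting

/-! ### The flags on one conic and tangent to another form a Weierstrass curve -/

namespace SpaceWithFunctions

variable {k : Type u} [Field k] {W : Type w} [AddCommGroup W] [Module k W]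

theorem polynomialFunctions_const (c : k) : (fun _ : W => c) ∈ polynomialFunctions k W :=
  Subalgebra.algebraMap_mem _ c

theorem polynomialFunctions_add {p q : W → k} (hp : p ∈ polynomialFunctions k W)
    (hq : q ∈ polynomialFunctions k W) : (fun x => p x + q x) ∈ polynomialFunctions k W :=
  Subalgebra.add_mem _ hp hq

theorem polynomialFunctions_sub {p q : W → k} (hp : p ∈ polynomialFunctions k W)
    (hq : q ∈ polynomialFunctions k W) : (fun x => p x - q x) ∈ polynomialFunctions k W :=
  Subalgebra.sub_mem _ hp hq

theorem polynomialFunctions_neg {p : W → k} (hp : p ∈ polynomialFunctions k W) :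
    (fun x => -p x) ∈ polynomialFunctions k W :=
  Subalgebra.neg_mem _ hp

theorem polynomialFunctions_mul {p q : W → k} (hp : p ∈ polynomialFunctions k W)
    (hq : q ∈ polynomialFunctions k W) : (fun x => p x * q x) ∈ polynomialFunctions k W :=
  Subalgebra.mul_mem _ hp hq

theorem polynomialFunctions_pow {p : W → k} (hp : p ∈ polynomialFunctions k W) (n : ℕ) :
    (fun x => p x ^ n) ∈ polynomialFunctions k W :=
  Subalgebra.pow_mem _ hp n

theorem polynomialFunctions_proj {n : ℕ} (i : Fin n) :
    (fun x : Fin n → k => x i) ∈ polynomialFunctions k (Fin n → k) :=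
  dual_mem_polynomialFunctions (LinearMap.proj (φ := fun _ => k) i)

theorem isPolynomialMap_pi {n : ℕ} {h : W → Fin n → k}
    (hh : ∀ i, (fun x => h x i) ∈ polynomialFunctions k W) : IsPolynomialMap (k := k) h := by
  intro ℓ
  have hℓ : (fun x => ℓ (h x)) = ∑ i, fun x => h x i * ℓ (Pi.single i 1) := by
    ext x
    rw [dual_apply_eq_sum, Finset.sum_apply]
  rw [hℓ]
  exact Subalgebra.sum_mem _ fun i _ =>
    polynomialFunctions_mul (hh i) (polynomialFunctions_const _)

theorem IsPolynomialMap.prodMk {W₁ W₂ : Type*} [AddCommGroup W₁] [Module k W₁] [AddCommGroup W₂]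
    [Module k W₂] {h₁ : W → W₁} {h₂ : W → W₂} (hh₁ : IsPolynomialMap (k := k) h₁)
    (hh₂ : IsPolynomialMap (k := k) h₂) : IsPolynomialMap (k := k) fun x => (h₁ x, h₂ x) := by
  intro ℓ
  have hℓ : (fun x => ℓ (h₁ x, h₂ x)) = fun x =>
      (ℓ.comp (LinearMap.inl k W₁ W₂)) (h₁ x) + (ℓ.comp (LinearMap.inr k W₁ W₂)) (h₂ x) := by
    ext x
    rw [LinearMap.comp_apply, LinearMap.comp_apply, ← map_add]
    simp
  rw [hℓ]
  exact polynomialFunctions_add (hh₁ _) (hh₂ _)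

theorem isPolynomialMap_sum_smul {W' : Type*} [AddCommGroup W'] [Module k W'] {p₀ p₁ p₂ : W → k}
    (h₀ : p₀ ∈ polynomialFunctions k W) (h₁ : p₁ ∈ polynomialFunctions k W)
    (h₂ : p₂ ∈ polynomialFunctions k W) (a b c : W') :
    IsPolynomialMap (k := k) fun x => p₀ x • a + p₁ x • b + p₂ x • c := by
  intro ℓ
  simp only [map_add, map_smul, smul_eq_mul]
  exact polynomialFunctions_add (polynomialFunctions_add
    (polynomialFunctions_mul h₀ (polynomialFunctions_const _))
    (polynomialFunctions_mul h₁ (polynomialFunctions_const _)))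
    (polynomialFunctions_mul h₂ (polynomialFunctions_const _))

theorem mk_mem_weierstrassPoints {C : WeierstrassCurve k} {X : Fin 3 → k} (hX : X ≠ 0) :
    Projectivization.mk k X hX ∈ weierstrassPoints C ↔
      X 1 ^ 2 * X 2 + C.a₁ * X 0 * X 1 * X 2 + C.a₃ * X 1 * X 2 ^ 2 =
        X 0 ^ 3 + C.a₂ * X 0 ^ 2 * X 2 + C.a₄ * X 0 * X 2 ^ 2 + C.a₆ * X 2 ^ 3 := by
  obtain ⟨a, ha⟩ := Projectivization.exists_smul_eq_mk_rep k X hX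
  change C.toProjective.Equation (Projectivization.mk k X hX).rep ↔ _
  rw [← ha, Units.smul_def, WeierstrassCurve.Projective.equation_smul X a.isUnit,
    WeierstrassCurve.Projective.equation_iff]
  exact sub_eq_zero

end SpaceWithFunctions

theorem exists_equiv_of_existsUnique {α β : Type*} {R : α → β → Prop} (h : ∀ a, ∃! b, R a b)
    (h' : ∀ b, ∃! a, R a b) : ∃ e : α ≃ β, ∀ a b, R a b ↔ e a = b := by
  choose φ hφ hφ' using h
  refine ⟨Equiv.ofBijective φ ⟨fun a a' haa => ?_, fun b => ?_⟩, fun a b => ⟨fun hab => ?_, ?_⟩⟩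
  · exact (h' (φ a)).unique (hφ a) (haa ▸ hφ a')
  · obtain ⟨a, ha, _⟩ := h' b
    exact ⟨a, (hφ' a b ha).symm⟩
  · exact (hφ' a b hab).symm
  · rintro rfl
    exact hφ a

section FrameCurve

open LinearMap (GeneralLinearGroup BilinForm)
open Module (Basis)
open FullFlag SpaceWithFunctions

variable {k : Type u} [Field k]

/-- The point with parameter `s / t` of the first conic lies on the tangent with parameter `v / w`
of the second conic. -/
def FrameIncidence (α₀ α₁ β₀ β₁ s t v w : k) : Prop :=
  w ^ 2 * (s ^ 2 + α₀ * s * t + β₀ * t ^ 2) - 2 * v * w * t * (α₁ * s + β₁ * t) - v ^ 2 * s * t = 0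

/-- The graph of the isomorphism between pairs of parameters `(s / t, v / w)` and points
`X = [x : y : z]` of the Weierstrass curve: `s / t = x / z` and `v / w = y / x`, and the same after
rewriting the two fractions by means of the equation of the curve. -/
def FrameRel (α₀ α₁ β₀ β₁ s t v w : k) (X : Fin 3 → k) : Prop :=
  s * X 2 = t * X 0 ∧ X 0 * v = X 1 * w ∧
    X 0 ^ 2 * s = (X 1 ^ 2 + 2 * α₁ * X 0 * X 1 + 2 * β₁ * X 1 * X 2 - α₀ * X 0 ^ 2 -
      β₀ * X 0 * X 2) * t ∧
    (X 0 ^ 2 + α₀ * X 0 * X 2 + β₀ * X 2 ^ 2) * w =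
      (X 1 * X 2 + 2 * α₁ * X 0 * X 2 + 2 * β₁ * X 2 ^ 2) * v

variable {α₀ α₁ β₀ β₁ : k}

theorem mk_mem_weierstrassPoints_frameCurve {X : Fin 3 → k} (hX : X ≠ 0) :
    Projectivization.mk k X hX ∈ weierstrassPoints (frameCurve α₀ α₁ β₀ β₁) ↔
      X 0 ^ 3 = (X 1 ^ 2 + 2 * α₁ * X 0 * X 1 + 2 * β₁ * X 1 * X 2 - α₀ * X 0 ^ 2 -
        β₀ * X 0 * X 2) * X 2 := by
  rw [mk_mem_weierstrassPoints]
  simp only [frameCurve]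
  constructor <;> intro h <;> linear_combination -h

theorem FrameRel.smul {s t v w : k} {X : Fin 3 → k} (h : FrameRel α₀ α₁ β₀ β₁ s t v w X)
    (c d a : k) : FrameRel α₀ α₁ β₀ β₁ (c * s) (c * t) (d * v) (d * w) (a • X) := by
  obtain ⟨h1, h2, h3, h4⟩ := h
  simp only [FrameRel, Pi.smul_apply, smul_eq_mul]
  refine ⟨?_, ?_, ?_, ?_⟩
  · linear_combination c * a * h1
  · linear_combination a * d * h2
  · linear_combination a ^ 2 * c * h3
  · linear_combination a ^ 2 * d * h4

/-- The point at infinity is the point over the common point `s / t = ∞` of the two conics. -/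
theorem FrameRel.z_eq_zero_iff {s t v w : k} {X : Fin 3 → k}
    (h : FrameRel α₀ α₁ β₀ β₁ s t v w X) (hst : s ≠ 0 ∨ t ≠ 0) (hX : X ≠ 0)
    (hW : Projectivization.mk k X hX ∈ weierstrassPoints (frameCurve α₀ α₁ β₀ β₁)) :
    X 2 = 0 ↔ t = 0 := by
  obtain ⟨h1, h2, h3, h4⟩ := h
  rw [mk_mem_weierstrassPoints_frameCurve] at hW
  constructor
  · intro hz
    rw [hz, mul_zero, pow_eq_zero_iff three_ne_zero] at hW
    have hy : X 1 ≠ 0 := fun hy => hX (by ext i; fin_cases i <;> assumption)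
    rw [hz, hW] at h3
    refine (mul_eq_zero.1 (?_ : X 1 ^ 2 * t = 0)).resolve_left
          (pow_ne_zero 2 hy)
    linear_combination -h3
  · rintro rfl
    simpa [hst.resolve_right (not_not.2 rfl)] using h1

/-- The two formulas `[s w : s v : t w]` and `[s t v : … : t² v]` for the point of the Weierstrass
curve have no common base point. -/
theorem FrameIncidence.formula_ne_zero {s t v w : k} (hst : s ≠ 0 ∨ t ≠ 0) (hvw : v ≠ 0 ∨ w ≠ 0)
    (hI : FrameIncidence α₀ α₁ β₀ β₁ s t v w) : t * w ≠ 0 ∨ s * v ≠ 0 ∨ t * v ≠ 0 := by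
  by_contra! h
  obtain ⟨h1, h2, h3⟩ := h
  have hv : v = 0 := by
    by_contra hv
    rcases hst with hs | ht
    · exact mul_ne_zero hs hv h2
    · exact mul_ne_zero ht hv h3
  have hw : w ≠ 0 := hvw.resolve_left (not_not.2 hv)
  have ht : t = 0 := (mul_eq_zero.1 h1).resolve_right hw
  have hs : s ≠ 0 := hst.resolve_right (not_not.2 ht)
  rw [FrameIncidence, hv, ht] at hI
  simp [hw, hs] at hI

/-- The formula `[s w : s v : t w]` for the point of the Weierstrass curve. -/
theorem frameRel_first {s t v w : k} (hI : FrameIncidence α₀ α₁ β₀ β₁ s t v w) :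
    FrameRel α₀ α₁ β₀ β₁ s t v w ![s * w, s * v, t * w] ∧
      (s * w) ^ 3 = ((s * v) ^ 2 + 2 * α₁ * (s * w) * (s * v) + 2 * β₁ * (s * v) * (t * w) -
        α₀ * (s * w) ^ 2 - β₀ * (s * w) * (t * w)) * (t * w) := by
  rw [FrameIncidence] at hI
  refine ⟨⟨?_, ?_, ?_, ?_⟩, ?_⟩ <;> try simp
  · ring
  · ring
  · linear_combination s * hI
  · linear_combination w * hI
  · linear_combination w * s * hI

/-- A formula for the point of the Weierstrass curve that is valid where `t v ≠ 0`: it is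
obtained from `[s w : s v : t w]` by multiplication with `t v / w` and reduction by the incidence
relation. -/
theorem frameRel_second {s t v w : k} (hI : FrameIncidence α₀ α₁ β₀ β₁ s t v w) :
    FrameRel α₀ α₁ β₀ β₁ s t v w ![s * t * v, (s ^ 2 + α₀ * s * t + β₀ * t ^ 2) * w -
      2 * v * t * (α₁ * s + β₁ * t), t ^ 2 * v] ∧ (s * t * v) ^ 3 =
        (((s ^ 2 + α₀ * s * t + β₀ * t ^ 2) * w - 2 * v * t * (α₁ * s + β₁ * t)) ^ 2 +
        2 * α₁ * (s * t * v) * ((s ^ 2 + α₀ * s * t + β₀ * t ^ 2) * w -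
          2 * v * t * (α₁ * s + β₁ * t)) + 2 * β₁ * ((s ^ 2 + α₀ * s * t + β₀ * t ^ 2) * w -
          2 * v * t * (α₁ * s + β₁ * t)) * (t ^ 2 * v) - α₀ * (s * t * v) ^ 2 -
          β₀ * (s * t * v) * (t ^ 2 * v)) * (t ^ 2 * v) := by
  rw [FrameIncidence] at hI
  refine ⟨⟨?_, ?_, ?_, ?_⟩, ?_⟩ <;> try simp
  · ring
  · linear_combination -hI
  · linear_combination (-t * (s ^ 2 + α₀ * s * t + β₀ * t ^ 2)) * hI
  · ring
  · linear_combination (-t ^ 2 * v * (s ^ 2 + α₀ * s * t + β₀ * t ^ 2)) * hI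

theorem FrameRel.eq_smul_first {s t v w : k} {X : Fin 3 → k}
    (h : FrameRel α₀ α₁ β₀ β₁ s t v w X) (h0 : t * w ≠ 0 ∨ s * v ≠ 0) :
    ∃ a : k, X = a • ![s * w, s * v, t * w] := by
  obtain ⟨h1, h2, -, -⟩ := h
  rcases h0 with h0 | h0
  · have ht := left_ne_zero_of_mul h0
    have hw := right_ne_zero_of_mul h0
    refine ⟨X 2 / (t * w), ?_⟩
    ext i
    fin_cases i <;> simp <;> field_simp
    · linear_combination -h1
    · linear_combination -v * h1 - t * h2
  · have hs := left_ne_zero_of_mul h0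
    have hv := right_ne_zero_of_mul h0
    refine ⟨X 1 / (s * v), ?_⟩
    ext i
    fin_cases i <;> simp <;> field_simp
    · linear_combination h2
    · linear_combination v * h1 + t * h2

theorem FrameRel.eq_smul_second {s t v w : k} {X : Fin 3 → k} (hX : X ≠ 0)
    (h : FrameRel α₀ α₁ β₀ β₁ s t v w X) (h0 : t * v ≠ 0) :
    ∃ a : k, X = a • ![s * t * v, (s ^ 2 + α₀ * s * t + β₀ * t ^ 2) * w -
      2 * v * t * (α₁ * s + β₁ * t), t ^ 2 * v] := by
  obtain ⟨h1, -, h3, h4⟩ := h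
  have ht := left_ne_zero_of_mul h0
  have hv := right_ne_zero_of_mul h0
  have hz : X 2 ≠ 0 := fun hz => by
    rw [hz, mul_zero, eq_comm] at h1
    have hx : X 0 = 0 := (mul_eq_zero.1 h1).resolve_left ht
    rw [hx, hz] at h3
    have hy : X 1 = 0 := by simpa [ht] using h3
    exact hX (by ext i; fin_cases i <;> assumption)
  have hx : X 0 = s * X 2 / t := by
    field_simp
    linear_combination -h1
  refine ⟨X 2 / (t ^ 2 * v), ?_⟩
  ext i
  fin_cases i <;> simp
  · rw [hx]
    field_simp
  · rw [hx] at h4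
    field_simp at h4 ⊢
    linear_combination -h4
  · field_simp

/-- The point of the Weierstrass curve is determined by the two parameters. -/
theorem FrameRel.mk_eq {s t v w : k} {X X' : Fin 3 → k} (hX : X ≠ 0) (hX' : X' ≠ 0)
    (h : FrameRel α₀ α₁ β₀ β₁ s t v w X) (h' : FrameRel α₀ α₁ β₀ β₁ s t v w X')
    (h0 : t * w ≠ 0 ∨ s * v ≠ 0 ∨ t * v ≠ 0) :
    Projectivization.mk k X hX = Projectivization.mk k X' hX' := by
  obtain ⟨Y, ⟨a, rfl⟩, ⟨a', rfl⟩⟩ : ∃ Y : Fin 3 → k,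
      (∃ a : k, X = a • Y) ∧ ∃ a : k, X' = a • Y := by
    rw [← or_assoc] at h0
    rcases h0 with h0 | h0
    · exact ⟨_, h.eq_smul_first h0, h'.eq_smul_first h0⟩
    · exact ⟨_, h.eq_smul_second hX h0, h'.eq_smul_second hX' h0⟩
  have ha' : a' ≠ 0 := fun h => hX' (by rw [h, zero_smul])
  rw [Projectivization.mk_eq_mk_iff']
  exact ⟨a / a', by rw [smul_smul, div_mul_cancel₀ _ ha']⟩

/-- The two parameters are determined by the point of the Weierstrass curve. -/
theorem FrameRel.params_eq {s t v w s' t' v' w' : k} {X : Fin 3 → k} (h2 : (2 : k) ≠ 0)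
    (hβ : β₀ ≠ 0 ∨ β₁ ≠ 0) (hX : X ≠ 0) (h : FrameRel α₀ α₁ β₀ β₁ s t v w X)
    (h' : FrameRel α₀ α₁ β₀ β₁ s' t' v' w' X) : s * t' = s' * t ∧ v * w' = v' * w := by
  have key : ∀ {a b p q p' q' : k}, a ≠ 0 ∨ b ≠ 0 → p * b = q * a → p' * b = q' * a →
      p * q' = p' * q := by
    intro a b p q p' q' hab h1 h2
    rcases hab with ha | hb
    · refine mul_left_cancel₀ ha ?_
      linear_combination p' * h1 - p * h2
    · refine mul_left_cancel₀ hb ?_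
      linear_combination q' * h1 - q * h2
  obtain ⟨e1, e2, e3, e4⟩ := h
  obtain ⟨e1', e2', e3', e4'⟩ := h'
  constructor
  · by_cases h0 : X 0 ≠ 0 ∨ X 2 ≠ 0
    · exact key h0 e1 e1'
    · push Not at h0
      have hy : X 1 ≠ 0 := fun hy => hX (by
        ext i
        fin_cases i
        exacts [h0.1, hy, h0.2])
      rw [h0.1, h0.2] at e3 e3'
      have ht : t = 0 :=
        (mul_eq_zero.1 (by linear_combination -e3 : X 1 ^ 2 * t = 0)).resolve_left
          (pow_ne_zero 2 hy)
      have ht' : t' = 0 :=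
        (mul_eq_zero.1 (by linear_combination -e3' : X 1 ^ 2 * t' = 0)).resolve_left
          (pow_ne_zero 2 hy)
      rw [ht, ht', mul_zero, mul_zero]
  · by_cases h0 : X 1 ≠ 0 ∨ X 0 ≠ 0
    · exact key h0 (by linear_combination e2) (by linear_combination e2')
    · push Not at h0
      have hz : X 2 ≠ 0 := fun hz => hX (by
        ext i
        fin_cases i
        exacts [h0.2, h0.1, hz])
      rw [h0.1, h0.2] at e4 e4'
      refine key (a := β₀) (b := 2 * β₁) (hβ.imp_right fun h => mul_ne_zero h2 h) ?_ ?_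
      · refine mul_left_cancel₀ (pow_ne_zero 2 hz) ?_
        linear_combination -e4
      · refine mul_left_cancel₀ (pow_ne_zero 2 hz) ?_
        linear_combination -e4'

/-- The formulas for the parameters of a point of the Weierstrass curve: each of the two fractions
has two expressions. -/
theorem frameRel_params {X : Fin 3 → k} {A D H : k}
    (hA : A = X 1 ^ 2 + 2 * α₁ * X 0 * X 1 + 2 * β₁ * X 1 * X 2 - α₀ * X 0 ^ 2 - β₀ * X 0 * X 2)
    (hD : D = X 0 ^ 2 + α₀ * X 0 * X 2 + β₀ * X 2 ^ 2)
    (hH : H = X 1 * X 2 + 2 * α₁ * X 0 * X 2 + 2 * β₁ * X 2 ^ 2)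
    (hW : X 0 ^ 3 = A * X 2) :
    (FrameRel α₀ α₁ β₀ β₁ (X 0) (X 2) (X 1) (X 0) X ∧
      FrameIncidence α₀ α₁ β₀ β₁ (X 0) (X 2) (X 1) (X 0)) ∧
    (FrameRel α₀ α₁ β₀ β₁ (X 0) (X 2) D H X ∧ FrameIncidence α₀ α₁ β₀ β₁ (X 0) (X 2) D H) ∧
    (FrameRel α₀ α₁ β₀ β₁ A (X 0 ^ 2) (X 1) (X 0) X ∧
      FrameIncidence α₀ α₁ β₀ β₁ A (X 0 ^ 2) (X 1) (X 0)) := by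
  have hDH : X 0 * D = X 1 * H := by
    rw [hD, hH]
    rw [hA] at hW
    linear_combination hW
  refine ⟨⟨⟨?_, ?_, ?_, ?_⟩, ?_⟩, ⟨⟨?_, ?_, ?_, ?_⟩, ?_⟩, ⟨⟨?_, ?_, ?_, ?_⟩, ?_⟩⟩
  · ring
  · ring
  · rw [← hA]
    linear_combination hW
  · rw [← hD, ← hH]
    linear_combination hDH
  · rw [hD, hH] at hDH
    rw [FrameIncidence]
    linear_combination X 0 * hDH
  · ring
  · exact hDH
  · rw [← hA]
    linear_combination hW
  · rw [← hD, ← hH]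
    ring
  · have hH' : H - 2 * X 2 * (α₁ * X 0 + β₁ * X 2) = X 1 * X 2 := by
      rw [hH]
      ring
    rw [FrameIncidence]
    linear_combination (-H ^ 2) * hD + D * H * hH' - D * X 2 * hDH
  · linear_combination -hW
  · ring
  · rw [← hA]
    ring
  · rw [← hD, ← hH]
    linear_combination hDH
  · rw [FrameIncidence]
    linear_combination X 0 ^ 2 * A * hA + X 0 ^ 2 * (β₀ * X 0 - 2 * β₁ * X 1) * hW

end FrameCurve

/-! ### The isomorphism with the Weierstrass curve -/

section FrameIsomorphism

open LinearMap (GeneralLinearGroup BilinForm)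
open Module (Basis)
open FullFlag SpaceWithFunctions

variable {k : Type u} {V : Type v} [Field k] [AddCommGroup V] [Module k V]

/-- The flags `(L, P)` such that `L` lies on the conic of `B` and `P` is tangent to the conic of
`B'`. -/
def secantTangentFlags (B B' : BilinForm k V) : Set (FullFlag k V) :=
  {F | F.L ∈ isotropicLines B ∧ IsTangentPlane B' F.P}

variable {B B' : BilinForm k V} {e f : Basis (Fin 3) k V} {α₀ α₁ β₀ β₁ : k}

theorem IsConicFrame.tangentForm_conicPoint (h : IsConicFrame B B' e f α₀ α₁ β₀ β₁)
    (s t v w : k) : tangentForm f v w (conicPoint e s t) = 0 ↔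
      FrameIncidence α₀ α₁ β₀ β₁ s t v w := by
  obtain ⟨h0, h1, h2⟩ := tangentForm_apply_basis f v w
  rw [conicPoint, h.zero_eq, h.one_eq, h.two_eq, FrameIncidence]
  simp only [map_add, map_sub, map_smul, smul_eq_mul, h0, h1, h2]
  constructor <;> intro h <;> linear_combination h

theorem params_ne_zero {s t v w : k}
    (hc : (conicPoint e s t, tangentForm f v w) ∈ homogeneousCoordinates k V) :
    (s ≠ 0 ∨ t ≠ 0) ∧ (v ≠ 0 ∨ w ≠ 0) := by
  obtain ⟨h1, h2, -⟩ := hc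
  constructor
  · by_contra! h
    exact h1 (by simp [conicPoint, h.1, h.2])
  · by_contra! h
    exact h2 (by simp [tangentForm, h.1, h.2])

theorem IsConicFrame.mem_homogeneousCoordinates (h : IsConicFrame B B' e f α₀ α₁ β₀ β₁)
    {s t v w : k} (hst : s ≠ 0 ∨ t ≠ 0) (hvw : v ≠ 0 ∨ w ≠ 0)
    (hI : FrameIncidence α₀ α₁ β₀ β₁ s t v w) :
    (conicPoint e s t, tangentForm f v w) ∈ homogeneousCoordinates k V :=
  ⟨conicPoint_ne_zero e hst, tangentForm_ne_zero f hvw, (h.tangentForm_conicPoint s t v w).2 hI⟩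

variable [Fact (Module.finrank k V = 3)]

theorem IsConicFrame.ofCoordinates_mem (h : IsConicFrame B B' e f α₀ α₁ β₀ β₁)
    (h2 : (2 : k) ≠ 0) (hs' : B'.IsSymm) (hB' : B'.Nondegenerate) {s t v w : k}
    (hc : (conicPoint e s t, tangentForm f v w) ∈ homogeneousCoordinates k V) :
    ofCoordinates k V ⟨_, hc⟩ ∈ secantTangentFlags B B' :=
  ⟨(mk_mem_isotropicLines hc.1).2 (h.left.conicPoint_isotropic s t),
    isTangentPlane_tangentForm h2 hs' hB' h.right v w⟩

theorem ofCoordinates_conicPoint_eq_iff (h2 : (2 : k) ≠ 0) {s t v w s' t' v' w' : k}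
    (hc : (conicPoint e s t, tangentForm f v w) ∈ homogeneousCoordinates k V)
    (hc' : (conicPoint e s' t', tangentForm f v' w') ∈ homogeneousCoordinates k V) :
    ofCoordinates k V ⟨_, hc⟩ = ofCoordinates k V ⟨_, hc'⟩ ↔ s * t' = s' * t ∧ v * w' = v' * w := by
  obtain ⟨hst, hvw⟩ := params_ne_zero hc
  obtain ⟨hst', hvw'⟩ := params_ne_zero hc'
  rw [FullFlag.ext_iff]
  exact and_congr (mk_conicPoint_eq_iff e hst hst') (ker_tangentForm_eq_iff h2 f hvw hvw')

theorem IsConicFrame.exists_params [IsAlgClosed k] (h : IsConicFrame B B' e f α₀ α₁ β₀ β₁)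
    (h2 : (2 : k) ≠ 0) (hs' : B'.IsSymm) (hB' : B'.Nondegenerate)
    {c : homogeneousCoordinates k V} (hc : ofCoordinates k V c ∈ secantTangentFlags B B') :
    ∃ s t v w : k, c.1 = (conicPoint e s t, tangentForm f v w) ∧
      FrameIncidence α₀ α₁ β₀ β₁ s t v w := by
  obtain ⟨⟨x, ξ⟩, hx, hξ, hxξ⟩ := c
  obtain ⟨s, t, -, rfl⟩ := h.left.exists_eq_conicPoint h2 hx ((mk_mem_isotropicLines hx).1 hc.1)
  obtain ⟨v, w, -, rfl⟩ := h.right.exists_eq_tangentForm h2 hs' hB' hξ hc.2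
  exact ⟨s, t, v, w, rfl, (h.tangentForm_conicPoint s t v w).1 hxξ⟩

/-- The graph of the isomorphism between the flags on the first conic and tangent to the second
one, and the points of the Weierstrass curve. -/
def FlagRel (e f : Basis (Fin 3) k V) (α₀ α₁ β₀ β₁ : k) (F : FullFlag k V)
    (P : ℙ k (Fin 3 → k)) : Prop :=
  ∃ (s t v w : k) (X : Fin 3 → k) (hX : X ≠ 0)
    (hc : (conicPoint e s t, tangentForm f v w) ∈ homogeneousCoordinates k V),
    FrameRel α₀ α₁ β₀ β₁ s t v w X ∧ P = Projectivization.mk k X hX ∧ F = ofCoordinates k V ⟨_, hc⟩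

theorem IsConicFrame.existsUnique_point [IsAlgClosed k]
    (h : IsConicFrame B B' e f α₀ α₁ β₀ β₁)
    (h2 : (2 : k) ≠ 0) (hs' : B'.IsSymm) (hB' : B'.Nondegenerate)
    (F : secantTangentFlags B B') :
    ∃! P : ↥(weierstrassPoints (frameCurve α₀ α₁ β₀ β₁)), FlagRel e f α₀ α₁ β₀ β₁ F.1 P.1 := by
  obtain ⟨F, hF⟩ := F
  obtain ⟨⟨c, hc⟩, rfl⟩ := ofCoordinates_surjective F
  obtain ⟨s, t, v, w, rfl, hI⟩ := h.exists_params h2 hs' hB' hF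
  obtain ⟨hst, hvw⟩ := params_ne_zero hc
  have h0 := hI.formula_ne_zero hst hvw
  refine existsUnique_of_exists_of_unique ?_ ?_
  · obtain ⟨X, hX, hR, hW⟩ : ∃ X : Fin 3 → k, X ≠ 0 ∧ FrameRel α₀ α₁ β₀ β₁ s t v w X ∧
        X 0 ^ 3 = (X 1 ^ 2 + 2 * α₁ * X 0 * X 1 + 2 * β₁ * X 1 * X 2 - α₀ * X 0 ^ 2 -
          β₀ * X 0 * X 2) * X 2 := by
      rcases h0 with h0 | h0 | h0
      · exact ⟨_, fun hX => h0 (congrFun hX 2), frameRel_first hI⟩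
      · exact ⟨_, fun hX => h0 (congrFun hX 1), frameRel_first hI⟩
      · have ht := left_ne_zero_of_mul h0
        have h0' : t ^ 2 * v ≠ 0 := by
          rw [pow_two, mul_assoc]
          exact mul_ne_zero ht h0
        exact ⟨_, fun hX => h0' (congrFun hX 2), frameRel_second hI⟩
    exact ⟨⟨_, (mk_mem_weierstrassPoints_frameCurve hX).2 hW⟩, s, t, v, w, X, hX, hc, hR, rfl, rfl⟩
  · rintro ⟨_, _⟩ ⟨_, _⟩ ⟨s₁, t₁, v₁, w₁, X₁, hX₁, hc₁, hR₁, rfl, hF₁⟩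
      ⟨s₂, t₂, v₂, w₂, X₂, hX₂, hc₂, hR₂, rfl, hF₂⟩
    have key : ∀ {s₁ t₁ v₁ w₁ : k} {X₁ : Fin 3 → k}
        (hc₁ : (conicPoint e s₁ t₁, tangentForm f v₁ w₁) ∈ homogeneousCoordinates k V),
        FrameRel α₀ α₁ β₀ β₁ s₁ t₁ v₁ w₁ X₁ →
        ofCoordinates k V ⟨_, hc⟩ = ofCoordinates k V ⟨_, hc₁⟩ →
        FrameRel α₀ α₁ β₀ β₁ s t v w X₁ := by
      intro s₁ t₁ v₁ w₁ X₁ hc₁ hR₁ hF₁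
      obtain ⟨hst₁, hvw₁⟩ := params_ne_zero hc₁
      obtain ⟨he, hf⟩ := (ofCoordinates_conicPoint_eq_iff h2 hc hc₁).1 hF₁
      obtain ⟨a, rfl, rfl⟩ := exists_eq_mul_of_mul_eq_mul hst₁ he
      obtain ⟨b, rfl, rfl⟩ := exists_eq_mul_of_mul_eq_mul hvw₁ hf
      simpa using hR₁.smul a b 1
    exact Subtype.ext ((key hc₁ hR₁ hF₁).mk_eq hX₁ hX₂ (key hc₂ hR₂ hF₂) h0)

theorem IsConicFrame.existsUnique_flag
    (h : IsConicFrame B B' e f α₀ α₁ β₀ β₁) (h2 : (2 : k) ≠ 0) (hβ : β₀ ≠ 0 ∨ β₁ ≠ 0)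
    (hs' : B'.IsSymm) (hB' : B'.Nondegenerate)
    (P : ↥(weierstrassPoints (frameCurve α₀ α₁ β₀ β₁))) :
    ∃! F : secantTangentFlags B B', FlagRel e f α₀ α₁ β₀ β₁ F.1 P.1 := by
  obtain ⟨P, hP⟩ := P
  change ℙ k (Fin 3 → k) at P
  induction P with
  | h X hX =>
    refine existsUnique_of_exists_of_unique ?_ ?_
    · obtain ⟨s, t, v, w, hst, hvw, hR, hI⟩ : ∃ s t v w : k, (s ≠ 0 ∨ t ≠ 0) ∧ (v ≠ 0 ∨ w ≠ 0) ∧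
          FrameRel α₀ α₁ β₀ β₁ s t v w X ∧ FrameIncidence α₀ α₁ β₀ β₁ s t v w := by
        obtain ⟨h1, h2', h3⟩ := frameRel_params rfl rfl rfl
          ((mk_mem_weierstrassPoints_frameCurve hX).1 hP)
        by_cases h02 : X 0 ≠ 0 ∨ X 2 ≠ 0
        · by_cases h10 : X 1 ≠ 0 ∨ X 0 ≠ 0
          · exact ⟨_, _, _, _, h02, h10, h1⟩
          · push Not at h10
            have hz : X 2 ≠ 0 := h02.resolve_left (not_not.2 h10.2)
            refine ⟨_, _, _, _, h02, ?_, h2'⟩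
            simpa [h10.1, h10.2, hz, h2] using hβ
        · push Not at h02
          have hy : X 1 ≠ 0 := fun hy => hX (by
            ext i
            fin_cases i
            exacts [h02.1, hy, h02.2])
          refine ⟨_, _, _, _, Or.inl ?_, Or.inl hy, h3⟩
          simpa [h02.1, h02.2] using hy
      have hc := h.mem_homogeneousCoordinates hst hvw hI
      exact ⟨⟨_, h.ofCoordinates_mem h2 hs' hB' hc⟩, s, t, v, w, X, hX, hc, hR, rfl, rfl⟩
    · rintro ⟨_, _⟩ ⟨_, _⟩ ⟨s₁, t₁, v₁, w₁, X₁, hX₁, hc₁, hR₁, hP₁, rfl⟩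
        ⟨s₂, t₂, v₂, w₂, X₂, hX₂, hc₂, hR₂, hP₂, rfl⟩
      obtain ⟨a₁, rfl⟩ := (Projectivization.mk_eq_mk_iff' k _ _ hX hX₁).1 hP₁
      obtain ⟨a₂, ha⟩ := (Projectivization.mk_eq_mk_iff' k _ _ hX₂ hX).1 hP₂.symm
      obtain rfl : X₂ = a₂ • a₁ • X₁ := ha.symm
      refine Subtype.ext ((ofCoordinates_conicPoint_eq_iff h2 hc₁ hc₂).2 ?_)
      have hR₁' := hR₁.smul 1 1 (a₂ * a₁)
      simp only [one_mul, mul_smul] at hR₁'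
      exact hR₁'.params_eq h2 hβ hX₂ hR₂

end FrameIsomorphism

section FrameMorphism

open LinearMap (GeneralLinearGroup BilinForm)
open Module (Basis)
open FullFlag SpaceWithFunctions

variable {k : Type u} {V : Type v} [Field k] [AddCommGroup V] [Module k V]
  {B B' : BilinForm k V} {e f : Basis (Fin 3) k V}
  {α₀ α₁ β₀ β₁ : k}

theorem lineCoord_conicPoint (e : Basis (Fin 3) k V) (s t : k) (ξ : Module.Dual k V) :
    lineCoord e 0 (conicPoint e s t, ξ) = s ^ 2 ∧ lineCoord e 1 (conicPoint e s t, ξ) = s * t ∧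
      lineCoord e 2 (conicPoint e s t, ξ) = t ^ 2 :=
  coord_conicPoint e s t

theorem planeCoord_tangentForm (f : Basis (Fin 3) k V) (x : V) (v w : k) :
    planeCoord (f 0) (x, tangentForm f v w) = w ^ 2 ∧
      planeCoord (f 1) (x, tangentForm f v w) = -(2 * (v * w)) ∧
      planeCoord (f 2) (x, tangentForm f v w) = v ^ 2 :=
  tangentForm_apply_basis f v w

theorem isPolynomialMap_conicPoint_tangentForm {W : Type w} [AddCommGroup W] [Module k W]
    (e f : Basis (Fin 3) k V) {S T v w : W → k} (hS : S ∈ polynomialFunctions k W)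
    (hT : T ∈ polynomialFunctions k W) (hv : v ∈ polynomialFunctions k W)
    (hw : w ∈ polynomialFunctions k W) : IsPolynomialMap (k := k) fun x =>
      (conicPoint e (S x) (T x), tangentForm f (v x) (w x)) := by
  refine (isPolynomialMap_sum_smul (polynomialFunctions_pow hS 2) (polynomialFunctions_mul hS hT)
    (polynomialFunctions_pow hT 2) _ _ _).prodMk ?_
  have := isPolynomialMap_sum_smul (polynomialFunctions_pow hw 2)
    (polynomialFunctions_neg (polynomialFunctions_mul (polynomialFunctions_const 2)
      (polynomialFunctions_mul hv hw)))
    (polynomialFunctions_pow hv 2) (f.coord 0) (f.coord 1) (f.coord 2)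
  refine cast (congrArg _ ?_) this
  ext x : 1
  rw [tangentForm, neg_smul, sub_eq_add_neg]

theorem IsConicFrame.ne_zero_or_ne_zero [IsAlgClosed k]
    (h : IsConicFrame B B' e f α₀ α₁ β₀ β₁) (h2 : (2 : k) ≠ 0)
    (h4 : (isotropicLines B ∩ isotropicLines B').ncard = 4) : β₀ ≠ 0 ∨ β₁ ≠ 0 := by
  by_contra! hβ
  refine (h.isElliptic h2 h4).isUnit.ne_zero ?_
  simp [frameCurve, hβ.1, hβ.2, WeierstrassCurve.Δ, WeierstrassCurve.b₂, WeierstrassCurve.b₄,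
    WeierstrassCurve.b₆, WeierstrassCurve.b₈]

variable [Fact (Module.finrank k V = 3)]

/-- Where two coordinates of the flag, one of the line and one of the plane, do not vanish, the
point of the Weierstrass curve is given by bihomogeneous polynomials. -/
theorem IsConicFrame.isMorphism_toPoint [IsAlgClosed k]
    (h : IsConicFrame B B' e f α₀ α₁ β₀ β₁)
    (h2 : (2 : k) ≠ 0) (hs' : B'.IsSymm) (hB' : B'.Nondegenerate)
    {φ : secantTangentFlags B B' → ↥(weierstrassPoints (frameCurve α₀ α₁ β₀ β₁))}
    (hφ : ∀ F P, FlagRel e f α₀ α₁ β₀ β₁ F.1 P.1 → φ F = P) :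
    IsMorphism ((variety k V).sub (secantTangentFlags B B'))
      ((projectiveSpace k (Fin 3 → k)).sub (weierstrassPoints (frameCurve α₀ α₁ β₀ β₁))) φ := by
  refine HasLocalSections.isMorphism_of_charts (C' := {x : Fin 3 → k | x ≠ 0})
    (π' := (Projectivization.mk' k : _ → ℙ k (Fin 3 → k))) (hasLocalSections k V) ?_
  have hl : ∀ i, ⇑(lineCoord e i) ∈ polynomialFunctions k (V × Module.Dual k V) := fun i =>
    dual_mem_polynomialFunctions _
  have hp : ∀ i, ⇑(planeCoord (k := k) (f i)) ∈ polynomialFunctions k (V × Module.Dual k V) :=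
    fun i => dual_mem_polynomialFunctions _
  have hc : ∀ a : k, (fun _ => a) ∈ polynomialFunctions k (V × Module.Dual k V) :=
    polynomialFunctions_const
  have hlp : ∀ i j, (fun c => lineCoord e i c * planeCoord (f j) c) ∈
      polynomialFunctions k (V × Module.Dual k V) := fun i j =>
    polynomialFunctions_mul (hl i) (hp j)
  have key : ∀ {s t v w a : k} {X : Fin 3 → k}
      (hc : (conicPoint e s t, tangentForm f v w) ∈ homogeneousCoordinates k V)
      (hF : ofCoordinates k V ⟨_, hc⟩ ∈ secantTangentFlags B B'), a ≠ 0 → X ≠ 0 →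
      (FrameRel α₀ α₁ β₀ β₁ s t v w X ∧ X 0 ^ 3 = (X 1 ^ 2 + 2 * α₁ * X 0 * X 1 +
        2 * β₁ * X 1 * X 2 - α₀ * X 0 ^ 2 - β₀ * X 0 * X 2) * X 2) →
      ∀ Y : Fin 3 → k, Y = a • X → ∃ hY : Y ∈ {x : Fin 3 → k | x ≠ 0},
        Projectivization.mk' k ⟨Y, hY⟩ = (φ ⟨_, hF⟩).1 := by
    rintro s t v w a X hc hF ha hX ⟨hR, hW⟩ Y rfl
    refine ⟨smul_ne_zero ha hX, ?_⟩
    rw [hφ ⟨_, hF⟩ ⟨Projectivization.mk k X hX, (mk_mem_weierstrassPoints_frameCurve hX).2 hW⟩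
      ⟨s, t, v, w, X, hX, hc, hR, rfl, rfl⟩]
    exact (Projectivization.mk_eq_mk_iff' k _ _ _ _).2 ⟨a, rfl⟩
  intro c hcF
  obtain ⟨s, t, v, w, hc₀, hI⟩ := h.exists_params h2 hs' hB' hcF
  obtain ⟨c, hcc⟩ := c
  obtain rfl : c = _ := hc₀
  obtain ⟨hst, hvw⟩ := params_ne_zero hcc
  obtain ⟨l0, l1, l2⟩ := lineCoord_conicPoint e s t (tangentForm f v w)
  obtain ⟨p0, p1, p2⟩ := planeCoord_tangentForm f (conicPoint e s t) v w
  rcases hI.formula_ne_zero hst hvw with h0 | h0 | h0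
  · refine ⟨_, hlp 2 0, ?_, fun c => ![2 * (lineCoord e 1 c * planeCoord (f 0) c),
      -(lineCoord e 1 c * planeCoord (f 1) c), 2 * (lineCoord e 2 c * planeCoord (f 0) c)],
      isPolynomialMap_pi fun i => ?_, ?_⟩
    · simp only [l2, p0, ← mul_pow]
      exact pow_ne_zero 2 h0
    · fin_cases i
      · exact polynomialFunctions_mul (hc 2) (hlp 1 0)
      · exact polynomialFunctions_neg (hlp 1 1)
      · exact polynomialFunctions_mul (hc 2) (hlp 2 0)
    · rintro ⟨c', hcc'⟩ hcF' hq
      obtain ⟨s', t', v', w', hc₀', hI'⟩ := h.exists_params h2 hs' hB' hcF'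
      obtain rfl : c' = _ := hc₀'
      obtain ⟨l0, l1, l2⟩ := lineCoord_conicPoint e s' t' (tangentForm f v' w')
      obtain ⟨p0, p1, p2⟩ := planeCoord_tangentForm f (conicPoint e s' t') v' w'
      simp only [l2, p0, ← mul_pow] at hq
      have htw := ne_zero_pow two_ne_zero hq
      refine key hcc' hcF' (mul_ne_zero h2 htw) (fun hX => htw (congrFun hX 2)) (frameRel_first hI')
        _ ?_
      simp only [l1, l2, p0, p1]
      ext i
      fin_cases i <;> simp <;> ring
  · refine ⟨_, hlp 0 2, ?_, fun c => ![-(lineCoord e 0 c * planeCoord (f 1) c),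
      2 * (lineCoord e 0 c * planeCoord (f 2) c), -(lineCoord e 1 c * planeCoord (f 1) c)],
      isPolynomialMap_pi fun i => ?_, ?_⟩
    · simp only [l0, p2, ← mul_pow]
      exact pow_ne_zero 2 h0
    · fin_cases i
      · exact polynomialFunctions_neg (hlp 0 1)
      · exact polynomialFunctions_mul (hc 2) (hlp 0 2)
      · exact polynomialFunctions_neg (hlp 1 1)
    · rintro ⟨c', hcc'⟩ hcF' hq
      obtain ⟨s', t', v', w', hc₀', hI'⟩ := h.exists_params h2 hs' hB' hcF'
      obtain rfl : c' = _ := hc₀'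
      obtain ⟨l0, l1, l2⟩ := lineCoord_conicPoint e s' t' (tangentForm f v' w')
      obtain ⟨p0, p1, p2⟩ := planeCoord_tangentForm f (conicPoint e s' t') v' w'
      simp only [l0, p2, ← mul_pow] at hq
      have hsv := ne_zero_pow two_ne_zero hq
      refine key hcc' hcF' (mul_ne_zero h2 hsv) (fun hX => hsv (congrFun hX 1)) (frameRel_first hI')
        _ ?_
      simp only [l0, l1, p2, p1]
      ext i
      fin_cases i <;> simp <;> ring
  · refine ⟨_, hlp 2 2, ?_, fun c => ![2 * (lineCoord e 1 c * planeCoord (f 2) c),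
      -((lineCoord e 0 c + α₀ * lineCoord e 1 c + β₀ * lineCoord e 2 c) * planeCoord (f 1) c) -
        4 * ((α₁ * lineCoord e 1 c + β₁ * lineCoord e 2 c) * planeCoord (f 2) c),
      2 * (lineCoord e 2 c * planeCoord (f 2) c)],
      isPolynomialMap_pi fun i => ?_, ?_⟩
    · simp only [l2, p2, ← mul_pow]
      exact pow_ne_zero 2 h0
    · fin_cases i
      · exact polynomialFunctions_mul (hc 2) (hlp 1 2)
      · exact polynomialFunctions_sub (polynomialFunctions_neg (polynomialFunctions_mul
          (polynomialFunctions_add (polynomialFunctions_add (hl 0)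
            (polynomialFunctions_mul (hc _) (hl 1))) (polynomialFunctions_mul (hc _) (hl 2)))
            (hp 1)))
          (polynomialFunctions_mul (hc 4) (polynomialFunctions_mul (polynomialFunctions_add
            (polynomialFunctions_mul (hc _) (hl 1)) (polynomialFunctions_mul (hc _) (hl 2)))
            (hp 2)))
      · exact polynomialFunctions_mul (hc 2) (hlp 2 2)
    · rintro ⟨c', hcc'⟩ hcF' hq
      obtain ⟨s', t', v', w', hc₀', hI'⟩ := h.exists_params h2 hs' hB' hcF'
      obtain rfl : c' = _ := hc₀'
      obtain ⟨l0, l1, l2⟩ := lineCoord_conicPoint e s' t' (tangentForm f v' w')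
      obtain ⟨p0, p1, p2⟩ := planeCoord_tangentForm f (conicPoint e s' t') v' w'
      simp only [l2, p2, ← mul_pow] at hq
      have htv := ne_zero_pow two_ne_zero hq
      have hX2 : t' ^ 2 * v' ≠ 0 := by
        rw [pow_two, mul_assoc]
        exact mul_ne_zero (left_ne_zero_of_mul htv) htv
      refine key hcc' hcF' (mul_ne_zero h2 (right_ne_zero_of_mul htv))
        (fun hX => hX2 (congrFun hX 2)) (frameRel_second hI') _ ?_
      simp only [l0, l1, l2, p2, p1]
      ext i
      fin_cases i <;> simp <;> ring

theorem IsConicFrame.isMorphism_toFlag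
    (h : IsConicFrame B B' e f α₀ α₁ β₀ β₁) (h2 : (2 : k) ≠ 0) (hβ : β₀ ≠ 0 ∨ β₁ ≠ 0)
    (hs' : B'.IsSymm) (hB' : B'.Nondegenerate)
    {ψ : ↥(weierstrassPoints (frameCurve α₀ α₁ β₀ β₁)) → secantTangentFlags B B'}
    (hψ : ∀ F P, FlagRel e f α₀ α₁ β₀ β₁ F.1 P.1 → ψ P = F) :
    IsMorphism ((projectiveSpace k (Fin 3 → k)).sub (weierstrassPoints (frameCurve α₀ α₁ β₀ β₁)))
      ((variety k V).sub (secantTangentFlags B B')) ψ := by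
  refine HasLocalSections.isMorphism_of_charts (C' := homogeneousCoordinates k V)
    (π' := ofCoordinates k V) (projectiveSpace_hasLocalSections (k := k) (W := Fin 3 → k)) ?_
  -- one of the two expressions for each of the two parameters is defined near the given point
  have key : ∀ S ∈ polynomialFunctions k (Fin 3 → k), ∀ T ∈ polynomialFunctions k (Fin 3 → k),
      ∀ v ∈ polynomialFunctions k (Fin 3 → k), ∀ w ∈ polynomialFunctions k (Fin 3 → k),
      (∀ X : Fin 3 → k, X 0 ^ 3 = (X 1 ^ 2 + 2 * α₁ * X 0 * X 1 + 2 * β₁ * X 1 * X 2 -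
        α₀ * X 0 ^ 2 - β₀ * X 0 * X 2) * X 2 → FrameRel α₀ α₁ β₀ β₁ (S X) (T X) (v X) (w X) X ∧
          FrameIncidence α₀ α₁ β₀ β₁ (S X) (T X) (v X) (w X)) →
      ∀ X : Fin 3 → k, (S X ≠ 0 ∨ T X ≠ 0) → (v X ≠ 0 ∨ w X ≠ 0) →
      ∃ q ∈ polynomialFunctions k (Fin 3 → k), q X ≠ 0 ∧
        ∃ h : (Fin 3 → k) → V × Module.Dual k V, IsPolynomialMap (k := k) h ∧
        ∀ (c' : {x : Fin 3 → k | x ≠ 0})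
          (hc' : Projectivization.mk' k c' ∈ weierstrassPoints (frameCurve α₀ α₁ β₀ β₁)),
          q c'.1 ≠ 0 → ∃ hh : h c'.1 ∈ homogeneousCoordinates k V,
            ofCoordinates k V ⟨h c'.1, hh⟩ = (ψ ⟨Projectivization.mk' k c', hc'⟩).1 := by
    intro S hS T hT v hv w hw hR X hST hvw
    obtain ⟨q₁, hq₁, hq₁X, hq₁'⟩ : ∃ q ∈ polynomialFunctions k (Fin 3 → k), q X ≠ 0 ∧
        ∀ Y, q Y ≠ 0 → S Y ≠ 0 ∨ T Y ≠ 0 := by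
      rcases hST with hX | hX
      · exact ⟨S, hS, hX, fun Y => Or.inl⟩
      · exact ⟨T, hT, hX, fun Y => Or.inr⟩
    obtain ⟨q₂, hq₂, hq₂X, hq₂'⟩ : ∃ q ∈ polynomialFunctions k (Fin 3 → k), q X ≠ 0 ∧
        ∀ Y, q Y ≠ 0 → v Y ≠ 0 ∨ w Y ≠ 0 := by
      rcases hvw with hX | hX
      · exact ⟨v, hv, hX, fun Y => Or.inl⟩
      · exact ⟨w, hw, hX, fun Y => Or.inr⟩
    refine ⟨_, polynomialFunctions_mul hq₁ hq₂, mul_ne_zero hq₁X hq₂X, _,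
      isPolynomialMap_conicPoint_tangentForm e f hS hT hv hw, ?_⟩
    rintro ⟨Y, hY⟩ hYW hq
    obtain ⟨hRY, hIY⟩ := hR Y ((mk_mem_weierstrassPoints_frameCurve hY).1 hYW)
    have hc := h.mem_homogeneousCoordinates (hq₁' Y (left_ne_zero_of_mul hq))
      (hq₂' Y (right_ne_zero_of_mul hq)) hIY
    refine ⟨hc, ?_⟩
    rw [hψ ⟨_, h.ofCoordinates_mem h2 hs' hB' hc⟩ ⟨Projectivization.mk' k ⟨Y, hY⟩, hYW⟩
      ⟨_, _, _, _, Y, hY, hc, hRY, rfl, rfl⟩]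
  rintro ⟨X, hX⟩ hP
  have hp : ∀ i : Fin 3, (fun X : Fin 3 → k => X i) ∈ polynomialFunctions k (Fin 3 → k) :=
    polynomialFunctions_proj
  have hpp : ∀ i j : Fin 3, ∀ a : k, (fun X : Fin 3 → k => a * X i * X j) ∈
      polynomialFunctions k (Fin 3 → k) := fun i j a =>
    polynomialFunctions_mul (polynomialFunctions_mul (polynomialFunctions_const a) (hp i)) (hp j)
  have hpsq : ∀ i : Fin 3, (fun X : Fin 3 → k => X i ^ 2) ∈ polynomialFunctions k (Fin 3 → k) :=
    fun i => polynomialFunctions_pow (hp i) 2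
  have hcp : ∀ i : Fin 3, ∀ a : k, (fun X : Fin 3 → k => a * X i ^ 2) ∈
      polynomialFunctions k (Fin 3 → k) := fun i a =>
    polynomialFunctions_mul (polynomialFunctions_const a) (hpsq i)
  by_cases h02 : X 0 ≠ 0 ∨ X 2 ≠ 0
  · by_cases h10 : X 1 ≠ 0 ∨ X 0 ≠ 0
    · exact key _ (hp 0) _ (hp 2) _ (hp 1) _ (hp 0)
        (fun Y hY => (frameRel_params rfl rfl rfl hY).1) X h02 h10
    · push Not at h10
      have hz : X 2 ≠ 0 := h02.resolve_left (not_not.2 h10.2)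
      refine key _ (hp 0) _ (hp 2)
        (fun X => X 0 ^ 2 + α₀ * X 0 * X 2 + β₀ * X 2 ^ 2)
        (polynomialFunctions_add (polynomialFunctions_add (hpsq 0) (hpp 0 2 _)) (hcp 2 _))
        (fun X => X 1 * X 2 + 2 * α₁ * X 0 * X 2 + 2 * β₁ * X 2 ^ 2)
        (polynomialFunctions_add (polynomialFunctions_add (polynomialFunctions_mul (hp 1) (hp 2))
          (hpp 0 2 _)) (hcp 2 _))
        (fun Y hY => (frameRel_params rfl rfl rfl hY).2.1) X h02 ?_
      simpa [h10.1, h10.2, hz, h2] using hβ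
  · push Not at h02
    have hy : X 1 ≠ 0 := fun hy => hX (by
      ext i
      fin_cases i
      exacts [h02.1, hy, h02.2])
    refine key (fun X => X 1 ^ 2 + 2 * α₁ * X 0 * X 1 + 2 * β₁ * X 1 * X 2 - α₀ * X 0 ^ 2 -
        β₀ * X 0 * X 2)
      (polynomialFunctions_sub (polynomialFunctions_sub (polynomialFunctions_add
        (polynomialFunctions_add (hpsq 1) (hpp 0 1 _)) (hpp 1 2 _)) (hcp 0 _)) (hpp 0 2 _))
      _ (hpsq 0) _ (hp 1) _ (hp 0)
      (fun Y hY => (frameRel_params rfl rfl rfl hY).2.2) X (Or.inl ?_) (Or.inl hy)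
    simpa [h02.1, h02.2] using hy

/-- The isomorphism with the Weierstrass curve. Over the line of `x`, the affine coordinate `X / Z`
is the quotient of the coordinates `1` and `2` of `x`. -/
theorem IsConicFrame.exists_isomorphism [IsAlgClosed k]
    (h : IsConicFrame B B' e f α₀ α₁ β₀ β₁) (h2 : (2 : k) ≠ 0)
    (hs' : B'.IsSymm) (hB' : B'.Nondegenerate)
    (h4 : (isotropicLines B ∩ isotropicLines B').ncard = 4) :
    ∃ φ : secantTangentFlags B B' ≃ ↥(weierstrassPoints (frameCurve α₀ α₁ β₀ β₁)),
      IsMorphism ((variety k V).sub (secantTangentFlags B B'))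
        ((projectiveSpace k (Fin 3 → k)).sub (weierstrassPoints (frameCurve α₀ α₁ β₀ β₁))) φ ∧
      IsMorphism ((projectiveSpace k (Fin 3 → k)).sub (weierstrassPoints (frameCurve α₀ α₁ β₀ β₁)))
        ((variety k V).sub (secantTangentFlags B B')) φ.symm ∧
      ∀ (F : secantTangentFlags B B') (x : V) (hx : x ≠ 0) (X : Fin 3 → k) (hX : X ≠ 0),
        F.1.L = Projectivization.mk k x hx → (φ F).1 = Projectivization.mk k X hX →
        e.coord 1 x * X 2 = e.coord 2 x * X 0 ∧ (X 2 = 0 ↔ e.coord 2 x = 0) := by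
  have hβ := h.ne_zero_or_ne_zero h2 h4
  obtain ⟨φ, hφ⟩ := exists_equiv_of_existsUnique (h.existsUnique_point h2 hs' hB')
    (h.existsUnique_flag h2 hβ hs' hB')
  refine ⟨φ, h.isMorphism_toPoint h2 hs' hB' fun F P => (hφ F P).1,
    h.isMorphism_toFlag h2 hβ hs' hB' fun F P hFP => ?_, ?_⟩
  · rw [← (hφ F P).1 hFP, φ.symm_apply_apply]
  intro F x hx X hX hL hP
  obtain ⟨s, t, v, w, X', hX', hc, hR, hP', hF⟩ := (hφ F (φ F)).2 rfl
  have hW := (φ F).2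
  rw [hP'] at hW
  have hz := hR.z_eq_zero_iff (params_ne_zero hc).1 hX' hW
  obtain ⟨a, rfl⟩ := (Projectivization.mk_eq_mk_iff' k _ _ hX hX').1 (hP.symm.trans hP')
  obtain ⟨b, rfl⟩ := (Projectivization.mk_eq_mk_iff' k _ _ hx hc.1).1
    (hL.symm.trans (congrArg FullFlag.L hF))
  have ha : a ≠ 0 := fun ha => hX (by rw [ha, zero_smul])
  have hb : b ≠ 0 := fun hb => hx (by rw [hb, zero_smul])
  obtain ⟨-, c1, c2⟩ := coord_conicPoint e s t
  rw [map_smul, map_smul, c1, c2]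
  simp only [Pi.smul_apply, smul_eq_mul, mul_eq_zero, ha, hb, false_or, pow_eq_zero_iff two_ne_zero]
  exact ⟨by linear_combination a * b * t * hR.1, hz⟩

end FrameMorphism

/-! ### Affine charts of a double covering -/

namespace SpaceWithFunctions

variable {k : Type u} [Field k]

theorem regularAt_sum {X : SpaceWithFunctions.{u, v} k} {ι : Type*} (s : Finset ι)
    {f : ι → X → k} {x : X} (hf : ∀ i, X.RegularAt (f i) x) :
    X.RegularAt (fun y => ∑ i ∈ s, f i y) x := by
  classical
  induction s using Finset.induction_on with
  | empty => simpa using X.const 0 x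
  | insert i s hi ih =>
    simp only [Finset.sum_insert hi]
    exact X.add (hf i) ih

theorem MorphismAt.of_coordinates {X : SpaceWithFunctions.{u, v} k} (hX : X.InvertsUnits) {n : ℕ}
    {φ : X → affineSpace k (Fin n → k)} {x : X}
    (h : ∀ i, X.RegularAt (fun y => (φ y : Fin n → k) i) x) :
    MorphismAt X (affineSpace k (Fin n → k)) φ x := by
  refine .of_dual hX fun ℓ => ?_
  have hℓ : (fun y => ℓ (φ y)) = fun y => ∑ i, (φ y : Fin n → k) i * ℓ (Pi.single i 1) :=
    funext fun y => dual_apply_eq_sum ℓ (φ y)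
  rw [hℓ]
  exact regularAt_sum _ fun i => X.mul (h i) (X.const _ x)

theorem polynomialFunctions_eval {W : Type w} [AddCommGroup W] [Module k W] {p : W → k}
    (hp : p ∈ polynomialFunctions k W) (a : Polynomial k) :
    (fun x => a.eval (p x)) ∈ polynomialFunctions k W := by
  induction a using Polynomial.induction_on' with
  | add a b ha hb =>
    simp only [Polynomial.eval_add]
    exact polynomialFunctions_add ha hb
  | monomial n c =>
    simp only [Polynomial.eval_monomial]
    exact polynomialFunctions_mul (polynomialFunctions_const c) (polynomialFunctions_pow hp n)

theorem eval_aeval_globalSections {X : SpaceWithFunctions.{u, v} k} (s : X.globalSections)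
    (a : Polynomial k) (x : X) : (Polynomial.aeval s a).1 x = a.eval (s.1 x) := by
  have := Polynomial.aeval_algHom_apply
    ((Pi.evalAlgHom k (fun _ : X => k) x).comp X.globalSections.val) s a
  exact this.symm.trans (by rw [Polynomial.coe_aeval_eq_eval]; rfl)

theorem exists_polynomial_of_mvPolynomial_one (P : MvPolynomial (Fin 1) k) :
    ∃ A : Polynomial k, ∀ c : Fin 1 → k, MvPolynomial.eval c P = A.eval (c 0) := by
  induction P using MvPolynomial.induction_on with
  | C a => exact ⟨.C a, fun c => by simp⟩
  | add p q hp hq =>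
    obtain ⟨A, hA⟩ := hp
    obtain ⟨A', hA'⟩ := hq
    exact ⟨A + A', fun c => by simp [hA, hA']⟩
  | mul_X p i hp =>
    obtain ⟨A, hA⟩ := hp
    exact ⟨A * .X, fun c => by simp [hA, Fin.fin_one_eq_zero i]⟩

/-- Division with remainder by a monic quadratic polynomial in the second variable. -/
theorem exists_polynomials_of_mvPolynomial_two (a b : Polynomial k) (P : MvPolynomial (Fin 2) k) :
    ∃ A D : Polynomial k, ∀ c : Fin 2 → k, c 1 ^ 2 + a.eval (c 0) * c 1 = b.eval (c 0) →
      MvPolynomial.eval c P = A.eval (c 0) + D.eval (c 0) * c 1 := by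
  induction P using MvPolynomial.induction_on with
  | C a => exact ⟨.C a, 0, fun c _ => by simp⟩
  | add p q hp hq =>
    obtain ⟨A, D, hA⟩ := hp
    obtain ⟨A', D', hA'⟩ := hq
    refine ⟨A + A', D + D', fun c hc => ?_⟩
    rw [map_add, hA c hc, hA' c hc, Polynomial.eval_add, Polynomial.eval_add]
    ring
  | mul_X p i hp =>
    obtain ⟨A, D, hA⟩ := hp
    fin_cases i
    · refine ⟨A * .X, D * .X, fun c hc => ?_⟩
      rw [map_mul, hA c hc]
      simp
      ring
    · refine ⟨D * b, A - D * a, fun c hc => ?_⟩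
      rw [map_mul, hA c hc]
      simp
      linear_combination D.eval (c 0) * hc

theorem ncard_quadratic_roots [IsAlgClosed k] (h2 : (2 : k) ≠ 0) (p q : k) :
    (p ^ 2 + 4 * q = 0 → {y : k | y ^ 2 + p * y = q}.ncard = 1) ∧
      (p ^ 2 + 4 * q ≠ 0 → {y : k | y ^ 2 + p * y = q}.ncard = 2) := by
  obtain ⟨d, hd⟩ := IsAlgClosed.exists_pow_nat_eq (p ^ 2 + 4 * q) two_pos
  have hset : {y : k | y ^ 2 + p * y = q} = {(-p + d) / 2, (-p - d) / 2} := by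
    ext y
    have hy : 4 * (y ^ 2 + p * y - q) = (2 * y - (-p + d)) * (2 * y - (-p - d)) := by
      linear_combination hd
    have h4 : (4 : k) ≠ 0 := by
      rw [show (4 : k) = 2 * 2 by norm_num]
      exact mul_ne_zero h2 h2
    rw [Set.mem_ofPred_eq, ← sub_eq_zero, ← mul_right_inj' h4, mul_zero, hy, mul_eq_zero,
      sub_eq_zero, sub_eq_zero, Set.mem_insert_iff, Set.mem_singleton_iff, eq_div_iff h2,
      eq_div_iff h2, mul_comm y]
  rw [hset]
  constructor
  · intro h0
    rw [h0, pow_eq_zero_iff two_ne_zero] at hd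
    rw [hd, add_zero, sub_zero, Set.pair_eq_singleton, Set.ncard_singleton]
  · intro h0
    rw [← hd, pow_ne_zero_iff two_ne_zero] at h0
    refine Set.ncard_pair fun h => h0 ?_
    rw [div_left_inj' h2] at h
    refine (mul_eq_zero.1 (?_ : 2 * d = 0)).resolve_left h2
    linear_combination h

section DoubleCover

variable {X : SpaceWithFunctions.{u, v} k} {Y : SpaceWithFunctions.{u, w} k} {π : X → Y}
  {U : Set Y} {a b : Polynomial k}

/-- The affine curve `y² + a(x) y = b(x)`. -/
def quadraticCurve (a b : Polynomial k) : Set (Fin 2 → k) :=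
  {c | c 1 ^ 2 + a.eval (c 0) * c 1 = b.eval (c 0)}

theorem isClosed_quadraticCurve (a b : Polynomial k) :
    IsClosed (X := affineSpace k (Fin 2 → k)) (quadraticCurve a b) := by
  have := isClosed_eq_zero (polynomialFunctions_sub (polynomialFunctions_add
    (polynomialFunctions_pow (polynomialFunctions_proj (k := k) (1 : Fin 2)) 2)
    (polynomialFunctions_mul (polynomialFunctions_eval (polynomialFunctions_proj (0 : Fin 2)) a)
      (polynomialFunctions_proj 1))) (polynomialFunctions_eval (polynomialFunctions_proj 0) b))
  simp only [sub_eq_zero] at this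
  exact this

theorem regularAt_coordinate {n : ℕ} {Z : Set (affineSpace k (Fin n → k))}
    (i : Fin n) (z : Z) :
    ((affineSpace k (Fin n → k)).sub Z).RegularAt (fun c => (c.1 : Fin n → k) i) z :=
  (isMorphism_subtype_val (affineSpace k (Fin n → k)) Z).2 (fun c : Fin n → k => c i) z
    (regularAt_of_mem_polynomialFunctions (polynomialFunctions_proj i) z.1)

/-- If in affine coordinates a map is the projection `(x, y) ↦ x` of a curve `y² + a(x) y = b(x)`,
then `1` and `y` form a basis of the regular functions. -/
theorem exists_basis_of_charts [IsAlgClosed k] (h2 : (2 : k) ≠ 0) (hd : a ^ 2 + 4 * b ≠ 0)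
    {η : ↥(π ⁻¹' U) ≃ ↥(quadraticCurve a b)} {ε : ↥U ≃ ↥(Set.univ : Set (Fin 1 → k))}
    (hη : IsMorphism (X.sub (π ⁻¹' U)) ((affineSpace k (Fin 2 → k)).sub (quadraticCurve a b)) η)
    (hη' : IsMorphism ((affineSpace k (Fin 2 → k)).sub (quadraticCurve a b)) (X.sub (π ⁻¹' U))
      η.symm)
    (hε : IsMorphism (Y.sub U) ((affineSpace k (Fin 1 → k)).sub Set.univ) ε)
    (hε' : IsMorphism ((affineSpace k (Fin 1 → k)).sub Set.univ) (Y.sub U) ε.symm)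
    (h : ∀ x : ↥(π ⁻¹' U), (η x).1 0 = (ε ⟨π x.1, x.2⟩).1 0) :
    ∃ b : Fin 2 → (X.sub (π ⁻¹' U)).globalSections,
      ∀ h : (X.sub (π ⁻¹' U)).globalSections, ∃! c : Fin 2 → (Y.sub U).globalSections,
        ∀ x : ↥(π ⁻¹' U), h.1 x = ∑ i, (c i).1 ⟨π x.1, x.2⟩ * (b i).1 x := by
  let y : (X.sub (π ⁻¹' U)).globalSections :=
    ⟨fun x => (η x).1 1, fun x => hη.2 _ x (regularAt_coordinate 1 (η x))⟩
  let s : (Y.sub U).globalSections :=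
    ⟨fun x => (ε x).1 0, fun x => hε.2 _ x (regularAt_coordinate 0 (ε x))⟩
  have hclosed : IsClosed (X := affineSpace k (Fin 1 → k)) Set.univ := isClosed_univ
  -- the regular functions on `U` are the polynomials in `s`
  have hpoly : ∀ c : (Y.sub U).globalSections, ∃ A : Polynomial k, ∀ x, c.1 x = A.eval (s.1 x) := by
    intro c
    obtain ⟨P, hP⟩ := exists_mvPolynomial_of_regularAt hclosed (f := fun z => c.1 (ε.symm z))
      fun z => hε'.2 c.1 z (c.2 (ε.symm z))
    obtain ⟨A, hA⟩ := exists_polynomial_of_mvPolynomial_one P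
    refine ⟨A, fun (x : ↥U) => ?_⟩
    have hx := hP (ε x)
    rw [ε.symm_apply_apply, hA] at hx
    exact hx
  refine ⟨![1, y], fun f => existsUnique_of_exists_of_unique ?_ ?_⟩
  · obtain ⟨P, hP⟩ := exists_mvPolynomial_of_regularAt (isClosed_quadraticCurve a b)
      (f := fun z => f.1 (η.symm z)) fun z => hη'.2 f.1 z (f.2 (η.symm z))
    obtain ⟨A, D, hAD⟩ := exists_polynomials_of_mvPolynomial_two a b P
    refine ⟨![Polynomial.aeval s A, Polynomial.aeval s D], fun x => ?_⟩
    have hx := hP (η x)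
    rw [η.symm_apply_apply, hAD _ (η x).2, h x] at hx
    have hA := eval_aeval_globalSections s A ⟨π x.1, x.2⟩
    have hD := eval_aeval_globalSections s D ⟨π x.1, x.2⟩
    simp only [Fin.sum_univ_two, Matrix.cons_val_zero, Matrix.cons_val_one]
    refine hx.trans (congrArg₂ (· + ·) ?_ ?_)
    · exact hA.symm.trans (mul_one _).symm
    · exact congrArg (· * _) hD.symm
  · intro c c' hc hc'
    simp only [Fin.sum_univ_two, Matrix.cons_val_zero, Matrix.cons_val_one] at hc hc'
    have key : ∀ x : ↥(π ⁻¹' U), ((c 0).1 ⟨π x.1, x.2⟩ - (c' 0).1 ⟨π x.1, x.2⟩) +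
        ((c 1).1 ⟨π x.1, x.2⟩ - (c' 1).1 ⟨π x.1, x.2⟩) * y.1 x = 0 := by
      intro x
      have h1 := hc x
      rw [hc' x] at h1
      change _ * (1 : k) + _ = _ * (1 : k) + _ at h1
      linear_combination -h1
    obtain ⟨A, hA⟩ := hpoly (c 0 - c' 0)
    obtain ⟨D, hD⟩ := hpoly (c 1 - c' 1)
    have key' : ∀ z ∈ quadraticCurve a b, A.eval (z 0) + D.eval (z 0) * z 1 = 0 := by
      intro z hz
      have h1 := key (η.symm ⟨z, hz⟩)
      have h2 := h (η.symm ⟨z, hz⟩)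
      rw [η.apply_symm_apply] at h2
      have h3 := hA ⟨π (η.symm ⟨z, hz⟩).1, (η.symm ⟨z, hz⟩).2⟩
      have h4 := hD ⟨π (η.symm ⟨z, hz⟩).1, (η.symm ⟨z, hz⟩).2⟩
      change (c 0).1 _ - (c' 0).1 _ = A.eval ((ε _).1 0) at h3
      change (c 1).1 _ - (c' 1).1 _ = D.eval ((ε _).1 0) at h4
      rw [← h2] at h3 h4
      rw [h3, h4] at h1
      have h5 : y.1 (η.symm ⟨z, hz⟩) = z 1 := by
        change (η _).1 1 = _
        rw [η.apply_symm_apply]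
      rwa [h5] at h1
    -- a linear expression that vanishes at two solutions of the quadratic equation is zero
    have hDroot : D * (a ^ 2 + 4 * b) = 0 := by
      refine Polynomial.funext fun r => ?_
      rw [Polynomial.eval_mul, Polynomial.eval_zero, mul_eq_zero]
      by_contra! hr
      have hr' : a.eval r ^ 2 + 4 * b.eval r ≠ 0 := by simpa using hr.2
      obtain ⟨y₁, y₂, hy, hset⟩ := Set.ncard_eq_two.1 ((ncard_quadratic_roots h2 _ _).2 hr')
      have h1 : y₁ ∈ {y : k | y ^ 2 + a.eval r * y = b.eval r} := by rw [hset]; simp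
      have h2 : y₂ ∈ {y : k | y ^ 2 + a.eval r * y = b.eval r} := by rw [hset]; simp
      have e1 := key' ![r, y₁] h1
      have e2 := key' ![r, y₂] h2
      simp only [Matrix.cons_val_zero, Matrix.cons_val_one] at e1 e2
      refine mul_ne_zero hr.1 (sub_ne_zero.2 hy) ?_
      linear_combination e1 - e2
    have hD0 : D = 0 := (mul_eq_zero.1 hDroot).resolve_right hd
    have hA0 : A = 0 := by
      refine Polynomial.funext fun r => ?_
      obtain ⟨y₁, hy₁⟩ : {y : k | y ^ 2 + a.eval r * y = b.eval r}.Nonempty := by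
        refine Set.nonempty_of_ncard_ne_zero ?_
        by_cases hr : a.eval r ^ 2 + 4 * b.eval r = 0
        · rw [(ncard_quadratic_roots h2 _ _).1 hr]
          exact one_ne_zero
        · rw [(ncard_quadratic_roots h2 _ _).2 hr]
          exact two_ne_zero
      simpa [hD0] using key' ![r, y₁] hy₁
    have e0 : c 0 = c' 0 := sub_eq_zero.1 (Subtype.ext (funext fun x => by rw [hA, hA0]; simp))
    have e1 : c 1 = c' 1 := sub_eq_zero.1 (Subtype.ext (funext fun x => by rw [hD, hD0]; simp))
    ext i : 1
    fin_cases i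
    exacts [e0, e1]

theorem ncard_fibre_of_charts
    {η : ↥(π ⁻¹' U) ≃ ↥(quadraticCurve a b)} {ε : ↥U ≃ ↥(Set.univ : Set (Fin 1 → k))}
    (h : ∀ x : ↥(π ⁻¹' U), (η x).1 0 = (ε ⟨π x.1, x.2⟩).1 0)
    {y : Y} (hy : y ∈ U) {s : k} (hs : (ε ⟨y, hy⟩).1 0 = s) :
    (π ⁻¹' {y}).ncard = {t : k | t ^ 2 + a.eval s * t = b.eval s}.ncard := by
  have hmem : ∀ x ∈ π ⁻¹' {y}, x ∈ π ⁻¹' U := fun x hx => by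
    rw [Set.mem_preimage, Set.mem_singleton_iff] at hx
    rwa [Set.mem_preimage, hx]
  have h0 : ∀ x (hx : x ∈ π ⁻¹' {y}), (η ⟨x, hmem x hx⟩).1 0 = s := fun x hx => by
    rw [h, ← hs]
    exact congrArg (fun z => (ε z).1 0) (Subtype.ext hx)
  refine Set.ncard_congr (fun x hx => (η ⟨x, hmem x hx⟩).1 1) (fun x hx => ?_) ?_ ?_
  · have := (η ⟨x, hmem x hx⟩).2
    change _ = _ at this
    rwa [h0 x hx] at this
  · intro x x' hx hx' hxx
    refine congrArg Subtype.val (η.injective (a₁ := ⟨x, hmem x hx⟩) (a₂ := ⟨x', hmem x' hx'⟩)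
      (Subtype.ext (funext fun i => ?_)))
    fin_cases i
    exacts [(h0 x hx).trans (h0 x' hx').symm, hxx]
  · intro t ht
    have hz : ![s, t] ∈ quadraticCurve a b := ht
    have hx : π (η.symm ⟨![s, t], hz⟩).1 = y := by
      have hε : ε ⟨_, (η.symm ⟨![s, t], hz⟩).2⟩ = ε ⟨y, hy⟩ := by
        refine Subtype.ext (funext fun i => ?_)
        rw [Fin.fin_one_eq_zero i, ← h, hs, η.apply_symm_apply]
        rfl
      exact congrArg Subtype.val (ε.injective hε)
    refine ⟨(η.symm ⟨![s, t], hz⟩).1, hx, ?_⟩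
    change (η (η.symm ⟨![s, t], hz⟩)).1 1 = t
    rw [η.apply_symm_apply]
    rfl

end DoubleCover

end SpaceWithFunctions

/-! ### The projection to the conic -/

section Projective

open SpaceWithFunctions

variable {k : Type u} [Field k] {W : Type w} [AddCommGroup W] [Module k W]

theorem isMorphism_sub_univ (X : SpaceWithFunctions.{u, v} k) :
    IsMorphism X (X.sub Set.univ) fun x => ⟨x, trivial⟩ :=
  .of_subtype_val ⟨continuous_id, fun _ _ h => h⟩

theorem projectiveSpace_invertsUnits : (projectiveSpace k W).InvertsUnits :=
  (affineSpace_invertsUnits.sub _).quotient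

theorem exists_rep_mk_eq_smul {x : W} (hx : x ≠ 0) :
    ∃ a : k, a ≠ 0 ∧ (Projectivization.mk k x hx).rep = a • x := by
  obtain ⟨a, ha⟩ := Projectivization.exists_smul_eq_mk_rep k x hx
  exact ⟨a, a.ne_zero, ha.symm⟩

theorem apply_rep_ne_zero_iff (m : Module.Dual k W) {x : W} (hx : x ≠ 0) :
    m (Projectivization.mk k x hx).rep ≠ 0 ↔ m x ≠ 0 := by
  obtain ⟨a, ha, h⟩ := exists_rep_mk_eq_smul (k := k) hx
  rw [h, map_smul, smul_ne_zero_iff, and_iff_right ha]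

theorem apply_rep_div_apply_rep (ℓ m : Module.Dual k W) {x : W} (hx : x ≠ 0) :
    ℓ (Projectivization.mk k x hx).rep / m (Projectivization.mk k x hx).rep = ℓ x / m x := by
  obtain ⟨a, ha, h⟩ := exists_rep_mk_eq_smul (k := k) hx
  rw [h, map_smul, map_smul, smul_eq_mul, smul_eq_mul, mul_div_mul_left _ _ ha]

theorem isOpen_apply_rep_ne_zero (m : Module.Dual k W) :
    IsOpen (X := projectiveSpace k W) {L : ℙ k W | m L.rep ≠ 0} := by
  refine isOpen_coinduced.2 ?_
  have hopen : IsOpen (X := (affineSpace k W).sub {x : W | x ≠ 0})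
      {x : {x : W // x ≠ 0} | m x.1 ≠ 0} :=
    (isOpen_ne_zero (dual_mem_polynomialFunctions m)).preimage
      (isMorphism_subtype_val (affineSpace k W) {x : W | x ≠ 0}).1
  convert hopen using 1
  ext x
  exact apply_rep_ne_zero_iff m x.2

theorem regularAt_apply_rep_div (ℓ m : Module.Dual k W) {L : ℙ k W} (hL : m L.rep ≠ 0) :
    (projectiveSpace k W).RegularAt (fun L : ℙ k W => ℓ L.rep / m L.rep) L := by
  induction L with
  | h x hx =>
    rw [apply_rep_ne_zero_iff] at hL
    have hinv : ∀ c c' : {v : W // v ≠ 0}, Projectivization.mk' k c = Projectivization.mk' k c' →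
        m c.1 ≠ 0 → m c'.1 ≠ 0 := by
      rintro ⟨c, hc⟩ ⟨c', hc'⟩ h hm
      simp only [Projectivization.mk'_eq_mk] at h
      rwa [← apply_rep_ne_zero_iff m hc', ← h, apply_rep_ne_zero_iff]
    exact quotient_regularAt (C := {x : W | x ≠ 0}) (π := (Projectivization.mk' k : _ → ℙ k W))
      (dual_mem_polynomialFunctions ℓ) (dual_mem_polynomialFunctions m) hinv
      (fun c _ => apply_rep_div_apply_rep ℓ m c.2) (c := ⟨x, hx⟩) hL

end Projective

section Conic

open LinearMap (GeneralLinearGroup BilinForm)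
open Module (Basis)
open FullFlag SpaceWithFunctions

variable {k : Type u} {V : Type v} [Field k] [AddCommGroup V] [Module k V] [IsAlgClosed k]
  {B : BilinForm k V} {e : Basis (Fin 3) k V}

theorem IsConicBasis.exists_rep_eq (he : IsConicBasis B e) (h2 : (2 : k) ≠ 0)
    (L : isotropicLines B) : ∃ s t : k, (s ≠ 0 ∨ t ≠ 0) ∧ L.1.rep = conicPoint e s t :=
  he.exists_eq_conicPoint h2 L.1.rep_nonzero
    ((mk_mem_isotropicLines L.1.rep_nonzero).1 (L.1.mk_rep.symm ▸ L.2))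

/-- The affine chart of the conic with coordinate `s / t`, on the complement of one point. -/
theorem IsConicBasis.exists_chart (he : IsConicBasis B e) (h2 : (2 : k) ≠ 0) :
    ∃ ε : ↥{L : isotropicLines B | e.coord 2 L.1.rep ≠ 0} ≃ ↥(Set.univ : Set (Fin 1 → k)),
      IsMorphism (((projectiveSpace k V).sub (isotropicLines B)).sub
        {L : isotropicLines B | e.coord 2 L.1.rep ≠ 0})
        ((affineSpace k (Fin 1 → k)).sub Set.univ) ε ∧
      IsMorphism ((affineSpace k (Fin 1 → k)).sub Set.univ)
        (((projectiveSpace k V).sub (isotropicLines B)).sub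
          {L : isotropicLines B | e.coord 2 L.1.rep ≠ 0}) ε.symm ∧
      (∀ L, (ε L).1 0 = e.coord 1 L.1.1.rep / e.coord 2 L.1.1.rep) ∧
      ∀ L, L.1.1 = Projectivization.mk k (conicPoint e ((ε L).1 0) 1)
        (conicPoint_ne_zero e (Or.inr one_ne_zero)) := by
  have hne : ∀ s : k, conicPoint e s 1 ≠ 0 := fun s => conicPoint_ne_zero e (Or.inr one_ne_zero)
  have hcoord : ∀ s : k, e.coord 1 (conicPoint e s 1) / e.coord 2 (conicPoint e s 1) = s := by
    intro s
    obtain ⟨-, h1, h2⟩ := coord_conicPoint e s 1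
    rw [h1, h2, one_pow, div_one, mul_one]
  have hmem : ∀ s : k, Projectivization.mk k _ (hne s) ∈ isotropicLines B := fun s =>
    (mk_mem_isotropicLines (hne s)).2 (he.conicPoint_isotropic s 1)
  have hU : ∀ s : k, e.coord 2 (Projectivization.mk k _ (hne s)).rep ≠ 0 := fun s => by
    rw [apply_rep_ne_zero_iff, (coord_conicPoint e s 1).2.2, one_pow]
    exact one_ne_zero
  have hmk : ∀ L : ↥{L : isotropicLines B | e.coord 2 L.1.rep ≠ 0}, L.1.1 =
      Projectivization.mk k _ (hne (e.coord 1 L.1.1.rep / e.coord 2 L.1.1.rep)) := by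
    rintro ⟨L, hL⟩
    rw [Set.mem_ofPred_eq] at hL
    obtain ⟨s, t, hst, hx⟩ := he.exists_rep_eq h2 L
    obtain ⟨-, h1, h2⟩ := coord_conicPoint e s t
    have hL' : L.1 = Projectivization.mk k _ (conicPoint_ne_zero e hst) := by
      rw [← L.1.mk_rep]
      simp only [hx]
    rw [hx, h2] at hL
    have ht := ne_zero_pow two_ne_zero hL
    refine hL'.trans ((mk_conicPoint_eq_iff e hst (Or.inr one_ne_zero)).2 ?_)
    simp only [hx, h1, h2]
    field_simp
  refine ⟨⟨fun L => ⟨fun _ => e.coord 1 L.1.1.rep / e.coord 2 L.1.1.rep, trivial⟩,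
    fun c => ⟨⟨Projectivization.mk k _ (hne (c.1 0)), hmem _⟩, hU _⟩, fun L => ?_, fun c => ?_⟩,
    ?_, ?_, fun L => rfl, hmk⟩
  · exact Subtype.ext (Subtype.ext (hmk L).symm)
  · refine Subtype.ext (funext fun i => ?_)
    rw [Fin.fin_one_eq_zero i]
    exact (apply_rep_div_apply_rep (e.coord 1) (e.coord 2) (hne _)).trans (hcoord _)
  · refine .of_subtype_val (isMorphism_iff_morphismAt.2 fun L => .of_coordinates
      ((projectiveSpace_invertsUnits.sub _).sub _) fun i => ?_)
    exact ((isMorphism_subtype_val (projectiveSpace k V) (isotropicLines B)).comp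
      (isMorphism_subtype_val _ _)).2 _ L
      (regularAt_apply_rep_div (e.coord 1) (e.coord 2) (L := L.1.1) L.2)
  · refine .of_subtype_val (.of_subtype_val (isMorphism_iff_morphismAt.2 fun c => ?_))
    have hpoly : IsPolynomialMap (k := k) fun c : Fin 1 → k => conicPoint e (c 0) 1 :=
      isPolynomialMap_sum_smul (polynomialFunctions_pow (polynomialFunctions_proj 0) 2)
        (polynomialFunctions_mul (polynomialFunctions_proj 0) (polynomialFunctions_const 1))
        (polynomialFunctions_const (1 ^ 2)) _ _ _
    exact .of_lift (C := {x : V | x ≠ 0}) (π := (Projectivization.mk' k : _ → ℙ k V))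
      (isMorphism_iff_morphismAt.1 (hpoly.isMorphism.comp (isMorphism_subtype_val _ _)) c)
      (Eventually.of_forall fun c => ⟨hne _, rfl⟩)

theorem IsConicBasis.isProjectiveLine (he : IsConicBasis B e) (h2 : (2 : k) ≠ 0) :
    ((projectiveSpace k V).sub (isotropicLines B)).IsProjectiveLine := by
  have hpt : ∀ {c : Fin 2 → k}, c ≠ 0 → c 0 ≠ 0 ∨ c 1 ≠ 0 := fun {c} hc => by
    by_contra! h
    exact hc (by ext i; fin_cases i; exacts [h.1, h.2])
  have hpt' : ∀ {s t : k}, s ≠ 0 ∨ t ≠ 0 → ![s, t] ≠ 0 := fun {s t} h h0 => by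
    rcases h with h | h
    · exact h (congrFun h0 0)
    · exact h (congrFun h0 1)
  have hmem : ∀ {s t : k} (h : s ≠ 0 ∨ t ≠ 0),
      Projectivization.mk k _ (conicPoint_ne_zero e h) ∈ isotropicLines B := fun {s t} h =>
    (mk_mem_isotropicLines (conicPoint_ne_zero e h)).2 (he.conicPoint_isotropic s t)
  have hmk : ∀ {s t : k} (h : s ≠ 0 ∨ t ≠ 0) {c : Fin 2 → k} (hc : c ≠ 0),
      Projectivization.mk k _ (hpt' h) = Projectivization.mk k c hc ↔ s * c 1 = c 0 * t := by
    intro s t h c hc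
    rw [Projectivization.mk_eq_mk_iff']
    constructor
    · rintro ⟨a, ha⟩
      obtain rfl : a * c 0 = s := congrFun ha 0
      obtain rfl : a * c 1 = t := congrFun ha 1
      ring
    · intro h'
      obtain ⟨a, ha, ha'⟩ := exists_eq_mul_of_mul_eq_mul (hpt hc) h'
      exact ⟨a, by ext i; fin_cases i; exacts [ha.symm, ha'.symm]⟩
  -- the graph of the parametrization
  let R : isotropicLines B → ℙ k (Fin 2 → k) → Prop := fun L P => ∃ (s t : k) (h : s ≠ 0 ∨ t ≠ 0),
    L.1 = Projectivization.mk k _ (conicPoint_ne_zero e h) ∧ P = Projectivization.mk k _ (hpt' h)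
  obtain ⟨φ, hφ⟩ : ∃ φ : isotropicLines B ≃ ℙ k (Fin 2 → k), ∀ L P, R L P ↔ φ L = P := by
    refine exists_equiv_of_existsUnique (fun L => existsUnique_of_exists_of_unique ?_ ?_)
      fun P => existsUnique_of_exists_of_unique ?_ ?_
    · obtain ⟨s, t, h, hx⟩ := he.exists_rep_eq h2 L
      refine ⟨_, s, t, h, ?_, rfl⟩
      rw [← L.1.mk_rep]
      simp only [hx]
    · rintro _ _ ⟨s, t, h, hL, rfl⟩ ⟨s', t', h', hL', rfl⟩
      exact (hmk h (hpt' h')).2 ((mk_conicPoint_eq_iff e h h').1 (hL.symm.trans hL'))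
    · induction P with
      | h c hc =>
        exact ⟨⟨_, hmem (hpt hc)⟩, _, _, hpt hc, rfl, ((hmk (hpt hc) hc).2 rfl).symm⟩
    · rintro ⟨_, _⟩ ⟨_, _⟩ ⟨s, t, h, rfl, hP⟩ ⟨s', t', h', rfl, hP'⟩
      exact Subtype.ext ((mk_conicPoint_eq_iff e h h').2 ((hmk h (hpt' h')).1 (hP.symm.trans hP')))
  refine ⟨φ, ?_, ?_⟩
  · have key : IsMorphism ((projectiveSpace k V).sub (isotropicLines B))
        ((projectiveSpace k (Fin 2 → k)).sub Set.univ) fun L => ⟨φ L, trivial⟩ := by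
      refine HasLocalSections.isMorphism_of_charts (C' := {x : Fin 2 → k | x ≠ 0})
        (π' := (Projectivization.mk' k : _ → ℙ k (Fin 2 → k)))
        (projectiveSpace_hasLocalSections (k := k) (W := V)) ?_
      rintro ⟨x, hx⟩ hxQ
      have hparam : ∀ {x : V} (hx : x ≠ 0), Projectivization.mk k x hx ∈ isotropicLines B →
          ∃ s t : k, (s ≠ 0 ∨ t ≠ 0) ∧ x = conicPoint e s t := fun hx hxQ =>
        he.exists_eq_conicPoint h2 hx ((mk_mem_isotropicLines hx).1 hxQ)
      -- the parameter is read off from two consecutive coordinates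
      have hchart : ∀ ℓ ℓ' m : Module.Dual k V,
          (∀ s t : k, m (conicPoint e s t) ≠ 0 → ∃ a : k, a ≠ 0 ∧
            ℓ (conicPoint e s t) = a * s ∧ ℓ' (conicPoint e s t) = a * t) → m x ≠ 0 →
          ∃ q ∈ polynomialFunctions k V, q x ≠ 0 ∧ ∃ h : V → Fin 2 → k, IsPolynomialMap (k := k) h ∧
            ∀ (c' : {x : V | x ≠ 0}) (hc' : Projectivization.mk' k c' ∈ isotropicLines B),
              q c'.1 ≠ 0 → ∃ hh : h c'.1 ∈ {x : Fin 2 → k | x ≠ 0},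
                Projectivization.mk' k ⟨h c'.1, hh⟩ = φ ⟨Projectivization.mk' k c', hc'⟩ := by
        intro ℓ ℓ' m hm hmx
        refine ⟨m, dual_mem_polynomialFunctions m, hmx, fun x => ![ℓ x, ℓ' x],
          isPolynomialMap_pi fun i => ?_, ?_⟩
        · fin_cases i
          exacts [dual_mem_polynomialFunctions ℓ, dual_mem_polynomialFunctions ℓ']
        · rintro ⟨y, hy⟩ hyQ hq
          obtain ⟨s, t, h, rfl⟩ := hparam hy hyQ
          obtain ⟨a, ha, h1, h2⟩ := hm s t hq
          have hvec : ![ℓ (conicPoint e s t), ℓ' (conicPoint e s t)] = a • ![s, t] := by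
            rw [h1, h2]
            ext i
            fin_cases i <;> rfl
          have hne : ![ℓ (conicPoint e s t), ℓ' (conicPoint e s t)] ≠ 0 := by
            rw [hvec]
            exact smul_ne_zero ha (hpt' h)
          refine ⟨hne, ?_⟩
          rw [(hφ ⟨_, hyQ⟩ (Projectivization.mk k _ (hpt' h))).1 ⟨s, t, h, rfl, rfl⟩]
          exact (Projectivization.mk_eq_mk_iff' k _ _ _ _).2 ⟨a, hvec.symm⟩
      obtain ⟨s, t, h, rfl⟩ := hparam hx hxQ
      obtain ⟨h0, -, h2'⟩ := coord_conicPoint e s t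
      rcases h with h | h
      · refine hchart (e.coord 0) (e.coord 1) (e.coord 0) (fun s t hst => ?_) ?_
        · obtain ⟨h0, h1, -⟩ := coord_conicPoint e s t
          exact ⟨s, ne_zero_pow two_ne_zero (h0 ▸ hst), by rw [h0, pow_two], h1⟩
        · rw [h0]
          exact pow_ne_zero 2 h
      · refine hchart (e.coord 1) (e.coord 2) (e.coord 2) (fun s t hst => ?_) ?_
        · obtain ⟨-, h1, h2⟩ := coord_conicPoint e s t
          exact ⟨t, ne_zero_pow two_ne_zero (h2 ▸ hst), by rw [h1, mul_comm], by rw [h2, pow_two]⟩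
        · rw [h2']
          exact pow_ne_zero 2 h
    exact (isMorphism_subtype_val (projectiveSpace k (Fin 2 → k)) Set.univ).comp key
  · have key : IsMorphism ((projectiveSpace k (Fin 2 → k)).sub Set.univ)
        ((projectiveSpace k V).sub (isotropicLines B)) fun P => φ.symm P.1 := by
      refine HasLocalSections.isMorphism_of_charts (C' := {x : V | x ≠ 0})
        (π' := (Projectivization.mk' k : _ → ℙ k V))
        (projectiveSpace_hasLocalSections (k := k) (W := Fin 2 → k)) ?_
      intro c _
      refine ⟨fun _ => 1, polynomialFunctions_const 1, one_ne_zero,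
        fun c => conicPoint e (c 0) (c 1), isPolynomialMap_sum_smul
          (polynomialFunctions_pow (polynomialFunctions_proj 0) 2)
          (polynomialFunctions_mul (polynomialFunctions_proj 0) (polynomialFunctions_proj 1))
          (polynomialFunctions_pow (polynomialFunctions_proj 1) 2) _ _ _, ?_⟩
      rintro ⟨c, hc⟩ _ _
      refine ⟨conicPoint_ne_zero e (hpt hc), ?_⟩
      have := (hφ ⟨_, hmem (hpt hc)⟩ (Projectivization.mk k c hc)).1
        ⟨_, _, hpt hc, rfl, ((hmk (hpt hc) hc).2 rfl).symm⟩
      exact congrArg Subtype.val (φ.eq_symm_apply.2 this)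
    exact key.comp (isMorphism_sub_univ (projectiveSpace k (Fin 2 → k)))

end Conic

section Covering

open LinearMap (GeneralLinearGroup BilinForm)
open Module (Basis)
open FullFlag SpaceWithFunctions

variable {k : Type u} {V : Type v} [Field k] [AddCommGroup V] [Module k V]
  [Fact (Module.finrank k V = 3)] {B B' : BilinForm k V} {e f : Basis (Fin 3) k V}
  {α₀ α₁ β₀ β₁ : k}

/-- The projection `(L, P) ↦ L` to the first conic. -/
def conicProjection (B B' : BilinForm k V) (F : secantTangentFlags B B') : isotropicLines B :=
  ⟨F.1.L, F.2.1⟩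

theorem isMorphism_conicProjection (B B' : BilinForm k V) :
    IsMorphism ((variety k V).sub (secantTangentFlags B B'))
      ((projectiveSpace k V).sub (isotropicLines B)) (conicProjection B B') := by
  refine HasLocalSections.isMorphism_of_charts (C' := {x : V | x ≠ 0})
    (π' := (Projectivization.mk' k : _ → ℙ k V)) (hasLocalSections k V) fun c _ => ?_
  exact ⟨fun _ => 1, polynomialFunctions_const 1, one_ne_zero, Prod.fst,
    fun ℓ => dual_mem_polynomialFunctions (ℓ.comp (LinearMap.fst k V (Module.Dual k V))),
    fun c' _ _ => ⟨c'.2.1, rfl⟩⟩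

theorem FullFlag.variety_invertsUnits : (variety k V).InvertsUnits :=
  (affineSpace_invertsUnits.sub _).quotient

/-- The affine Weierstrass equation `y² + 2 (α₁ x + β₁) y = x³ + α₀ x² + β₀ x`. -/
theorem mk_mem_weierstrassPoints_frameCurve_iff {X : Fin 3 → k} (hX : X ≠ 0) (hX2 : X 2 ≠ 0) :
    Projectivization.mk k X hX ∈ weierstrassPoints (frameCurve α₀ α₁ β₀ β₁) ↔
      ![X 0 / X 2, X 1 / X 2] ∈ quadraticCurve (.C (2 * α₁) * .X + .C (2 * β₁))
        (.X ^ 3 + .C α₀ * .X ^ 2 + .C β₀ * .X) := by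
  rw [mk_mem_weierstrassPoints_frameCurve, quadraticCurve, Set.mem_ofPred_eq]
  simp
  field_simp
  constructor <;> intro h <;> linear_combination -h

/-- The affine chart of the Weierstrass curve, over the chart of the first conic. -/
theorem IsConicFrame.exists_chart [IsAlgClosed k] (h : IsConicFrame B B' e f α₀ α₁ β₀ β₁)
    (h2 : (2 : k) ≠ 0) (hs' : B'.IsSymm) (hB' : B'.Nondegenerate)
    (h4 : (isotropicLines B ∩ isotropicLines B').ncard = 4) {a b : Polynomial k}
    (ha : a = .C (2 * α₁) * .X + .C (2 * β₁))
    (hb : b = .X ^ 3 + .C α₀ * .X ^ 2 + .C β₀ * .X) {U : Set (isotropicLines B)}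
    (hU : U = {L : isotropicLines B | e.coord 2 L.1.rep ≠ 0}) :
    ∃ η : ↥(conicProjection B B' ⁻¹' U) ≃ ↥(quadraticCurve a b),
      IsMorphism (((variety k V).sub (secantTangentFlags B B')).sub (conicProjection B B' ⁻¹' U))
        ((affineSpace k (Fin 2 → k)).sub (quadraticCurve a b)) η ∧
      IsMorphism ((affineSpace k (Fin 2 → k)).sub (quadraticCurve a b))
        (((variety k V).sub (secantTangentFlags B B')).sub (conicProjection B B' ⁻¹' U)) η.symm ∧
      ∀ F, (η F).1 0 = e.coord 1 F.1.1.L.rep / e.coord 2 F.1.1.L.rep := by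
  subst hU
  obtain ⟨φ, hφ, hφ', hφL⟩ := h.exists_isomorphism h2 hs' hB' h4
  have hne : ∀ c : Fin 2 → k, ![c 0, c 1, 1] ≠ 0 := fun c h0 => one_ne_zero (congrFun h0 2)
  have hrep : ∀ F : secantTangentFlags B B',
      e.coord 1 F.1.L.rep * (φ F).1.rep 2 = e.coord 2 F.1.L.rep * (φ F).1.rep 0 ∧
        ((φ F).1.rep 2 = 0 ↔ e.coord 2 F.1.L.rep = 0) := fun F =>
    hφL F _ F.1.L.rep_nonzero _ (φ F).1.rep_nonzero F.1.L.mk_rep.symm (φ F).1.mk_rep.symm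
  have hW : ∀ c : quadraticCurve a b, Projectivization.mk k _ (hne c.1) ∈
      weierstrassPoints (frameCurve α₀ α₁ β₀ β₁) := fun c => by
    refine (mk_mem_weierstrassPoints_frameCurve_iff (hne c.1) one_ne_zero).2 ?_
    rw [← ha, ← hb]
    convert c.2 using 1
    ext i
    fin_cases i <;> simp
  have hU : ∀ c : quadraticCurve a b,
      φ.symm ⟨_, hW c⟩ ∈ conicProjection B B' ⁻¹' {L | e.coord 2 L.1.rep ≠ 0} := fun c => by
    change e.coord 2 (φ.symm ⟨_, hW c⟩).1.L.rep ≠ 0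
    rw [Ne, ← (hrep _).2, φ.apply_symm_apply]
    exact (apply_rep_ne_zero_iff (LinearMap.proj (φ := fun _ => k) (2 : Fin 3)) (hne c.1)).2
      one_ne_zero
  have hmem : ∀ F : ↥(conicProjection B B' ⁻¹' {L | e.coord 2 L.1.rep ≠ 0}),
      (φ F.1).1.rep 2 ≠ 0 := fun F => (not_congr (hrep F.1).2).2 F.2
  have hZ : ∀ F : ↥(conicProjection B B' ⁻¹' {L | e.coord 2 L.1.rep ≠ 0}),
      ![(φ F.1).1.rep 0 / (φ F.1).1.rep 2, (φ F.1).1.rep 1 / (φ F.1).1.rep 2] ∈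
        quadraticCurve a b := fun F => by
    rw [ha, hb]
    refine (mk_mem_weierstrassPoints_frameCurve_iff (φ F.1).1.rep_nonzero (hmem F)).1 ?_
    rw [(φ F.1).1.mk_rep]
    exact (φ F.1).2
  refine ⟨⟨fun F => ⟨_, hZ F⟩, fun c => ⟨_, hU c⟩, fun F => ?_, fun c => ?_⟩, ?_, ?_, fun F => ?_⟩
  · refine Subtype.ext (φ.symm_apply_eq.2 (Subtype.ext ?_))
    refine Eq.trans ?_ (φ F.1).1.mk_rep
    refine (Projectivization.mk_eq_mk_iff' k _ _ _ _).2 ⟨((φ F.1).1.rep 2)⁻¹, ?_⟩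
    have hz := hmem F
    ext i
    fin_cases i <;> simp [div_eq_inv_mul, hz]
  · have hr : ∀ i, (Projectivization.mk k _ (hne c.1)).rep i /
        (Projectivization.mk k _ (hne c.1)).rep 2 = ![c.1 0, c.1 1, 1] i / 1 := fun i =>
      apply_rep_div_apply_rep (LinearMap.proj (φ := fun _ => k) i)
        (LinearMap.proj (φ := fun _ => k) (2 : Fin 3)) (hne c.1)
    refine Subtype.ext ?_
    simp only [φ.apply_symm_apply, hr, div_one]
    ext i
    fin_cases i <;> rfl
  · refine .of_subtype_val (isMorphism_iff_morphismAt.2 fun F => .of_coordinates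
      ((FullFlag.variety_invertsUnits.sub _).sub _) fun i => ?_)
    have hm : IsMorphism (((variety k V).sub (secantTangentFlags B B')).sub
        (conicProjection B B' ⁻¹' {L | e.coord 2 L.1.rep ≠ 0})) (projectiveSpace k (Fin 3 → k))
        fun F => (φ F.1).1 :=
      (isMorphism_subtype_val (projectiveSpace k (Fin 3 → k)) _).comp
        (hφ.comp (isMorphism_subtype_val _ _))
    have hreg : ∀ j : Fin 3, (((variety k V).sub (secantTangentFlags B B')).sub
        (conicProjection B B' ⁻¹' {L | e.coord 2 L.1.rep ≠ 0})).RegularAt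
        (fun F => (φ F.1).1.rep j / (φ F.1).1.rep 2) F := fun j =>
      hm.2 _ F (regularAt_apply_rep_div (LinearMap.proj (φ := fun _ => k) j)
        (LinearMap.proj (φ := fun _ => k) (2 : Fin 3)) (hmem F))
    fin_cases i
    exacts [hreg 0, hreg 1]
  · have hpoly : IsPolynomialMap (k := k) fun c : Fin 2 → k => ![c 0, c 1, 1] :=
      isPolynomialMap_pi fun i => by
        fin_cases i
        exacts [polynomialFunctions_proj 0, polynomialFunctions_proj 1, polynomialFunctions_const 1]
    have hm : IsMorphism ((affineSpace k (Fin 2 → k)).sub (quadraticCurve a b))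
        ((projectiveSpace k (Fin 3 → k)).sub (weierstrassPoints (frameCurve α₀ α₁ β₀ β₁)))
        fun c => ⟨_, hW c⟩ :=
      .of_subtype_val (isMorphism_iff_morphismAt.2 fun c =>
        .of_lift (C := {x : Fin 3 → k | x ≠ 0})
          (π := (Projectivization.mk' k : _ → ℙ k (Fin 3 → k)))
          (isMorphism_iff_morphismAt.1 (hpoly.isMorphism.comp (isMorphism_subtype_val _ _)) c)
          (Eventually.of_forall fun c => ⟨hne _, rfl⟩))
    exact .of_subtype_val (hφ'.comp hm)
  · refine (div_eq_div_iff (hmem F) F.2).2 ?_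
    have := (hrep F.1).1
    change _ * e.coord 2 F.1.1.L.rep = _
    linear_combination -this

end Covering

section Branching

open LinearMap (GeneralLinearGroup BilinForm)
open Module (Basis)
open FullFlag SpaceWithFunctions

variable {k : Type u} {V : Type v} [Field k] [AddCommGroup V] [Module k V] [IsAlgClosed k]
  [Fact (Module.finrank k V = 3)] {B B' : BilinForm k V}

/-- The chart of the conic omits only the common point at which the frame is based, and there are
four such points to choose from. -/
theorem exists_isConicFrame_coord_ne_zero (h2 : (2 : k) ≠ 0)
    (hs : B.IsSymm) (hB : B.Nondegenerate) (hs' : B'.IsSymm) (hB' : B'.Nondegenerate)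
    (h4 : (isotropicLines B ∩ isotropicLines B').ncard = 4) (L : isotropicLines B) :
    ∃ (e f : Basis (Fin 3) k V) (α₀ α₁ β₀ β₁ : k), IsConicFrame B B' e f α₀ α₁ β₀ β₁ ∧
      e.coord 2 L.1.rep ≠ 0 := by
  obtain ⟨p, ⟨hp, hp'⟩, hpL⟩ := Set.exists_ne_of_one_lt_ncard (h4.symm ▸ by norm_num :
    1 < (isotropicLines B ∩ isotropicLines B').ncard) L.1
  induction p with
  | h x hx =>
    obtain ⟨e, f, α₀, α₁, β₀, β₁, a, h, ha, he⟩ := exists_isConicFrame h2 hs hB hs' hB' h4 hx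
      ((mk_mem_isotropicLines hx).1 hp) ((mk_mem_isotropicLines hx).1 hp')
    refine ⟨e, f, α₀, α₁, β₀, β₁, h, fun h0 => hpL ?_⟩
    obtain ⟨s, t, hst, hL⟩ := h.left.exists_rep_eq h2 L
    rw [hL, (coord_conicPoint e s t).2.2, pow_eq_zero_iff two_ne_zero] at h0
    rw [← L.1.mk_rep, eq_comm, Projectivization.mk_eq_mk_iff']
    refine ⟨s ^ 2 * a, ?_⟩
    rw [hL, h0, conicPoint, he, smul_smul]
    simp

theorem isDoubleCoverBranchedAt_conicProjection (h2 : (2 : k) ≠ 0)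
    (hs : B.IsSymm) (hB : B.Nondegenerate) (hs' : B'.IsSymm) (hB' : B'.Nondegenerate)
    (h4 : (isotropicLines B ∩ isotropicLines B').ncard = 4) :
    IsDoubleCoverBranchedAt ((variety k V).sub (secantTangentFlags B B'))
      ((projectiveSpace k V).sub (isotropicLines B)) (conicProjection B B')
      {L : isotropicLines B | L.1 ∈ isotropicLines B'} := by
  have key : ∀ L : isotropicLines B,
      (∃ U : Set ((projectiveSpace k V).sub (isotropicLines B)), IsOpen U ∧ L ∈ U ∧
        (((projectiveSpace k V).sub (isotropicLines B)).sub U).IsAffine ∧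
        (((variety k V).sub (secantTangentFlags B B')).sub
          (conicProjection B B' ⁻¹' U)).IsAffine ∧
        ∃ b : Fin 2 → (((variety k V).sub (secantTangentFlags B B')).sub
            (conicProjection B B' ⁻¹' U)).globalSections,
          ∀ h : (((variety k V).sub (secantTangentFlags B B')).sub
            (conicProjection B B' ⁻¹' U)).globalSections,
          ∃! c : Fin 2 → (((projectiveSpace k V).sub (isotropicLines B)).sub U).globalSections,
            ∀ x : ↥(conicProjection B B' ⁻¹' U),
              h.1 x = ∑ i, (c i).1 ⟨conicProjection B B' x.1, x.2⟩ * (b i).1 x) ∧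
      (L.1 ∈ isotropicLines B' → (conicProjection B B' ⁻¹' {L}).ncard = 1) ∧
      (L.1 ∉ isotropicLines B' → (conicProjection B B' ⁻¹' {L}).ncard = 2) := by
    intro L
    obtain ⟨e, f, α₀, α₁, β₀, β₁, h, hL⟩ :=
      exists_isConicFrame_coord_ne_zero h2 hs hB hs' hB' h4 L
    obtain ⟨ε, hε, hε', hε₁, hε₂⟩ := h.left.exists_chart h2
    obtain ⟨a, ha⟩ : ∃ a : Polynomial k, a = .C (2 * α₁) * .X + .C (2 * β₁) := ⟨_, rfl⟩
    obtain ⟨b, hb⟩ : ∃ b : Polynomial k, b = .X ^ 3 + .C α₀ * .X ^ 2 + .C β₀ * .X := ⟨_, rfl⟩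
    obtain ⟨η, hη, hη', hη₁⟩ := h.exists_chart h2 hs' hB' h4 ha hb rfl
    have hcompat : ∀ x : ↥(conicProjection B B' ⁻¹' {L | e.coord 2 L.1.rep ≠ 0}),
        (η x).1 0 = (ε ⟨conicProjection B B' x.1, x.2⟩).1 0 := fun x =>
      (hη₁ x).trans (hε₁ ⟨conicProjection B B' x.1, x.2⟩).symm
    have h4' : (4 : k) ≠ 0 := by
      rw [show (4 : k) = 2 * 2 by norm_num]
      exact mul_ne_zero h2 h2
    -- the discriminant is, up to a constant, the restriction of the second form to the first conic
    have hdisc : a ^ 2 + 4 * b ≠ 0 := by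
      have : a ^ 2 + 4 * b = .C 4 * .X ^ 3 + .C (4 * (α₀ + α₁ ^ 2)) * .X ^ 2 +
          .C (4 * (β₀ + 2 * α₁ * β₁)) * .X + .C (4 * β₁ ^ 2) := by
        rw [ha, hb]
        simp only [map_mul, map_add, map_pow, map_ofNat]
        ring
      rw [this, ← Polynomial.leadingCoeff_ne_zero, Polynomial.leadingCoeff_cubic h4']
      exact h4'
    have hdisc' : ∀ s, a.eval s ^ 2 + 4 * b.eval s =
        2 * B' (conicPoint e s 1) (conicPoint e s 1) := fun s => by
      rw [h.apply_conicPoint, ha, hb]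
      simp
      ring
    have hbranch : L.1 ∈ isotropicLines B' ↔
        a.eval ((ε ⟨L, hL⟩).1 0) ^ 2 + 4 * b.eval ((ε ⟨L, hL⟩).1 0) = 0 := by
      rw [hdisc', mul_eq_zero, or_iff_right h2]
      have hL' := hε₂ ⟨L, hL⟩
      exact (iff_of_eq (congrArg (· ∈ isotropicLines B') hL')).trans (mk_mem_isotropicLines _)
    refine ⟨⟨{L : isotropicLines B | e.coord 2 L.1.rep ≠ 0},
      (isOpen_apply_rep_ne_zero (e.coord 2)).preimage
        (isMorphism_subtype_val (projectiveSpace k V) (isotropicLines B)).1, hL,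
      ⟨1, Set.univ, isClosed_univ, ε, hε, hε'⟩,
      ⟨2, quadraticCurve a b, isClosed_quadraticCurve a b, η, hη, hη'⟩,
      exists_basis_of_charts h2 hdisc hη hη' hε hε' hcompat⟩, fun hL' => ?_, fun hL' => ?_⟩
    · exact (ncard_fibre_of_charts (X := (variety k V).sub (secantTangentFlags B B'))
        (Y := (projectiveSpace k V).sub (isotropicLines B)) hcompat hL rfl).trans
        ((ncard_quadratic_roots h2 _ _).1 (hbranch.1 hL'))
    · exact (ncard_fibre_of_charts (X := (variety k V).sub (secantTangentFlags B B'))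
        (Y := (projectiveSpace k V).sub (isotropicLines B)) hcompat hL rfl).trans
        ((ncard_quadratic_roots h2 _ _).2 (mt hbranch.2 hL'))
  exact ⟨⟨isMorphism_conicProjection B B', fun L => (key L).1⟩, fun L hL => (key L).2.1 hL,
    fun L hL => (key L).2.2 hL⟩

theorem isEllipticCurve_secantTangentFlags (h2 : (2 : k) ≠ 0)
    (hs : B.IsSymm) (hB : B.Nondegenerate) (hs' : B'.IsSymm) (hB' : B'.Nondegenerate)
    (h4 : (isotropicLines B ∩ isotropicLines B').ncard = 4) :
    ((variety k V).sub (secantTangentFlags B B')).IsEllipticCurve := by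
  obtain ⟨L, hL, -⟩ := Set.nonempty_of_ncard_ne_zero (s := isotropicLines B ∩ isotropicLines B')
    (by rw [h4]; exact four_ne_zero)
  obtain ⟨e, f, α₀, α₁, β₀, β₁, h, -⟩ :=
    exists_isConicFrame_coord_ne_zero h2 hs hB hs' hB' h4 ⟨L, hL⟩
  obtain ⟨φ, hφ, hφ', -⟩ := h.exists_isomorphism h2 hs' hB' h4
  exact ⟨_, h.isElliptic h2 h4, φ, hφ, hφ'⟩

/-- The flags with `P` not tangent to the first conic and `L` not on the second one. Apart from
them, only the class of flags satisfying neither condition has to be excluded: it is empty. -/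
theorem flagOrbit_one_inter_two (h2 : (2 : k) ≠ 0)
    (hs : B.IsSymm) (hB : B.Nondegenerate) (hs' : B'.IsSymm) (hB' : B'.Nondegenerate)
    (h4 : (isotropicLines B ∩ isotropicLines B').ncard = 4) :
    flagOrbit B 1 ∩ flagOrbit B' 2 = secantTangentFlags B B' \
      ((flagOrbit B 1 ∩ flagOrbit B' 0) ∪ (flagOrbit B 0 ∩ flagOrbit B' 2)) := by
  ext F
  have h00 : F ∈ flagOrbit B 0 → F ∉ flagOrbit B' 0 :=
    disjoint_flagOrbit_zero h2 hs hB hs' hB' h4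
  simp only [flagOrbit, secantTangentFlags, Set.mem_sdiff, Set.mem_union, Set.mem_inter_iff,
    Matrix.cons_val, Set.mem_ofPred_eq] at h00 ⊢
  tauto

theorem ncard_union_flagOrbit (h2 : (2 : k) ≠ 0)
    (hs : B.IsSymm) (hB : B.Nondegenerate) (hs' : B'.IsSymm) (hB' : B'.Nondegenerate)
    (h4 : (isotropicLines B ∩ isotropicLines B').ncard = 4) :
    ((flagOrbit B 1 ∩ flagOrbit B' 0) ∪ (flagOrbit B 0 ∩ flagOrbit B' 2)).ncard = 8 := by
  have h1 := ncard_flagOrbit_one_inter_zero h2 hs hB hs' hB' h4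
  have h2 := ncard_flagOrbit_zero_inter_two h2 hs hB hs' hB' h4
  rw [Set.ncard_union_eq ?_ (Set.finite_of_ncard_ne_zero (by rw [h1]; exact four_ne_zero))
    (Set.finite_of_ncard_ne_zero (by rw [h2]; exact four_ne_zero)), h1, h2]
  refine Set.disjoint_left.2 ?_
  rintro F ⟨hF, -⟩ ⟨hF', -⟩
  exact hF.2 hF'.2

end Branching

theorem mainTheorem9 {k : Type u} [Field k] [IsAlgClosed k] (h2 : (2 : k) ≠ 0)
    {V : Type v} [AddCommGroup V] [Module k V] [Fact (Module.finrank k V = 3)]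
    (B : LinearMap.BilinForm k V) (hB : B.IsSymm) (hB' : B.Nondegenerate) :
    -- `𝒪₀, …, 𝒪₃` are the four `SO(V)`-orbits on the flag variety
    (Function.Injective (flagOrbit B) ∧
      Set.range (fun F : FullFlag k V => MulAction.orbit (specialOrthogonal B) F) =
        Set.range (flagOrbit B)) ∧
    -- closures of `𝒪₁` and `𝒪₂`
    flagOrbitClosure B 1 = {F | F.L ∈ isotropicLines B} ∧
    flagOrbitClosure B 2 = {F | IsTangentPlane B F.P} ∧
    -- there are `g` for which `Q` and `gQ` meet in four points
    (∃ g : LinearMap.GeneralLinearGroup k V,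
      (isotropicLines B ∩ g • isotropicLines B).ncard = 4) ∧
    -- for each of them:
    ∀ g : LinearMap.GeneralLinearGroup k V,
      (isotropicLines B ∩ g • isotropicLines B).ncard = 4 →
      -- the intersection `E` of the closure of `𝒪₁` and the translate of that of `𝒪₂` is an
      -- elliptic curve
      ((FullFlag.variety k V).sub
        (flagOrbitClosure B 1 ∩ g • flagOrbitClosure B 2)).IsEllipticCurve ∧
      -- `Q` is a projective line, and `(L, P) ↦ L` is a double covering `E → Q` branched at the
      -- four points of `Q ∩ gQ`
      ((SpaceWithFunctions.projectiveSpace k V).sub (isotropicLines B)).IsProjectiveLine ∧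
      (∃ π : ↥(flagOrbitClosure B 1 ∩ g • flagOrbitClosure B 2) → ↥(isotropicLines B),
        (∀ F, (π F).1 = F.1.L) ∧
        SpaceWithFunctions.IsDoubleCoverBranchedAt
          ((FullFlag.variety k V).sub (flagOrbitClosure B 1 ∩ g • flagOrbitClosure B 2))
          ((SpaceWithFunctions.projectiveSpace k V).sub (isotropicLines B))
          π {L | L.1 ∈ g • isotropicLines B}) ∧
      -- `𝒪₁ ∩ g𝒪₂` is `E` with eight points removed: the four points of `𝒪₁ ∩ g𝒪₀` and the
      -- four points of `𝒪₀ ∩ g𝒪₂`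
      (flagOrbit B 1 ∩ g • flagOrbit B 0).ncard = 4 ∧
      (flagOrbit B 0 ∩ g • flagOrbit B 2).ncard = 4 ∧
      ∃ S ⊆ flagOrbitClosure B 1 ∩ g • flagOrbitClosure B 2,
        S.ncard = 8 ∧ S = (flagOrbit B 1 ∩ g • flagOrbit B 0) ∪ (flagOrbit B 0 ∩ g • flagOrbit B 2) ∧
        flagOrbit B 1 ∩ g • flagOrbit B 2 =
          (flagOrbitClosure B 1 ∩ g • flagOrbitClosure B 2) \ S := by
  have hO : ∀ (g : LinearMap.GeneralLinearGroup k V) i,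
      g • flagOrbit B i = flagOrbit (B.comp g⁻¹.1 g⁻¹.1) i := smul_flagOrbit hB hB'
  refine ⟨flagOrbit_injective_and_range h2 hB hB', flagOrbitClosure_one h2 hB hB',
    flagOrbitClosure_two h2 hB hB', exists_ncard_inter_eq_four h2 hB hB', fun g h4 => ?_⟩
  have hE : flagOrbitClosure B 1 ∩ g • flagOrbitClosure B 2 =
      secantTangentFlags B (B.comp g⁻¹.1 g⁻¹.1) := by
    rw [flagOrbitClosure_one h2 hB hB', flagOrbitClosure_two h2 hB hB', smul_isTangentPlane hB hB']
    rfl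
  rw [smul_isotropicLines] at h4 ⊢
  rw [hO, hO]
  have hgs := isSymm_comp hB g
  have hgn := nondegenerate_comp hB' g
  obtain ⟨e, he⟩ := exists_isConicBasis h2 hB hB'
  have hcover : ∀ E : Set (FullFlag k V), E = secantTangentFlags B (B.comp g⁻¹.1 g⁻¹.1) →
      ((FullFlag.variety k V).sub E).IsEllipticCurve ∧
      ∃ π : ↥E → ↥(isotropicLines B), (∀ F, (π F).1 = F.1.L) ∧
        SpaceWithFunctions.IsDoubleCoverBranchedAt ((FullFlag.variety k V).sub E)
          ((SpaceWithFunctions.projectiveSpace k V).sub (isotropicLines B)) π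
          {L : isotropicLines B | L.1 ∈ isotropicLines (B.comp g⁻¹.1 g⁻¹.1)} := by
    rintro _ rfl
    exact ⟨isEllipticCurve_secantTangentFlags h2 hB hB' hgs hgn h4, conicProjection _ _,
      fun _ => rfl, isDoubleCoverBranchedAt_conicProjection h2 hB hB' hgs hgn h4⟩
  refine ⟨(hcover _ hE).1, he.isProjectiveLine h2, (hcover _ hE).2,
    ncard_flagOrbit_one_inter_zero h2 hB hB' hgs hgn h4,
    ncard_flagOrbit_zero_inter_two h2 hB hB' hgs hgn h4, _, ?_,
    ncard_union_flagOrbit h2 hB hB' hgs hgn h4, rfl,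
    (flagOrbit_one_inter_two h2 hB hB' hgs hgn h4).trans (congrArg (· \ _) hE.symm)⟩
  rw [hE]
  rintro F (⟨hF, hF'⟩ | ⟨hF, hF'⟩)
  exacts [⟨hF.1, hF'.2⟩, ⟨hF.1, hF'.2⟩]
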